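/- **Setting.** Let $\Lambda_h=\mathbb Z\mathbf v_1\oplus\mathbb Z\mathbf v_2\subset\mathbb R^2$ with $\mathbf v_1=(\tfrac{\sqrt3}2,\tfrac12)$, $\mathbf v_2=(\tfrac{\sqrt3}2,-\tfrac12)$, and $\Lambda_h^*=\mathbb Z\mathbf k_1\oplus\mathbb Z\mathbf k_2$ with $\mathbf k_1=\tfrac{4\pi}{\sqrt3}(\tfrac12,\tfrac{\sqrt3}2)$, $\mathbf k_2=\tfrac{4\pi}{\sqrt3}(\tfrac12,-\tfrac{\sqrt3}2)$. Let $\Omega_h$ be the period cell spanned by $\mathbf v_1,\mathbf v_2$, let $\mathcal B_h$ be the closed Brillouin zone (the regular hexagon of the points at least as close to $0$ as to any other point of $\Lambda_h^*$), and put $\mathbf K=\tfrac13(\mathbf k_1-\mathbf k_2)$, $\mathbf K'=-\mathbf K$. Let $R$ be the clockwise rotation of the plane by $120^\circ$, $\tau=e^{2\pi i/3}$, and $(\mathcal Cf)(\mathbf x)=\overline{f(\mathbf x)}$, $(\mathcal Pf)(\mathbf x)=f(-\mathbf x)$, $(\mathcal Rf)(\mathbf x)=f(R^*\mathbf x)$.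 Let $L^2_{\mathbf k}$ be the space of $f\in L^2_{loc}(\mathbb R^2)$ with $f(\mathbf x+\mathbf v)=e^{i\mathbf k\cdot\mathbf v}f(\mathbf x)$ for all $\mathbf v\in\Lambda_h$, with $\langle f,g\rangle=\int_{\Omega_h}\overline f g$, and for $\mathbf k=\mathbf K_\star$ a vertex of $\mathcal B_h$ let $L^2_{\mathbf K_\star,\sigma}=\{f\in L^2_{\mathbf K_\star}:\mathcal Rf=\sigma f\}$, $\sigma\in\{1,\tau,\bar\tau\}$. A *honeycomb structured medium* is a smooth, Hermitian, $\Lambda_h$-periodic, uniformly elliptic $2\times2$ complex matrix function $A$ on $\mathbb R^2$ for which $\mathcal L^A=-\nabla\cdot A\nabla$ commutes with $\mathcal{PC}$ and with $\mathcal R$. An $L^2_{\mathbf k}$-eigenpair $(E,\Phi)$ of $\mathcal L^A$ is a weak solution $0\ne\Phi\in L^2_{\mathbf k}\cap H^1_{loc}$ of $\mathcal L^A\Phi=E\Phi$ with $E\in\mathbb R$; multiplicities are dimensions of eigenspaces, and an $L^2_{\mathbf k,\sigma}$-eigenvalue is one with an eigenfunction in $L^2_{\mathbf k,\sigma}$.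 Let $\mathscr A=A\tfrac1i\nabla+\tfrac1i\nabla\cdot A$, with components $\mathscr A_jf=\sum_l\big(a_{jl}\tfrac1i\partial_lf+\tfrac1i\partial_l(a_{lj}f)\big)$, and put $$\upsilon_F(\Phi_1,\Phi_2)=\tfrac12\left|\overline{\langle\Phi_1,\mathscr A\Phi_2\rangle}\cdot\begin{pmatrix}1\\ i\end{pmatrix}\right| ,\qquad (a_1,a_2)\cdot(1,i)=a_1+ia_2 .$$ The pair $(\mathbf K_\star,E_D)\in\mathcal B_h\times\mathbb R$ is a *Dirac point with modes $\Phi_1,\Phi_2$ and slope $\upsilon>0$* if: for all $\mathbf k\in\mathbb R^2$ the $L^2_{\mathbf k}$-eigenvalues of $\mathcal L^A$ can be listed with multiplicity as $E_1(\mathbf k)\le E_2(\mathbf k)\le\cdots\to\infty$, with eigenfunctions $\Phi_b(\cdot;\mathbf k)$ that form a complete orthonormal system of $L^2_{\mathbf k}$; for some $b_\star\ge1$, $E_D=E_{b_\star}(\mathbf K_\star)=E_{b_\star+1}(\mathbf K_\star)$ is an $L^2_{\mathbf K_\star}$-eigenvalue of multiplicity exactly two; $\Phi_1\in L^2_{\mathbf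 K_\star,\tau}$, $\Phi_2=\mathcal{PC}\Phi_1\in L^2_{\mathbf K_\star,\bar\tau}$ form an orthonormal basis of its eigenspace; and there are $\zeta_0>0$, $C$ and Lipschitz functions $e_\pm$ on $|\mathbf k-\mathbf K_\star|<\zeta_0$ with $|e_\pm(\mathbf k)|\le C|\mathbf k-\mathbf K_\star|$ and $$E_{b_\star+1}(\mathbf k)-E_D=+\upsilon|\mathbf k-\mathbf K_\star|(1+e_+(\mathbf k)),\qquad E_{b_\star}(\mathbf k)-E_D=-\upsilon|\mathbf k-\mathbf K_\star|(1+e_-(\mathbf k)).$$ **Theorem.** Let $A$ define a honeycomb structured medium. 1. Let $\mathbf K_\star$ be a vertex of $\mathcal B_h$ and $E_D\in\mathbb R$. Suppose that $E_D$ is an $L^2_{\mathbf K_\star,\tau}$-eigenvalue of $\mathcal L^A$ of multiplicity one, with an eigenfunction $\Phi_1$ of norm one, and an $L^2_{\mathbf K_\star,\bar\tau}$-eigenvalue of multiplicity one, with eigenfunction $\Phi_2=\mathcal{PC}\Phi_1$; that $E_D$ is not an $L^2_{\mathbf K_\star,1}$-eigenvalue; and that $\upsilon_F=\upsilon_F(\Phi_1,\Phi_2)>0$.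 Then $(\mathbf K_\star,E_D)$ is a Dirac point with modes $\Phi_1,\Phi_2$ and slope $\upsilon_F$. 2. Suppose in addition that $A$ is real-valued. Then: (i) $(E,\Phi)$ is an $L^2_{\mathbf K}$-eigenpair of $\mathcal L^A$ if and only if $(E,\mathcal C\Phi)$ is an $L^2_{\mathbf K'}$-eigenpair. (ii) $(\mathbf K,E_D)$ is a Dirac point with modes $\Phi_1$, $\Phi_2=\mathcal{PC}\Phi_1$ and slope $\upsilon$ if and only if $(\mathbf K',E_D)$ is a Dirac point with modes $\mathcal C\Phi_2$, $\mathcal C\Phi_1$ and slope $\upsilon$. (iii) For $\mathbf K_\star\in\{\mathbf K,\mathbf K'\}$ and $j\ge0$, the $L^2_{R^j\mathbf K_\star}$-eigenpairs are exactly the $L^2_{\mathbf K_\star}$-eigenpairs, and if $(E,\Phi)$ is an $L^2_{\mathbf K_\star}$-eigenpair then so is $(E,\mathcal R^j\Phi)$. (iv) If $(\mathbf K,E_D)$ is a Dirac point with modes $\Phi_1$, $\Phi_2=\mathcal{PC}\Phi_1$, then $\upsilon_F(\Phi_1,\Phi_2)=\upsilon_F(\mathcal C\Phi_2,\mathcal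 C\Phi_1)$; that is, $\upsilon_F^{\mathbf K}=\upsilon_F^{\mathbf K'}$. -/

import Mathlib

open MeasureTheory Filter Topology Complex
open scoped ContDiff ComplexConjugate

noncomputable section

namespace Honeycomb

/-- The plane with its Euclidean norm (position space and quasi-momentum space). -/
abbrev Plane : Type := EuclideanSpace ℝ (Fin 2)

/-- Complex functions on the plane modulo equality almost everywhere. -/
abbrev Fn : Type := Plane →ₘ[(volume : Measure Plane)] ℂ

/-! ### The equilateral triangular lattice, its dual, the Brillouin zone -/

def v₁ : Plane := !₂[√3 / 2, 1 / 2]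

def v₂ : Plane := !₂[√3 / 2, -(1 / 2)]

def k₁ : Plane := (4 * Real.pi / √3) • !₂[1 / 2, √3 / 2]

def k₂ : Plane := (4 * Real.pi / √3) • !₂[1 / 2, -(√3 / 2)]

/-- The lattice `ℤ v₁ ⊕ ℤ v₂`. -/
def lattice : Set Plane := {v | ∃ m n : ℤ, v = (m : ℝ) • v₁ + (n : ℝ) • v₂}

/-- The dual lattice `ℤ k₁ ⊕ ℤ k₂`. -/
def dualLattice : Set Plane := {g | ∃ m n : ℤ, g = (m : ℝ) • k₁ + (n : ℝ) • k₂}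

/-- The fundamental period cell. -/
def cell : Set Plane :=
  {x | ∃ s t : ℝ, s ∈ Set.Icc (0 : ℝ) 1 ∧ t ∈ Set.Icc (0 : ℝ) 1 ∧ x = s • v₁ + t • v₂}

/-- The (closed) Brillouin zone: the points at least as close to the origin as to any other
point of the dual lattice. It is a regular hexagon. -/
def brillouinZone : Set Plane := {k | ∀ g ∈ dualLattice, ‖k‖ ≤ ‖k - g‖}

/-- The vertices of the Brillouin zone, as extreme points of this convex polygon. -/
def brillouinVertices : Set Plane := brillouinZone.extremePoints ℝ

/-- The vertex `K`; the vertex `K'` is `-K`. -/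
def pointK : Plane := (1 / 3 : ℝ) • (k₁ - k₂)

/-! ### The symmetries -/

private theorem sq3 : √3 * √3 = (3 : ℝ) := Real.mul_self_sqrt (by norm_num)

/-- The clockwise rotation `R` by 120 degrees about the origin; `R.symm` is `R*`. -/
def R : Plane ≃ₗᵢ[ℝ] Plane where
  toFun x := !₂[-(1 / 2) * x 0 + √3 / 2 * x 1, -(√3 / 2) * x 0 - 1 / 2 * x 1]
  invFun x := !₂[-(1 / 2) * x 0 - √3 / 2 * x 1, √3 / 2 * x 0 - 1 / 2 * x 1]
  map_add' x y := by ext i; fin_cases i <;> simp <;> ring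
  map_smul' c x := by ext i; fin_cases i <;> simp <;> ring
  left_inv x := by
    ext i; fin_cases i <;> simp
    · linear_combination (x 0 / 4) * sq3
    · linear_combination (x 1 / 4) * sq3
  right_inv x := by
    ext i; fin_cases i <;> simp
    · linear_combination (x 0 / 4) * sq3
    · linear_combination (x 1 / 4) * sq3
  norm_map' x := by
    simp only [EuclideanSpace.norm_eq, Fin.sum_univ_two, Real.norm_eq_abs, sq_abs]
    congr 1
    simp
    linear_combination ((x 0 ^ 2 + x 1 ^ 2) / 4) * sq3

/-- `τ = exp(2πi/3)`. -/
def τ : ℂ := Complex.exp (2 * Real.pi * Complex.I / 3)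

/-- Complex conjugation `(C f)(x) = conj (f x)`. -/
def opC (f : Fn) : Fn := f.comp (fun z => conj z) Complex.continuous_conj

/-- Parity inversion `(P f)(x) = f (-x)`. -/
def opP (f : Fn) : Fn :=
  f.compMeasurePreserving (fun x => -x) (Measure.measurePreserving_neg volume)

/-- `(PC f)(x) = conj (f (-x))`. -/
def opPC (f : Fn) : Fn := opP (opC f)

/-- The rotation operator `(R f)(x) = f (R* x)`. -/
def opR (f : Fn) : Fn :=
  f.compMeasurePreserving R.symm R.symm.measurePreserving

/-! ### Honeycomb structured media -/

/-- The partial derivative with respect to the coordinate `j`. -/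
def pd (j : Fin 2) (f : Plane → ℂ) (x : Plane) : ℂ :=
  fderiv ℝ f x (EuclideanSpace.single j 1)

/-- The differential expression `-∇ · A ∇ f`, for smooth `f`. -/
def divForm (A : Plane → Matrix (Fin 2) (Fin 2) ℂ) (f : Plane → ℂ) (x : Plane) : ℂ :=
  -∑ i, pd i (fun y => ∑ j, A y i j * pd j f y) x

/-- `A` defines a honeycomb structured medium: it is smooth, Hermitian, periodic with respect to
the triangular lattice, uniformly elliptic, and `-∇ · A ∇` commutes with `PC` and with the
rotation by 120 degrees. -/
structure IsHoneycombMedium (A : Plane → Matrix (Fin 2) (Fin 2) ℂ) : Prop where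
  smooth : ∀ i j, ContDiff ℝ ∞ (fun x => A x i j)
  hermitian : ∀ x, (A x).IsHermitian
  periodic : ∀ x, ∀ v ∈ lattice, A (x + v) = A x
  elliptic : ∃ c C : ℝ, 0 < c ∧ 0 < C ∧ ∀ (x : Plane) (ξ : Fin 2 → ℂ),
    c * ∑ i, ‖ξ i‖ ^ 2 ≤ (star ξ ⬝ᵥ (A x).mulVec ξ).re ∧
    (star ξ ⬝ᵥ (A x).mulVec ξ).re ≤ C * ∑ i, ‖ξ i‖ ^ 2
  comm_PC : ∀ f : Plane → ℂ, ContDiff ℝ ∞ f →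
    divForm A (fun x => conj (f (-x))) = fun x => conj (divForm A f (-x))
  comm_R : ∀ f : Plane → ℂ, ContDiff ℝ ∞ f →
    divForm A (fun x => f (R.symm x)) = fun x => divForm A f (R.symm x)

/-- `A` is real-valued. -/
def IsRealValued (A : Plane → Matrix (Fin 2) (Fin 2) ℂ) : Prop := ∀ x i j, (A x i j).im = 0

/-! ### Pseudo-periodic functions -/

/-- Locally square integrable functions. -/
def LocL2 (f : Plane → ℂ) : Prop := ∀ S : Set Plane, IsCompact S → MemLp f 2 (volume.restrict S)

/-- The `L²` inner product over the fundamental cell, antilinear in the first argument. -/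
def ip (f g : Plane → ℂ) : ℂ := ∫ x in cell, conj (f x) * g x

theorem LocL2.congr {f g : Plane → ℂ} (hf : LocL2 f) (h : g =ᵐ[volume] f) : LocL2 g :=
  fun S hS => (memLp_congr_ae (ae_restrict_of_ae h)).2 (hf S hS)

theorem LocL2.add {f g : Plane → ℂ} (hf : LocL2 f) (hg : LocL2 g) :
    LocL2 (fun x => f x + g x) :=
  fun S hS => (hf S hS).add (hg S hS)

theorem LocL2.const_mul {f : Plane → ℂ} (hf : LocL2 f) (c : ℂ) :
    LocL2 (fun x => c * f x) :=
  fun S hS => (hf S hS).const_mul c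

theorem LocL2.zero : LocL2 (fun _ => 0) :=
  fun _ _ => MemLp.zero

theorem LocL2.locallyIntegrable {f : Plane → ℂ} (hf : LocL2 f) :
    LocallyIntegrable f volume := by
  rw [locallyIntegrable_iff]
  intro S hS
  have : IsFiniteMeasure (volume.restrict S : Measure Plane) :=
    ⟨by simpa using hS.measure_lt_top⟩
  exact (hf S hS).integrable (by norm_num)

theorem coeFn_add' (f g : Fn) : ∀ᵐ x ∂(volume : Measure Plane), (f + g) x = f x + g x :=
  AEEqFun.coeFn_add f g

theorem coeFn_smul' (c : ℂ) (f : Fn) : ∀ᵐ x ∂(volume : Measure Plane), (c • f) x = c * f x :=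
  AEEqFun.coeFn_smul c f

theorem coeFn_zero' : ∀ᵐ x ∂(volume : Measure Plane), (0 : Fn) x = 0 :=
  AEEqFun.coeFn_zero

theorem ae_shift {p : Plane → Prop} (h : ∀ᵐ x ∂(volume : Measure Plane), p x) (v : Plane) :
    ∀ᵐ x ∂(volume : Measure Plane), p (x + v) :=
  (measurePreserving_add_right volume v).quasiMeasurePreserving.ae h

/-- The space `L²_k` of locally square integrable, `k`-pseudo-periodic functions. -/
def L2k (k : Plane) : Submodule ℂ Fn where
  carrier := {f | LocL2 f ∧ ∀ v ∈ lattice, ∀ᵐ x ∂(volume : Measure Plane),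
    f (x + v) = Complex.exp (Complex.I * (inner ℝ k v : ℝ)) * f x}
  zero_mem' := by
    refine ⟨LocL2.zero.congr coeFn_zero', fun v _ => ?_⟩
    filter_upwards [coeFn_zero', ae_shift coeFn_zero' v] with x h₁ h₂
    rw [h₁, h₂, mul_zero]
  add_mem' := by
    rintro f g ⟨hf, hf'⟩ ⟨hg, hg'⟩
    refine ⟨(hf.add hg).congr (coeFn_add' f g), fun v hv => ?_⟩
    filter_upwards [coeFn_add' f g, ae_shift (coeFn_add' f g) v, hf' v hv, hg' v hv]
      with x h₁ h₂ h₃ h₄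
    rw [h₁, h₂, h₃, h₄, mul_add]
  smul_mem' := by
    rintro c f ⟨hf, hf'⟩
    refine ⟨(hf.const_mul c).congr (coeFn_smul' c f), fun v hv => ?_⟩
    filter_upwards [coeFn_smul' c f, ae_shift (coeFn_smul' c f) v, hf' v hv] with x h₁ h₂ h₃
    rw [h₁, h₂, h₃]; ring

theorem opR_add (f g : Fn) : opR (f + g) = opR f + opR g := by
  induction f using AEEqFun.induction_on with | _ f hf => ?_
  induction g using AEEqFun.induction_on with | _ g hg => ?_
  rfl

theorem opR_smul (c : ℂ) (f : Fn) : opR (c • f) = c • opR f := by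
  induction f using AEEqFun.induction_on with | _ f hf => ?_
  rfl

/-- The space `L²_{k,σ}` of the `f` in `L²_k` with `R f = σ f`. -/
def L2kσ (k : Plane) (σ : ℂ) : Submodule ℂ Fn where
  carrier := {f | f ∈ L2k k ∧ opR f = σ • f}
  zero_mem' := by
    refine ⟨(L2k k).zero_mem, ?_⟩
    have h := opR_add 0 0
    rw [smul_zero]
    simpa using h
  add_mem' := by
    rintro f g ⟨hf, hf'⟩ ⟨hg, hg'⟩
    exact ⟨(L2k k).add_mem hf hg, by rw [opR_add, hf', hg', smul_add]⟩
  smul_mem' := by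
    rintro c f ⟨hf, hf'⟩
    exact ⟨(L2k k).smul_mem c hf, by rw [opR_smul, hf', smul_comm]⟩

/-! ### Weak solutions, eigenspaces -/

/-- Test functions: smooth and compactly supported. -/
def IsTest (φ : Plane → ℂ) : Prop := ContDiff ℝ ∞ φ ∧ HasCompactSupport φ

/-- `g` is a weak gradient of `f`, with locally square integrable components. -/
def IsWeakGrad (f : Plane → ℂ) (g : Fin 2 → Plane → ℂ) : Prop :=
  ∀ j, LocL2 (g j) ∧ ∀ φ, IsTest φ → ∫ x, f x * pd j φ x = -∫ x, g j x * φ x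

/-- The flux `A g`, the vector with the components `∑ j, A i j * g j`. -/
def flux (A : Plane → Matrix (Fin 2) (Fin 2) ℂ) (g : Fin 2 → Plane → ℂ) (i : Fin 2)
    (x : Plane) : ℂ := ∑ j, A x i j * g j x

/-- `-∇ · (A ∇ f) = E f` in the weak sense: `f` has a weak gradient `g` in `L²_loc`, the flux `A g`
is in `L²_loc` (which is automatic for continuous `A`), and the equation holds after
integration against test functions. -/
def IsWeakSol (A : Plane → Matrix (Fin 2) (Fin 2) ℂ) (E : ℝ) (f : Plane → ℂ) : Prop :=
  ∃ g : Fin 2 → Plane → ℂ, IsWeakGrad f g ∧ (∀ i, LocL2 (flux A g i)) ∧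
    ∀ φ, IsTest φ → ∑ i, ∫ x, flux A g i x * pd i φ x = (E : ℂ) * ∫ x, f x * φ x

theorem IsTest.pd {φ : Plane → ℂ} (h : IsTest φ) (j : Fin 2) :
    Continuous (pd j φ) ∧ HasCompactSupport (pd j φ) :=
  ⟨(h.1.continuous_fderiv (by simp)).clm_apply continuous_const,
    h.2.fderiv_apply (𝕜 := ℝ) _⟩

theorem LocL2.integrable_mul {f φ : Plane → ℂ} (hf : LocL2 f)
    (h : Continuous φ ∧ HasCompactSupport φ) : Integrable (fun x => f x * φ x) volume := by
  simpa [mul_comm] using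
    hf.locallyIntegrable.integrable_smul_left_of_hasCompactSupport h.1 h.2

theorem integral_add_mul {f g φ : Plane → ℂ} (hf : LocL2 f) (hg : LocL2 g)
    (h : Continuous φ ∧ HasCompactSupport φ) :
    ∫ x, (f x + g x) * φ x = (∫ x, f x * φ x) + ∫ x, g x * φ x := by
  simp_rw [add_mul]
  exact integral_add (hf.integrable_mul h) (hg.integrable_mul h)

theorem integral_smul_mul (c : ℂ) (f φ : Plane → ℂ) :
    ∫ x, (c * f x) * φ x = c * ∫ x, f x * φ x := by
  simp_rw [mul_assoc]
  exact integral_const_mul c _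

theorem integral_congr_mul {f g : Plane → ℂ} (h : ∀ᵐ x ∂(volume : Measure Plane), f x = g x)
    (φ : Plane → ℂ) : ∫ x, f x * φ x = ∫ x, g x * φ x :=
  integral_congr_ae (by filter_upwards [h] with x hx; rw [hx])

/-- The `L²_k`-eigenspace of `L^A = -∇ · A ∇` for the energy `E`, which is zero when `E` is not an
`L²_k`-eigenvalue. -/
def eigenspace (A : Plane → Matrix (Fin 2) (Fin 2) ℂ) (k : Plane) (E : ℝ) :
    Submodule ℂ Fn where
  carrier := {f | f ∈ L2k k ∧ IsWeakSol A E f}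
  zero_mem' := by
    refine ⟨(L2k k).zero_mem, fun _ _ => 0, fun j => ⟨LocL2.zero, fun φ hφ => ?_⟩,
      fun i => ?_, fun φ hφ => ?_⟩
    · rw [integral_congr_mul coeFn_zero']; simp
    · have : flux A (fun _ _ => 0) i = fun _ => 0 := by
        funext x
        simp [flux]
      rw [this]
      exact LocL2.zero
    · rw [integral_congr_mul coeFn_zero']; simp [flux]
  add_mem' := by
    rintro f₁ f₂ ⟨hf₁, g₁, hg₁, hA₁, hs₁⟩ ⟨hf₂, g₂, hg₂, hA₂, hs₂⟩
    have hfl : ∀ i x, flux A (fun j x => g₁ j x + g₂ j x) i x = flux A g₁ i x + flux A g₂ i x := by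
      intro i x
      simp only [flux, mul_add, Finset.sum_add_distrib]
    refine ⟨(L2k k).add_mem hf₁ hf₂, fun j x => g₁ j x + g₂ j x,
      fun j => ⟨(hg₁ j).1.add (hg₂ j).1, fun φ hφ => ?_⟩, fun i => ?_, fun φ hφ => ?_⟩
    · have hc : Continuous φ ∧ HasCompactSupport φ := ⟨hφ.1.continuous, hφ.2⟩
      rw [integral_congr_mul (coeFn_add' f₁ f₂), integral_add_mul hf₁.1 hf₂.1 (hφ.pd j),
        integral_add_mul (hg₁ j).1 (hg₂ j).1 hc, (hg₁ j).2 φ hφ, (hg₂ j).2 φ hφ]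
      ring
    · rw [show flux A (fun j x => g₁ j x + g₂ j x) i = fun x => flux A g₁ i x + flux A g₂ i x
        from funext (hfl i)]
      exact (hA₁ i).add (hA₂ i)
    · have hc : Continuous φ ∧ HasCompactSupport φ := ⟨hφ.1.continuous, hφ.2⟩
      simp_rw [hfl]
      rw [integral_congr_mul (coeFn_add' f₁ f₂), integral_add_mul hf₁.1 hf₂.1 hc, mul_add,
        ← hs₁ φ hφ, ← hs₂ φ hφ, ← Finset.sum_add_distrib]
      exact Finset.sum_congr rfl fun i _ => integral_add_mul (hA₁ i) (hA₂ i) (hφ.pd i)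
  smul_mem' := by
    rintro c f ⟨hf, g, hg, hA, hs⟩
    have hfl : ∀ i x, flux A (fun j x => c * g j x) i x = c * flux A g i x := by
      intro i x
      simp only [flux, Finset.mul_sum]
      exact Finset.sum_congr rfl fun j _ => by ring
    refine ⟨(L2k k).smul_mem c hf, fun j x => c * g j x,
      fun j => ⟨(hg j).1.const_mul c, fun φ hφ => ?_⟩, fun i => ?_, fun φ hφ => ?_⟩
    · rw [integral_congr_mul (coeFn_smul' c f), integral_smul_mul, integral_smul_mul,
        (hg j).2 φ hφ]
      ring
    · rw [show flux A (fun j x => c * g j x) i = fun x => c * flux A g i x from funext (hfl i)]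
      exact (hA i).const_mul c
    · simp_rw [hfl]
      rw [integral_congr_mul (coeFn_smul' c f), integral_smul_mul]
      simp_rw [integral_smul_mul]
      rw [← Finset.mul_sum, hs φ hφ]
      ring

/-- `(E, Φ)` is an `L²_k`-eigenpair of `L^A`. -/
def IsEigenpair (A : Plane → Matrix (Fin 2) (Fin 2) ℂ) (k : Plane) (E : ℝ) (Φ : Fn) : Prop :=
  Φ ∈ eigenspace A k E ∧ Φ ≠ 0

/-! ### The Fermi velocity -/

open Classical in
/-- The weak gradient of `f` if there is one in `L²_loc` (it is unique almost everywhere), and zero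
otherwise. -/
def weakGrad (f : Plane → ℂ) : Fin 2 → Plane → ℂ :=
  if h : ∃ g, IsWeakGrad f g then h.choose else 0

/-- The components of `𝒜 f = A (1/i) ∇ f + (1/i) ∇ · (A f)`, namely
`∑ l, (A j l * (1/i) ∂_l f + (1/i) ∂_l (A l j * f))`, where the second derivative is expanded by the
product rule. -/
def opA (A : Plane → Matrix (Fin 2) (Fin 2) ℂ) (f : Plane → ℂ) (j : Fin 2) (x : Plane) : ℂ :=
  ∑ l, (A x j l * (1 / Complex.I * weakGrad f l x) +
    1 / Complex.I * (pd l (fun y => A y l j) x * f x + A x l j * weakGrad f l x))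

/-- `υ_F = ½ |conj ⟨Φ₁, 𝒜 Φ₂⟩ · (1, i)|`. -/
def fermiVelocity (A : Plane → Matrix (Fin 2) (Fin 2) ℂ) (Φ₁ Φ₂ : Fn) : ℝ :=
  1 / 2 * ‖conj (ip Φ₁ (opA A Φ₂ 0)) * 1 + conj (ip Φ₁ (opA A Φ₂ 1)) * Complex.I‖

/-! ### Dispersion surfaces and Dirac points -/

/-- For every quasi-momentum `k`, the numbers `E 0 k ≤ E 1 k ≤ …` are the `L²_k`-eigenvalues of `L^A`
listed with multiplicity, and the `Φ b k` are corresponding eigenfunctions that form a complete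
orthonormal system in `L²_k`. The indices start at `0`. -/
structure IsBandStructure (A : Plane → Matrix (Fin 2) (Fin 2) ℂ) (E : ℕ → Plane → ℝ)
    (Φ : ℕ → Plane → Fn) : Prop where
  mono : ∀ k, Monotone fun b => E b k
  unbounded : ∀ k, Tendsto (fun b => E b k) atTop atTop
  eigen : ∀ b k, IsEigenpair A k (E b k) (Φ b k)
  orthonormal : ∀ k b b', ip (Φ b k) (Φ b' k) = if b = b' then 1 else 0
  complete : ∀ k, ∀ f ∈ L2k k, (∀ b, ip (Φ b k) f = 0) → f = 0

/-- `(K, E_D)` is a Dirac point with the modes `Φ₁`, `Φ₂` and the slope `υ`. -/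
def IsDiracPointWith (A : Plane → Matrix (Fin 2) (Fin 2) ℂ) (K : Plane) (E_D : ℝ)
    (Φ₁ Φ₂ : Fn) (υ : ℝ) : Prop :=
  K ∈ brillouinZone ∧
  ∃ (E : ℕ → Plane → ℝ) (Φ : ℕ → Plane → Fn), IsBandStructure A E Φ ∧
  ∃ b : ℕ,
    -- a two-fold degenerate eigenvalue
    E b K = E_D ∧ E (b + 1) K = E_D ∧ Module.finrank ℂ (eigenspace A K E_D) = 2 ∧
    -- an orthonormal basis of the eigenspace
    Φ₁ ∈ L2kσ K τ ∧ Φ₂ = opPC Φ₁ ∧ Φ₂ ∈ L2kσ K (conj τ) ∧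
    ip Φ₁ Φ₁ = 1 ∧ ip Φ₂ Φ₂ = 1 ∧ ip Φ₁ Φ₂ = 0 ∧
    eigenspace A K E_D = Submodule.span ℂ {Φ₁, Φ₂} ∧
    -- two adjacent dispersion surfaces that touch conically
    0 < υ ∧ ∃ ζ₀ > 0, ∃ eplus eminus : Plane → ℝ,
      (∃ L, LipschitzOnWith L eplus (Metric.ball K ζ₀)) ∧
      (∃ L, LipschitzOnWith L eminus (Metric.ball K ζ₀)) ∧
      (∃ C : ℝ, ∀ k ∈ Metric.ball K ζ₀, |eplus k| ≤ C * ‖k - K‖ ∧ |eminus k| ≤ C * ‖k - K‖) ∧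
      ∀ k ∈ Metric.ball K ζ₀,
        E (b + 1) k - E_D = υ * ‖k - K‖ * (1 + eplus k) ∧
        E b k - E_D = -(υ * ‖k - K‖ * (1 + eminus k))

end Honeycomb

end

open Honeycomb

noncomputable section

namespace Honeycomb

/-! Conjugating with a plane wave and with `(1 - Δ)^(-1/2)` turns the weak eigenvalue problem in
`L²_k` into `B(k) w = E J² w` on the fixed Hilbert space `L²(cell)`. Here `J = (1 - Δ)^(-1/2)` on
periodic functions is compact, injective and symmetric. The operator `B(k) = ∑ S_i(k) A_ij S_j(k)`,
with `S_j(k) = (-i ∂_j + k_j) J`, is bounded, symmetric and a quadratic polynomial in `k`.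
Ellipticity makes `B(k) + c J²` coercive, uniformly for bounded `k`. The dictionary is
`mem_eigenspace_iff`. Quadratic forms thus replace unbounded operators throughout, and no regularity
theory for eigenfunctions is needed.

The numbers `(E + c)⁻¹` are the eigenvalues of the compact positive operator `J (B + c J²)⁻¹ J`. The
spectral theorem therefore yields the ordered bands with a complete orthonormal system
(`exists_isBands`), and Weyl's inequality bounds their dependence on `k`
(`IsBands.abs_inv_sub_inv_le`).

Near a double energy `E₀` at `K`, put `k = K + κ` and `E = E₀ + μ`. A Lyapunov–Schmidt reduction
(`exists_bordered_inverse`, `exists_reduced_matrix`) shows that the kernel of `B(K + κ) - (E₀ + μ)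
J²` is governed by a two by two matrix. Up to terms of second order, it is `-μ` times the identity
plus the first variation of `B` on the degenerate eigenspace. The entries of this variation are the
matrix elements `κ · ⟨Φ_a, 𝒜 Φ_b⟩` (`ip_opA`).

Symmetry determines them. Rotation invariance makes the vector `⟨Φ_a, 𝒜 Φ_b⟩` an eigenvector of the
rotation of the plane, with an eigenvalue fixed by the rotation types of the two modes
(`ip_opA_rotation`). For `a = b` the vector is invariant, hence zero. For the off-diagonal pair it
is a multiple of `(1, i)`, so the entry is `c (κ₀ + i κ₁)` with `|c| = υ_F`. The determinant
equation becomes `μ² = υ_F² |κ|² + O(3)`, a perturbed double cone. For small `κ ≠ 0` the two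
adjacent bands are different, because equality would make the whole matrix vanish, although its
off-diagonal entry has size about `υ_F |κ|`. Both satisfy the cone equation, so one is the positive
and the other the negative sheet.

The theorem also asks for Lipschitz errors `e_±`. Remainders are therefore tracked by
`VanishesToOrder`, which records a Lipschitz estimate next to the bound on the size. The slopes `μ /
|κ|` are then compared directly at two points (`cone_slope_estimate`).

The medium commutes with the symmetries only as a classical operator on smooth functions. For weak
solutions all derivatives are first moved onto the test function (`isWeakSol_iff`). For `𝒜`, the
commutation is evaluated on linear functions and on products of two of them, which gives the
rotation laws of the divergence of `A` and of `A + Aᵀ`; `𝒜` depends on nothing else. At a vertex, `R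
K - K` lies in the dual lattice, so the rotation acts on the eigenspace and splits it into three
parts. The hypotheses make their dimensions 0, 1 and 1.

For real `A`, complex conjugation maps the problem at `k` to the one at `-k`, exchanges the two
rotation types and changes `𝒜` by a sign only. -/

section

/-! ### Sorting and compact positive operators -/

/-- A real function with finite sublevel sets on an infinite type can be listed monotonically. -/
theorem exists_monotone_enumeration {ι : Type*} [Infinite ι] (g : ι → ℝ)
    (hg : ∀ M, {i | g i ≤ M}.Finite) :
    ∃ e : ℕ ≃ ι, Monotone (g ∘ e) := by
  have hc : Countable ι := by
    rw [← Set.countable_univ_iff]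
    have : (Set.univ : Set ι) = ⋃ n : ℕ, {i | g i ≤ n} := by
      ext i
      simp only [Set.mem_univ, Set.mem_iUnion, Set.mem_ofPred_eq, true_iff]
      exact exists_nat_ge (g i)
    rw [this]
    exact Set.countable_iUnion fun n => (hg n).countable
  obtain ⟨c, hcinj⟩ := hc
  -- Ties of `g` are broken by the injection `c` into `ℕ`. The rank, the number of predecessors, is
  -- then injective. Surjectivity of the rank is not needed, since every infinite subset of `ℕ` is
  -- order isomorphic to `ℕ`.
  let below : ι → Set ι := fun i => {j | g j < g i ∨ (g j = g i ∧ c j < c i)}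
  have hfin : ∀ i, (below i).Finite := fun i =>
    (hg (g i)).subset fun j hj => by
      rcases hj with h | h
      · exact h.le
      · exact h.1.le
  let r : ι → ℕ := fun i => (below i).ncard
  have hlt : ∀ i j, (g i < g j ∨ (g i = g j ∧ c i < c j)) → r i < r j := by
    intro i j hij
    refine Set.ncard_lt_ncard ⟨fun k hk => ?_, fun hsub => ?_⟩ (hfin j)
    · simp only [below, Set.mem_ofPred_eq] at hk ⊢
      grind
    · have : i ∈ below i := hsub hij
      simp [below] at this
  have hrinj : Function.Injective r := by
    intro i j hij
    by_contra hne
    have hcne : c i ≠ c j := fun h => hne (hcinj h)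
    rcases lt_trichotomy (g i) (g j) with h | h | h
    · exact absurd hij (hlt i j (.inl h)).ne
    · rcases lt_or_gt_of_ne hcne with h' | h'
      · exact absurd hij (hlt i j (.inr ⟨h, h'⟩)).ne
      · exact absurd hij (hlt j i (.inr ⟨h.symm, h'⟩)).ne'
    · exact absurd hij (hlt j i (.inl h)).ne'
  have : Infinite (Set.range r) := (Set.infinite_range_of_injective hrinj).to_subtype
  classical
  let o : ℕ ≃o Set.range r := Nat.Subtype.orderIsoOfNat (Set.range r)
  let s : ι ≃ Set.range r := Equiv.ofInjective r hrinj
  refine ⟨o.toEquiv.trans s.symm, fun n m hnm => ?_⟩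
  have h1 : ∀ k, r (s.symm (o k)) = o k := fun k => by
    have := s.apply_symm_apply (o k)
    exact congrArg Subtype.val this
  have h2 : r (s.symm (o n)) ≤ r (s.symm (o m)) := by
    rw [h1, h1]
    exact o.monotone hnm
  simp only [Function.comp_apply, Equiv.trans_apply]
  by_contra! hlt'
  exact absurd h2 (not_le.2 (hlt _ _ (.inl hlt')))

variable {H : Type*} [NormedAddCommGroup H] [InnerProductSpace ℂ H]

/-- A compact operator has only finitely many orthonormal eigenvectors with eigenvalues bounded
away from zero. -/
theorem finite_setOf_le_eigenvalue {T : H →L[ℂ] H} (hT : IsCompactOperator T) {ι : Type*}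
    {v : ι → H} (hv : Orthonormal ℂ v) {l : ι → ℝ} (hl : ∀ i, T (v i) = (l i : ℂ) • v i)
    {ε : ℝ} (hε : 0 < ε) : {i | ε ≤ l i}.Finite := by
  by_contra hinf
  have hinf : {i | ε ≤ l i}.Infinite := hinf
  let f := hinf.natEmbedding
  obtain ⟨K, hK, hK'⟩ := hT.image_closedBall_subset_compact (1 : ℝ)
  obtain ⟨y, -, ψ, hψ, hψy⟩ := hK.tendsto_subseq
    (x := fun n => T (v (f n))) (fun n => hK' ⟨v (f n), by simp [hv.1], rfl⟩)
  have hc := hψy.cauchySeq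
  rw [Metric.cauchySeq_iff'] at hc
  obtain ⟨N, hN⟩ := hc ε hε
  have h1 := hN (N + 1) (Nat.le_succ N)
  rw [dist_eq_norm] at h1
  set i := (f (ψ (N + 1)) : ι)
  set j := (f (ψ N) : ι)
  have hij : i ≠ j := by
    intro h
    have := f.injective (Subtype.ext h)
    have := hψ.injective this
    omega
  have hi : ε ≤ l i := (f (ψ (N + 1))).2
  -- Two images are at distance at least `l i ≥ ε`: pairing their difference with `v i` leaves `l i`
  -- alone. This contradicts the convergent subsequence provided by compactness.
  have h2 : inner ℂ (v i) (T (v i) - T (v j)) = (l i : ℂ) := by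
    rw [inner_sub_right, hl, hl, inner_smul_right, inner_smul_right, hv.2 hij]
    simp [inner_self_eq_norm_sq_to_K, hv.1]
  have h3 : ‖(l i : ℂ)‖ ≤ ‖T (v i) - T (v j)‖ := by
    rw [← h2]
    have := norm_inner_le_norm (𝕜 := ℂ) (v i) (T (v i) - T (v j))
    rwa [hv.1, one_mul] at this
  rw [Complex.norm_real, Real.norm_eq_abs] at h3
  have h4 : ‖T (v i) - T (v j)‖ < ε := h1
  linarith [le_abs_self (l i)]

variable [CompleteSpace H]

/-- The spectral theorem for compact positive operators: a Hilbert basis of eigenvectors with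
decreasing eigenvalues that tend to zero. -/
theorem exists_hilbertBasis_eigenvectors (hinf : ¬ FiniteDimensional ℂ H) {T : H →L[ℂ] H}
    (hT : IsCompactOperator T) (hs : T.IsSymmetric) (hpos : ∀ x, x ≠ 0 → 0 < (inner ℂ x (T x)).re) :
    ∃ (b : HilbertBasis ℕ ℂ H) (l : ℕ → ℝ), Antitone l ∧ (∀ n, 0 < l n) ∧
      Tendsto l atTop (𝓝 0) ∧ ∀ n, T (b n) = (l n : ℂ) • b n := by
  -- Only non-zero eigenvalues have eigenspaces that compactness makes finite-dimensional. Nothing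
  -- is lost, because positivity makes `T` injective.
  let X := {μ : ℂ // μ ≠ 0}
  have hfd : ∀ μ : X, FiniteDimensional ℂ (Module.End.eigenspace T.toLinearMap μ.1) := fun μ =>
    ContinuousLinearMap.finite_dimensional_eigenspace hT μ.1 μ.2
  have hinj0 : ∀ x, T x = 0 → x = 0 := fun x hx => by
    by_contra h
    have := hpos x h
    simp [hx] at this
  let ι := Σ μ : X, Fin (Module.finrank ℂ (Module.End.eigenspace T.toLinearMap μ.1))
  let ob : ∀ μ : X, OrthonormalBasis _ ℂ (Module.End.eigenspace T.toLinearMap μ.1) :=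
    fun μ => stdOrthonormalBasis ℂ _
  let v : ι → H := fun a => ((ob a.1 a.2 : Module.End.eigenspace T.toLinearMap a.1.1) : H)
  have hfam : OrthogonalFamily ℂ
      (fun μ : X => Module.End.eigenspace T.toLinearMap μ.1)
      (fun μ => (Module.End.eigenspace T.toLinearMap μ.1).subtypeₗᵢ) :=
    (LinearMap.IsSymmetric.orthogonalFamily_eigenspaces hs).comp Subtype.val_injective
  have hv : Orthonormal ℂ v := hfam.orthonormal_sigma_orthonormal (fun μ => (ob μ).orthonormal)
  have hspan : (Submodule.span ℂ (Set.range v))ᗮ = ⊥ := by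
    rw [eq_bot_iff, ← ContinuousLinearMap.orthogonalComplement_iSup_eigenspaces_eq_bot hT hs]
    refine Submodule.orthogonal_le (iSup_le fun μ => ?_)
    by_cases hμ : μ = 0
    · intro x hx
      rw [hμ, Module.End.mem_eigenspace_iff] at hx
      rw [hinj0 x (by simpa using hx)]
      exact Submodule.zero_mem _
    · intro x hx
      have h1 : (⟨x, hx⟩ : Module.End.eigenspace T.toLinearMap μ) ∈
          Submodule.span ℂ (Set.range (ob ⟨μ, hμ⟩)) := by
        have := (ob ⟨μ, hμ⟩).toBasis.span_eq
        rw [OrthonormalBasis.coe_toBasis] at this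
        rw [this]
        trivial
      have h2 := Submodule.mem_map_of_mem (f := (Module.End.eigenspace T.toLinearMap μ).subtype) h1
      rw [Submodule.map_span] at h2
      refine Submodule.span_mono ?_ h2
      rintro _ ⟨_, ⟨i, rfl⟩, rfl⟩
      exact ⟨⟨⟨μ, hμ⟩, i⟩, rfl⟩
  have hTv' : ∀ a, T (v a) = a.1.1 • v a := fun a =>
    Module.End.mem_eigenspace_iff.1 (ob a.1 a.2).2
  have hnorm : ∀ a, ‖v a‖ = 1 := hv.1
  let l : ι → ℝ := fun a => (inner ℂ (v a) (T (v a))).re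
  have hl : ∀ a, T (v a) = (l a : ℂ) • v a := by
    intro a
    have h1 : inner ℂ (v a) (T (v a)) = a.1.1 := by
      rw [hTv', inner_smul_right, inner_self_eq_norm_sq_to_K, hnorm]; simp
    have h2 : (l a : ℂ) = a.1.1 := by
      rw [← h1]
      have h3 : conj (inner ℂ (v a) (T (v a))) = inner ℂ (v a) (T (v a)) := by
        rw [inner_conj_symm]; exact hs _ _
      exact Complex.conj_eq_iff_re.1 h3
    rw [h2, hTv']
  have hlpos : ∀ a, 0 < l a := fun a => hpos _ (by
    intro h
    have := hnorm a
    rw [h] at this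
    simp at this)
  let b0 : HilbertBasis ι ℂ H := HilbertBasis.mkOfOrthogonalEqBot hv hspan
  have hιinf : Infinite ι := by
    by_contra hni
    have : Finite ι := not_infinite_iff_finite.1 hni
    have : Fintype ι := Fintype.ofFinite ι
    exact hinf (b0.toOrthonormalBasis.toBasis.finiteDimensional_of_finite)
  have hfin : ∀ M, {a | (l a)⁻¹ ≤ M}.Finite := by
    intro M
    by_cases hM : 0 < M
    · refine (finite_setOf_le_eigenvalue hT hv hl (inv_pos.2 hM)).subset fun a ha => ?_
      exact inv_le_of_inv_le₀ (hlpos a) ha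
    · convert Set.finite_empty
      ext a
      simp only [Set.mem_ofPred_eq, Set.mem_empty_iff_false, iff_false, not_le]
      exact (not_lt.1 hM).trans_lt (inv_pos.2 (hlpos a))
  -- Listing by the reciprocals turns "finitely many eigenvalues above `ε`" into finite sublevel
  -- sets, and increasing reciprocals into decreasing eigenvalues.
  obtain ⟨e, he⟩ := exists_monotone_enumeration (fun a => (l a)⁻¹) hfin
  have hv2 : Orthonormal ℂ (v ∘ e) := hv.comp _ e.injective
  have hspan2 : (Submodule.span ℂ (Set.range (v ∘ e)))ᗮ = ⊥ := by
    rw [e.surjective.range_comp]; exact hspan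
  have hanti : Antitone (l ∘ e) := fun n m h => by
    have := he h
    simp only [Function.comp_apply] at this ⊢
    exact (inv_le_inv₀ (hlpos _) (hlpos _)).1 this
  refine ⟨HilbertBasis.mkOfOrthogonalEqBot hv2 hspan2, l ∘ e, hanti, fun n => hlpos _, ?_,
    fun n => ?_⟩
  · rw [Metric.tendsto_atTop]
    intro ε hε
    have hf := finite_setOf_le_eigenvalue hT hv2 (l := l ∘ e) (fun i => hl _) hε
    obtain ⟨N, hN⟩ := hf.bddAbove
    refine ⟨N + 1, fun n hn => ?_⟩
    rw [Real.dist_eq, sub_zero, Function.comp_apply, abs_of_pos (hlpos _)]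
    by_contra! h
    have := hN h
    omega
  · rw [HilbertBasis.coe_mkOfOrthogonalEqBot]
    exact hl _

/-- Parseval's identity for the quadratic form of a diagonal operator. -/
theorem hasSum_re_inner_eigen {T : H →L[ℂ] H} (hs : T.IsSymmetric) {b : HilbertBasis ℕ ℂ H}
    {l : ℕ → ℝ} (hl : ∀ n, T (b n) = (l n : ℂ) • b n) (x : H) :
    HasSum (fun n => l n * ‖inner ℂ (b n) x‖ ^ 2) (inner ℂ x (T x)).re := by
  have h := Complex.hasSum_re (b.hasSum_inner_mul_inner x (T x))
  convert h using 2 with n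
  have h1 : inner ℂ (b n) (T x) = (l n : ℂ) * inner ℂ (b n) x := by
    have h2 : inner ℂ (T (b n)) x = inner ℂ (b n) (T x) := hs (b n) x
    rw [← h2, hl, inner_smul_left]
    simp
  rw [h1, ← inner_conj_symm x, mul_left_comm, ← Complex.normSq_eq_conj_mul_self,
    Complex.normSq_eq_norm_sq, ← Complex.ofReal_mul, Complex.ofReal_re]

/-- Weyl's inequality for the ordered eigenvalues of two operators, in one direction. -/
theorem eigenvalue_le_add_norm_sub {T T' : H →L[ℂ] H} (hs : T.IsSymmetric) (hs' : T'.IsSymmetric)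
    {b b' : HilbertBasis ℕ ℂ H} {l l' : ℕ → ℝ} (hl : ∀ n, T (b n) = (l n : ℂ) • b n)
    (hl' : ∀ n, T' (b' n) = (l' n : ℂ) • b' n) (ha : Antitone l) (ha' : Antitone l') (n : ℕ) :
    l n ≤ l' n + ‖T - T'‖ := by
  -- The min-max argument: by dimension count some `x ≠ 0` in the span of `b 0, …, b n` is
  -- orthogonal to `b' 0, …, b' (n - 1)`. On this `x` the form of `T` is at least `l n` and the form
  -- of `T'` is at most `l' n`, each times `‖x‖²`.
  let φ : (Fin (n + 1) → ℂ) →ₗ[ℂ] (Fin n → ℂ) :=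
    LinearMap.pi fun i => ∑ j : Fin (n + 1), (inner ℂ (b' i) (b j)) • LinearMap.proj j
  have hker : LinearMap.ker φ ≠ ⊥ := by
    apply LinearMap.ker_ne_bot_of_finrank_lt
    simp
  obtain ⟨c, hc, hc0⟩ := Submodule.exists_mem_ne_zero_of_ne_bot hker
  let x : H := ∑ j : Fin (n + 1), c j • b j
  have hbx : ∀ j : Fin (n + 1), inner ℂ (b j) x = c j := by
    intro j
    have := (b.orthonormal.comp (fun j : Fin (n + 1) => (j : ℕ)) Fin.val_injective)
    exact this.inner_right_fintype c j
  have hbx' : ∀ m, n < m → inner ℂ (b m) x = 0 := by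
    intro m hm
    simp only [x, inner_sum, inner_smul_right]
    refine Finset.sum_eq_zero fun j _ => ?_
    rw [b.orthonormal.2 (by have := j.2; omega), mul_zero]
  have hb'x : ∀ m, m < n → inner ℂ (b' m) x = 0 := by
    intro m hm
    have := congrFun hc ⟨m, hm⟩
    simp only [x, inner_sum, inner_smul_right]
    simp only [φ, LinearMap.pi_apply, LinearMap.sum_apply, LinearMap.smul_apply,
      LinearMap.proj_apply, smul_eq_mul, Pi.zero_apply] at this
    rw [← this]
    exact Finset.sum_congr rfl fun j _ => mul_comm _ _
  have hx0 : x ≠ 0 := by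
    intro h
    apply hc0
    funext j
    rw [← hbx j, h]; simp
  have hnx : 0 < ‖x‖ := norm_pos_iff.2 hx0
  have one_sum : ∀ B : HilbertBasis ℕ ℂ H, HasSum (fun n => ‖inner ℂ (B n) x‖ ^ 2) (‖x‖ ^ 2) := by
    intro B
    have := hasSum_re_inner_eigen (T := ContinuousLinearMap.id ℂ H) (fun _ _ => rfl)
      (b := B) (l := fun _ => 1) (fun n => by simp) x
    simpa [inner_self_eq_norm_sq_to_K, ← Complex.ofReal_pow] using this
  have h1 : l n * ‖x‖ ^ 2 ≤ (inner ℂ x (T x)).re := by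
    refine hasSum_le (fun m => ?_) ((one_sum b).mul_left (l n)) (hasSum_re_inner_eigen hs hl x)
    rcases lt_or_ge n m with h | h
    · simp [hbx' m h]
    · exact mul_le_mul_of_nonneg_right (ha h) (by positivity)
  have h2 : (inner ℂ x (T' x)).re ≤ l' n * ‖x‖ ^ 2 := by
    refine hasSum_le (fun m => ?_) (hasSum_re_inner_eigen hs' hl' x) ((one_sum b').mul_left (l' n))
    rcases lt_or_ge m n with h | h
    · simp [hb'x m h]
    · exact mul_le_mul_of_nonneg_right (ha' h) (by positivity)
  have h3 : (inner ℂ x (T x)).re - (inner ℂ x (T' x)).re ≤ ‖T - T'‖ * ‖x‖ ^ 2 := by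
    have : (inner ℂ x (T x)).re - (inner ℂ x (T' x)).re = (inner ℂ x ((T - T') x)).re := by
      simp
    rw [this]
    refine (Complex.re_le_norm _).trans ((norm_inner_le_norm _ _).trans ?_)
    calc ‖x‖ * ‖(T - T') x‖ ≤ ‖x‖ * (‖T - T'‖ * ‖x‖) := by gcongr; exact (T - T').le_opNorm x
      _ = _ := by ring
  have h4 : 0 < ‖x‖ ^ 2 := by positivity
  by_contra! h
  nlinarith

/-- Weyl's inequality for the ordered eigenvalues of two operators. -/
theorem abs_eigenvalue_sub_le {T T' : H →L[ℂ] H} (hs : T.IsSymmetric) (hs' : T'.IsSymmetric)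
    {b b' : HilbertBasis ℕ ℂ H} {l l' : ℕ → ℝ} (hl : ∀ n, T (b n) = (l n : ℂ) • b n)
    (hl' : ∀ n, T' (b' n) = (l' n : ℂ) • b' n) (ha : Antitone l) (ha' : Antitone l') (n : ℕ) :
    |l n - l' n| ≤ ‖T - T'‖ := by
  rw [abs_sub_le_iff]
  constructor
  · linarith [eigenvalue_le_add_norm_sub hs hs' hl hl' ha ha' n]
  · have := eigenvalue_le_add_norm_sub hs' hs hl' hl ha' ha n
    rw [norm_sub_rev] at this
    linarith

end

section

/-! ### The generalized eigenvalue problem `B w = E J² w` -/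

variable {H : Type*} [NormedAddCommGroup H] [InnerProductSpace ℂ H] [CompleteSpace H]

/-- A coercive operator has a bounded inverse. -/
theorem exists_inverse_of_coercive {S : H →L[ℂ] H} {δ : ℝ} (hδ : 0 < δ)
    (h : ∀ w, δ * ‖w‖ ^ 2 ≤ (inner ℂ w (S w)).re) :
    ∃ R : H →L[ℂ] H, (∀ x, S (R x) = x) ∧ (∀ x, R (S x) = x) ∧ ‖R‖ ≤ δ⁻¹ := by
  have hu : IsUnit S := by
    refine ContinuousLinearMap.isUnit_of_forall_le_norm_inner_map S (c := ⟨δ, hδ.le⟩) hδ fun x => ?_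
    refine le_trans ?_ ((h x).trans ((Complex.re_le_norm _).trans (le_of_eq ?_)))
    · rw [mul_comm]; rfl
    · rw [← inner_conj_symm, RCLike.norm_conj]
  obtain ⟨u, rfl⟩ := hu
  have h1 : ∀ x, (u : H →L[ℂ] H) ((↑u⁻¹ : H →L[ℂ] H) x) = x := fun x => by
    rw [← mul_apply_eq_comp, Units.mul_inv]; rfl
  refine ⟨(u⁻¹ : (H →L[ℂ] H)ˣ), h1, fun x => by
    rw [← mul_apply_eq_comp, Units.inv_mul]; rfl, ?_⟩
  refine ContinuousLinearMap.opNorm_le_bound _ (inv_pos.2 hδ).le fun x => ?_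
  set y := (↑u⁻¹ : H →L[ℂ] H) x
  have h2 := (h y).trans ((Complex.re_le_norm _).trans (norm_inner_le_norm _ _))
  rw [h1] at h2
  rcases eq_or_lt_of_le (norm_nonneg y) with h0 | h0
  · rw [← h0]; positivity
  · rw [inv_mul_eq_div, le_div_iff₀ hδ]
    have : ‖y‖ * (‖y‖ * δ) ≤ ‖y‖ * ‖x‖ := by nlinarith
    exact le_of_mul_le_mul_left this h0

/-- The numbers `E n` are the eigenvalues of `B w = E J² w` in increasing order, and the vectors
`J (w n)` form a Hilbert basis. -/
structure IsBands (J B : H →L[ℂ] H) (E : ℕ → ℝ) (b : HilbertBasis ℕ ℂ H) (w : ℕ → H) : Prop where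
  mono : Monotone E
  tendsto : Tendsto E atTop atTop
  apply_J : ∀ n, J (w n) = b n
  eigen : ∀ n, B (w n) = (E n : ℂ) • J (b n)

/-- `B + c J²` is coercive. -/
def CoerciveWith (J B : H →L[ℂ] H) (c δ : ℝ) : Prop :=
  ∀ w, δ * ‖w‖ ^ 2 ≤ (inner ℂ w (B w)).re + c * ‖J w‖ ^ 2

/-- Lax–Milgram for `B + c J²`, whose quadratic form is that of `B` plus `c ‖J w‖²`. The last claim
is coercivity evaluated at `R x`; it supplies the positivity of `J R J` when `J` is injective. -/
theorem CoerciveWith.exists_inverse {J B : H →L[ℂ] H} (hJs : J.IsSymmetric) (hBs : B.IsSymmetric)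
    {c δ : ℝ} (hδ : 0 < δ) (h : CoerciveWith J B c δ) :
    ∃ R : H →L[ℂ] H, (∀ x, (B + (c : ℂ) • J * J) (R x) = x) ∧
      (∀ x, R ((B + (c : ℂ) • J * J) x) = x) ∧ ‖R‖ ≤ δ⁻¹ ∧ (J * R * J).IsSymmetric ∧
      ∀ x, δ * ‖R x‖ ^ 2 ≤ (inner ℂ x (R x)).re := by
  have hco : ∀ w, δ * ‖w‖ ^ 2 ≤ (inner ℂ w ((B + (c : ℂ) • J * J) w)).re := by
    intro w
    refine (h w).trans (le_of_eq ?_)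
    have : inner ℂ w (J (J w)) = ((‖J w‖ ^ 2 : ℝ) : ℂ) := by
      rw [show inner ℂ w (J (J w)) = inner ℂ (J w) (J w) from (hJs w (J w)).symm,
        inner_self_eq_norm_sq_to_K]
      simp
    simp only [add_apply, mul_apply_eq_comp,
      smul_apply, inner_add_right, inner_smul_right, this, Complex.add_re,
      ← Complex.ofReal_mul, Complex.ofReal_re]
  have hss : ∀ x y, inner ℂ ((B + (c : ℂ) • J * J) x) y = inner ℂ x ((B + (c : ℂ) • J * J) y) := by
    intro x y
    have h1 : inner ℂ (B x) y = inner ℂ x (B y) := hBs x y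
    have h2 : inner ℂ (J (J x)) y = inner ℂ x (J (J y)) := (hJs (J x) y).trans (hJs x (J y))
    simp only [add_apply, mul_apply_eq_comp,
      smul_apply, inner_add_right, inner_add_left, inner_smul_right,
      inner_smul_left, h1, h2, Complex.conj_ofReal]
  obtain ⟨R, hR1, hR2, hR3⟩ := exists_inverse_of_coercive hδ hco
  refine ⟨R, hR1, hR2, hR3, fun x y => ?_, fun x => ?_⟩
  · have h3 : ∀ u v, inner ℂ (R u) v = inner ℂ u (R v) := fun u v => by
      conv_lhs => rw [← hR1 v]
      rw [← hss, hR1]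
    have hJ : ∀ u v, inner ℂ (J u) v = inner ℂ u (J v) := hJs
    show inner ℂ (J (R (J x))) y = inner ℂ x (J (R (J y)))
    rw [hJ, h3, hJ]
  · have := hco (R x)
    rw [hR1] at this
    rwa [← inner_conj_symm, Complex.conj_re]

/-- The eigenvalues of `B w = E J² w` for compact injective symmetric `J` and symmetric `B`. -/
theorem exists_isBands (hinf : ¬ FiniteDimensional ℂ H) {J B : H →L[ℂ] H}
    (hJc : IsCompactOperator J) (hJs : J.IsSymmetric) (hJi : ∀ x, J x = 0 → x = 0)
    (hBs : B.IsSymmetric) {c δ : ℝ} (hδ : 0 < δ) (h : CoerciveWith J B c δ) :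
    ∃ E b w, IsBands J B E b w := by
  obtain ⟨R, hR1, hR2, -, hTs, hRp⟩ := h.exists_inverse hJs hBs hδ
  have hTc : IsCompactOperator (J * R * J) := hJc.clm_comp (J * R)
  have hpos : ∀ x, x ≠ 0 → 0 < (inner ℂ x ((J * R * J) x)).re := by
    intro x hx
    have h1 : inner ℂ x ((J * R * J) x) = inner ℂ (J x) (R (J x)) := (hJs x (R (J x))).symm
    rw [h1]
    refine lt_of_lt_of_le ?_ (hRp (J x))
    have : R (J x) ≠ 0 := by
      intro h0
      apply hx
      apply hJi
      rw [← hR1 (J x), h0, map_zero]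
    positivity
  obtain ⟨b, l, ha, hlp, hl0, hTb⟩ := exists_hilbertBasis_eigenvectors hinf hTc hTs hpos
  -- If `J R J b = l b`, then `w = l⁻¹ R J b` satisfies `J w = b` and `(B + c J²) w = l⁻¹ J b`, so
  -- that `B w = (l⁻¹ - c) J b`.
  refine ⟨fun n => (l n)⁻¹ - c, b, fun n => ((l n)⁻¹ : ℂ) • R (J (b n)), fun n m hnm => ?_, ?_,
    fun n => ?_, fun n => ?_⟩
  · have := (inv_le_inv₀ (hlp n) (hlp m)).2 (ha hnm)
    show (l n)⁻¹ - c ≤ (l m)⁻¹ - c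
    linarith
  · apply tendsto_atTop_add_const_right _ (-c)
    exact (tendsto_nhdsWithin_iff.2 ⟨hl0, Eventually.of_forall hlp⟩).inv_tendsto_nhdsGT_zero
  · have : J (R (J (b n))) = (l n : ℂ) • b n := hTb n
    rw [map_smul, this, smul_smul, inv_mul_cancel₀ (by exact_mod_cast (hlp n).ne'), one_smul]
  · have h1 : J (R (J (b n))) = (l n : ℂ) • b n := hTb n
    have h2 := hR1 (J (b n))
    simp only [add_apply, mul_apply_eq_comp,
      smul_apply, h1, map_smul] at h2
    have h3 : B (R (J (b n))) = J (b n) - (l n : ℂ) • (c : ℂ) • J (b n) := eq_sub_of_add_eq h2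
    have h4 : (l n : ℂ) ≠ 0 := by exact_mod_cast (hlp n).ne'
    rw [map_smul, h3, smul_sub, smul_smul, smul_smul, ← sub_smul]
    congr 1
    push_cast
    field_simp

/-- Since `‖J (w n)‖ = 1` and the form of `B` at `w n` is `E n`, coercivity at `w n` reads `δ ‖w n‖²
≤ E n + c`. -/
theorem IsBands.shift_pos {J B : H →L[ℂ] H} {E : ℕ → ℝ} {b : HilbertBasis ℕ ℂ H} {w : ℕ → H}
    (hb : IsBands J B E b w) (hJs : J.IsSymmetric) {c δ : ℝ} (hδ : 0 < δ)
    (h : CoerciveWith J B c δ) (n : ℕ) : 0 < E n + c := by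
  have h1 := h (w n)
  have h2 : inner ℂ (w n) (J (b n)) = 1 := by
    rw [show inner ℂ (w n) (J (b n)) = inner ℂ (J (w n)) (b n) from (hJs _ _).symm, hb.apply_J,
      inner_self_eq_norm_sq_to_K, b.orthonormal.1]
    simp
  rw [hb.eigen, inner_smul_right, hb.apply_J, b.orthonormal.1, h2] at h1
  have h3 : w n ≠ 0 := by
    intro h0
    rw [h0] at h2
    simp at h2
  have : 0 < δ * ‖w n‖ ^ 2 := by positivity
  simp at h1
  linarith

/-- The ordered eigenvalues depend on `B` in a Lipschitz continuous way. -/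
theorem IsBands.abs_inv_sub_inv_le {J B B' : H →L[ℂ] H} {E E' : ℕ → ℝ} {b b' : HilbertBasis ℕ ℂ H}
    {w w' : ℕ → H} (hb : IsBands J B E b w) (hb' : IsBands J B' E' b' w')
    (hJs : J.IsSymmetric) (hBs : B.IsSymmetric) (hBs' : B'.IsSymmetric) {c δ : ℝ} (hδ : 0 < δ)
    (h : CoerciveWith J B c δ) (h' : CoerciveWith J B' c δ) (n : ℕ) :
    |(E n + c)⁻¹ - (E' n + c)⁻¹| ≤ ‖J‖ ^ 2 * (δ⁻¹) ^ 2 * ‖B - B'‖ := by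
  -- Every band system diagonalizes `J R J`, with eigenvalues `(E n + c)⁻¹` in decreasing order.
  -- Weyl's inequality thus applies to arbitrary given bands, not only to constructed ones.
  have eig : ∀ {B : H →L[ℂ] H} {E : ℕ → ℝ} {b : HilbertBasis ℕ ℂ H} {w : ℕ → H}
      (hb : IsBands J B E b w) (h : CoerciveWith J B c δ) {R : H →L[ℂ] H}
      (hR : ∀ x, R ((B + (c : ℂ) • J * J) x) = x) (n : ℕ),
      (J * R * J) (b n) = (((E n + c)⁻¹ : ℝ) : ℂ) • b n := by
    intro B E b w hb h R hR n
    have hp := hb.shift_pos hJs hδ h n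
    have h1 := hR (w n)
    simp only [add_apply, mul_apply_eq_comp,
      smul_apply, hb.eigen, hb.apply_J, ← add_smul, map_smul] at h1
    have h2 : R (J (b n)) = (((E n + c)⁻¹ : ℝ) : ℂ) • w n := by
      rw [← h1, smul_smul]
      have : (((E n + c)⁻¹ : ℝ) : ℂ) * ((E n : ℂ) + c) = 1 := by
        rw [← Complex.ofReal_add, ← Complex.ofReal_mul, inv_mul_cancel₀ hp.ne', Complex.ofReal_one]
      rw [this, one_smul]
    show J (R (J (b n))) = _
    rw [h2, map_smul, hb.apply_J]
  have anti : ∀ {B : H →L[ℂ] H} {E : ℕ → ℝ} {b : HilbertBasis ℕ ℂ H} {w : ℕ → H}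
      (hb : IsBands J B E b w) (h : CoerciveWith J B c δ), Antitone fun n => (E n + c)⁻¹ := by
    intro B E b w hb h n m hnm
    have := hb.mono hnm
    exact (inv_le_inv₀ (hb.shift_pos hJs hδ h m) (hb.shift_pos hJs hδ h n)).2 (by linarith)
  obtain ⟨R, hR1, hR2, hR3, hTs, -⟩ := h.exists_inverse hJs hBs hδ
  obtain ⟨R', hR1', hR2', hR3', hTs', -⟩ := h'.exists_inverse hJs hBs' hδ
  refine (abs_eigenvalue_sub_le hTs hTs' (eig hb h hR2) (eig hb' h' hR2') (anti hb h)
    (anti hb' h') n).trans ?_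
  -- The resolvent identity; the shift `c J²` is common to both operators and cancels.
  have hdiff : J * R * J - J * R' * J = J * (R * (B' - B) * R') * J := by
    ext x
    have h1 : R (B' (R' (J x))) = R (J x) - R ((c : ℂ) • J (J (R' (J x)))) := by
      rw [← map_sub]
      congr 1
      exact eq_sub_of_add_eq (hR1' (J x))
    have h2 : R (B (R' (J x))) = R' (J x) - R ((c : ℂ) • J (J (R' (J x)))) := by
      have := hR2 (R' (J x))
      simp only [add_apply, mul_apply_eq_comp,
        smul_apply, map_add] at this
      exact eq_sub_of_add_eq this
    show J (R (J x)) - J (R' (J x)) = J (R ((B' - B) (R' (J x))))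
    rw [sub_apply, map_sub R, h1, h2, ← map_sub]
    congr 1
    abel
  rw [hdiff]
  calc ‖J * (R * (B' - B) * R') * J‖ ≤ ‖J‖ * (‖R‖ * ‖B' - B‖ * ‖R'‖) * ‖J‖ := by
        refine (norm_mul_le _ _).trans ?_
        gcongr
        refine (norm_mul_le _ _).trans ?_
        gcongr
        refine (norm_mul_le _ _).trans ?_
        gcongr
        exact norm_mul_le _ _
    _ ≤ ‖J‖ * (δ⁻¹ * ‖B' - B‖ * δ⁻¹) * ‖J‖ := by gcongr
    _ = _ := by rw [norm_sub_rev]; ring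

end

/-! ### Functions vanishing to some order, together with their Lipschitz constants -/

section Vanishing

variable {V W W' : Type*} [NormedAddCommGroup V] [NormedAddCommGroup W] [NormedAddCommGroup W']

/-- `f = O(‖z‖ ^ n)` on `s`, with a Lipschitz constant `O(ρ ^ (n - 1))` on the points of `s` with
norm at most `ρ`. -/
def VanishesToOrder (n : ℕ) (f : V → W) (s : Set V) : Prop :=
  ∃ C, 0 ≤ C ∧ (∀ z ∈ s, ‖f z‖ ≤ C * ‖z‖ ^ n) ∧
    ∀ z ∈ s, ∀ z' ∈ s, ‖z'‖ ≤ ‖z‖ → ‖z‖ * ‖f z - f z'‖ ≤ C * ‖z‖ ^ n * ‖z - z'‖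

theorem VanishesToOrder.add {n : ℕ} {f g : V → W} {s : Set V} (hf : VanishesToOrder n f s)
    (hg : VanishesToOrder n g s) : VanishesToOrder n (fun z => f z + g z) s := by
  obtain ⟨C, hC, h1, h2⟩ := hf
  obtain ⟨D, hD, h3, h4⟩ := hg
  refine ⟨C + D, by positivity, fun z hz => ?_, fun z hz z' hz' h => ?_⟩
  · refine (norm_add_le _ _).trans ?_
    linarith [h1 z hz, h3 z hz]
  · rw [add_sub_add_comm]
    have := mul_le_mul_of_nonneg_left (norm_add_le (f z - f z') (g z - g z')) (norm_nonneg z)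
    linarith [h2 z hz z' hz' h, h4 z hz z' hz' h]

theorem VanishesToOrder.map {n : ℕ} {f : V → W} {s : Set V} (hf : VanishesToOrder n f s)
    {g : W → W'} {K : ℝ} (hK : 0 ≤ K) (h0 : ∀ a, ‖g a‖ ≤ K * ‖a‖)
    (hg : ∀ a b, ‖g a - g b‖ ≤ K * ‖a - b‖) : VanishesToOrder n (fun z => g (f z)) s := by
  obtain ⟨C, hC, h1, h2⟩ := hf
  refine ⟨K * C, by positivity, fun z hz => ?_, fun z hz z' hz' h => ?_⟩
  · refine (h0 _).trans ?_
    rw [mul_assoc]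
    gcongr
    exact h1 z hz
  · calc ‖z‖ * ‖g (f z) - g (f z')‖ ≤ ‖z‖ * (K * ‖f z - f z'‖) := by gcongr; exact hg _ _
      _ = K * (‖z‖ * ‖f z - f z'‖) := by ring
      _ ≤ K * (C * ‖z‖ ^ n * ‖z - z'‖) := mul_le_mul_of_nonneg_left (h2 z hz z' hz' h) hK
      _ = _ := by ring

theorem VanishesToOrder.neg {n : ℕ} {f : V → W} {s : Set V} (hf : VanishesToOrder n f s) :
    VanishesToOrder n (fun z => -f z) s :=
  hf.map (g := fun a => -a) zero_le_one (by simp) (fun a b => by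
    rw [neg_sub_neg, norm_sub_rev]; simp)

theorem VanishesToOrder.sub {n : ℕ} {f g : V → W} {s : Set V} (hf : VanishesToOrder n f s)
    (hg : VanishesToOrder n g s) : VanishesToOrder n (fun z => f z - g z) s := by
  simpa only [sub_eq_add_neg] using hf.add hg.neg

/-- Orders add by telescoping `f g - f' g'`, where the value of `g` at the point with smaller norm
is bounded through the larger norm. The factor `‖z‖` on the left of the Lipschitz clause, in place
of the exponent `n - 1` on the right, lets bounded factors take part as order zero. -/
theorem VanishesToOrder.mul {A : Type*} [NormedRing A] {n m : ℕ} {f g : V → A} {s : Set V}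
    (hf : VanishesToOrder n f s) (hg : VanishesToOrder m g s) :
    VanishesToOrder (n + m) (fun z => f z * g z) s := by
  obtain ⟨C, hC, h1, h2⟩ := hf
  obtain ⟨D, hD, h3, h4⟩ := hg
  refine ⟨2 * (C * D), by positivity, fun z hz => ?_, fun z hz z' hz' h => ?_⟩
  · refine (norm_mul_le _ _).trans ?_
    have := mul_le_mul (h1 z hz) (h3 z hz) (norm_nonneg _) (by positivity)
    have h5 : 0 ≤ C * D * (‖z‖ ^ n * ‖z‖ ^ m) := by positivity
    rw [pow_add]
    linarith
  · have e : f z * g z - f z' * g z' = f z * (g z - g z') + (f z - f z') * g z' := by noncomm_ring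
    rw [e]
    have h5 : ‖g z'‖ ≤ D * ‖z‖ ^ m := (h3 z' hz').trans (by gcongr)
    calc ‖z‖ * ‖f z * (g z - g z') + (f z - f z') * g z'‖
        ≤ ‖z‖ * (‖f z‖ * ‖g z - g z'‖ + ‖f z - f z'‖ * ‖g z'‖) := by
          gcongr
          exact (norm_add_le _ _).trans (add_le_add (norm_mul_le _ _) (norm_mul_le _ _))
      _ = ‖f z‖ * (‖z‖ * ‖g z - g z'‖) + (‖z‖ * ‖f z - f z'‖) * ‖g z'‖ := by ring
      _ ≤ (C * ‖z‖ ^ n) * (D * ‖z‖ ^ m * ‖z - z'‖) + (C * ‖z‖ ^ n * ‖z - z'‖) * (D * ‖z‖ ^ m) :=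
          add_le_add
            (mul_le_mul (h1 z hz) (h4 z hz z' hz' h) (by positivity) (by positivity))
            (mul_le_mul (h2 z hz z' hz' h) h5 (by positivity) (by positivity))
      _ = _ := by rw [pow_add]; ring

theorem VanishesToOrder.mono {n : ℕ} {f : V → W} {s t : Set V} (hf : VanishesToOrder n f s)
    (h : t ⊆ s) : VanishesToOrder n f t := by
  obtain ⟨C, hC, h1, h2⟩ := hf
  exact ⟨C, hC, fun z hz => h1 z (h hz), fun z hz z' hz' => h2 z (h hz) z' (h hz')⟩

theorem VanishesToOrder.of_lipschitz {f : V → W} {s : Set V} {K : ℝ} (hK : 0 ≤ K)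
    (h0 : ∀ z ∈ s, ‖f z‖ ≤ K * ‖z‖) (h : ∀ z ∈ s, ∀ z' ∈ s, ‖f z - f z'‖ ≤ K * ‖z - z'‖) :
    VanishesToOrder 1 f s :=
  ⟨K, hK, fun z hz => by simpa using h0 z hz, fun z hz z' hz' _ => by
    have := mul_le_mul_of_nonneg_left (h z hz z' hz') (norm_nonneg z)
    rw [pow_one]
    linarith⟩

theorem VanishesToOrder.const {c : W} {s : Set V} : VanishesToOrder 0 (fun _ => c) s :=
  ⟨‖c‖, norm_nonneg _, fun z _ => by simp, fun z _ z' _ _ => by simp; positivity⟩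

end Vanishing

/-! ### Reduction of a perturbed kernel to a two by two matrix -/

section Reduction

variable {H : Type*} [NormedAddCommGroup H] [InnerProductSpace ℂ H] [CompleteSpace H]

/-- The rank one operator `x ↦ ⟪p, x⟫ p`. -/
def rankOneSelf (p : H) : H →L[ℂ] H := (ContinuousLinearMap.toSpanSingleton ℂ p).comp (innerSL ℂ p)

theorem rankOneSelf_apply (p x : H) : rankOneSelf p x = (inner ℂ p x : ℂ) • p := by
  simp [rankOneSelf]

theorem isCompactOperator_rankOneSelf (p : H) : IsCompactOperator (rankOneSelf p) :=
  (isCompactOperator_of_locallyCompactSpace_rng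
    (ContinuousLinearMap.toSpanSingleton ℂ p)).comp_clm (innerSL ℂ p)

/-- The Fredholm alternative for `B - E J²` bordered by its kernel. -/
theorem exists_bordered_inverse {J B : H →L[ℂ] H} (hJc : IsCompactOperator J)
    (hJs : J.IsSymmetric) (hBs : B.IsSymmetric) {c δ E : ℝ} (hδ : 0 < δ)
    (hco : CoerciveWith J B c δ) {w : Fin 2 → H}
    (hw : ∀ i, B (w i) = (E : ℂ) • J (J (w i)))
    (hort : ∀ i j, inner ℂ (J (w i)) (J (w j)) = if i = j then (1 : ℂ) else 0)
    (hker : ∀ x, B x = (E : ℂ) • J (J x) → x ∈ Submodule.span ℂ (Set.range w)) :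
    ∃ R : H →L[ℂ] H, (∀ x, R (B x - (E : ℂ) • J (J x)) =
        x - ∑ i, (inner ℂ (J (J (w i))) x : ℂ) • w i) ∧
      ∀ i x, inner ℂ (J (J (w i))) (R x) = inner ℂ (w i) x := by
  let p : Fin 2 → H := fun i => J (J (w i))
  have hJ : ∀ u v, inner ℂ (J u) v = inner ℂ u (J v) := hJs
  have hB : ∀ u v, inner ℂ (B u) v = inner ℂ u (B v) := hBs
  have hpw : ∀ i j, inner ℂ (p i) (w j) = if i = j then (1 : ℂ) else 0 := fun i j => by
    rw [← hort i j]; exact hJ _ _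
  have hwp : ∀ i j, inner ℂ (w i) (p j) = if i = j then (1 : ℂ) else 0 := fun i j => by
    rw [← hort i j]; exact (hJ _ _).symm
  -- The singular operator is bordered by `p i = J² (w i)`, which are dual to the kernel vectors `w
  -- i`. Pairing `Y x` with `w i` annihilates the singular part and leaves `⟨p i, x⟩`, so `Y` is
  -- injective.
  let Y : H →L[ℂ] H := B - (E : ℂ) • J * J + ∑ i, rankOneSelf (p i)
  have hY : ∀ x, Y x = B x - (E : ℂ) • J (J x) + ∑ i, (inner ℂ (p i) x : ℂ) • p i := fun x => by
    simp [Y, rankOneSelf_apply]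
  have hwY : ∀ i x, inner ℂ (w i) (Y x) = inner ℂ (p i) x := by
    intro i x
    rw [hY, inner_add_right, inner_sub_right, ← hB, hw, inner_smul_left, inner_smul_right,
      ← hJ (w i), ← hJ (J (w i)), Complex.conj_ofReal, sub_self, zero_add, inner_sum]
    simp [inner_smul_right, hwp]
  have hYinj : ∀ x, Y x = 0 → x = 0 := by
    intro x hx
    have h0 : ∀ i, inner ℂ (p i) x = 0 := fun i => by rw [← hwY, hx, inner_zero_right]
    have h1 : B x = (E : ℂ) • J (J x) := by
      rw [hY] at hx
      simpa [h0, sub_eq_zero] using hx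
    obtain ⟨a, ha⟩ := (Submodule.mem_span_range_iff_exists_fun ℂ).1 (hker x h1)
    have h2 : ∀ i, a i = 0 := fun i => by
      have := h0 i
      rw [← ha, inner_sum] at this
      simpa [inner_smul_right, hpw] using this
    rw [← ha]
    simp [h2]
  obtain ⟨S, hS1, hS2, -⟩ := hco.exists_inverse hJs hBs hδ
  -- With `S = (B + c J²)⁻¹` one has `S Y = 1 - K` with `K` compact. By the Fredholm alternative,
  -- injectivity of `Y` makes `1 - K` invertible.
  let K : H →L[ℂ] H := S * (((E + c : ℝ) : ℂ) • J * J - ∑ i, rankOneSelf (p i))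
  have hK : ∀ x, S (Y x) = x - K x := by
    intro x
    have h1 : Y x = (B + (c : ℂ) • J * J) x -
        (((E + c : ℝ) : ℂ) • J * J - ∑ i, rankOneSelf (p i)) x := by
      rw [hY]
      simp only [add_apply, sub_apply, mul_apply_eq_comp, smul_apply, sum_apply,
        rankOneSelf_apply, Complex.ofReal_add, add_smul]
      abel
    rw [h1, map_sub, hS2]
    rfl
  have hKc : IsCompactOperator K := by
    have h1 : IsCompactOperator (((E + c : ℝ) : ℂ) • J * J - ∑ i, rankOneSelf (p i)) := by
      rw [Fin.sum_univ_two]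
      exact ((hJc.clm_comp J).smul _).sub
        ((isCompactOperator_rankOneSelf _).add (isCompactOperator_rankOneSelf _))
    exact h1.clm_comp S
  have hres : (1 : ℂ) ∈ resolventSet ℂ K := by
    rcases hKc.hasEigenvalue_or_mem_resolventSet one_ne_zero with h | h
    · exfalso
      obtain ⟨x, hx, hx0⟩ := h.exists_hasEigenvector
      have hx' : K x = x := by
        have := Module.End.mem_eigenspace_iff.1 hx
        simpa using this
      apply hx0
      apply hYinj
      rw [← hS1 (Y x), hK, hx', sub_self, map_zero]
    · exact h
  rw [spectrum.mem_resolventSet_iff, map_one] at hres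
  obtain ⟨u, hu⟩ := hres
  let R : H →L[ℂ] H := (↑u⁻¹ : H →L[ℂ] H) * S
  have hRY : ∀ x, R (Y x) = x := by
    intro x
    show (↑u⁻¹ : H →L[ℂ] H) (S (Y x)) = x
    have h1 : S (Y x) = (u : H →L[ℂ] H) x := by rw [hK, hu]; rfl
    rw [h1, ← mul_apply_eq_comp, Units.inv_mul]; rfl
  have hYR : ∀ x, Y (R x) = x := by
    intro x
    have h1 : S (Y (R x)) = S x := by
      rw [hK]
      have : R x - K (R x) = (u : H →L[ℂ] H) (R x) := by rw [hu]; rfl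
      rw [this]
      show (u : H →L[ℂ] H) ((↑u⁻¹ : H →L[ℂ] H) (S x)) = S x
      rw [← mul_apply_eq_comp, Units.mul_inv]; rfl
    rw [← hS1 (Y (R x)), h1, hS1]
  refine ⟨R, fun x => ?_, fun i x => by rw [← hwY, hYR]⟩
  -- The singular part vanishes at `w i`, so `Y (w i) = p i`. Applying `R = Y⁻¹` to the definition
  -- of `Y x` then gives the formula for `R` on the singular part.
  have hRp : ∀ i, R (p i) = w i := fun i => by
    rw [← hRY (w i), hY, hw]
    simp [hpw]
  have h1 := hRY x
  rw [hY, map_add, map_sum] at h1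
  simp only [map_smul, hRp] at h1
  exact eq_sub_of_add_eq h1

/-- If `X` depends on a parameter in a Lipschitz continuous way, then for small parameters the
kernel of `X` is governed by a two by two matrix, up to terms that vanish to second order. -/
theorem exists_reduced_matrix {V : Type*} [NormedAddCommGroup V] {Z : V → H →L[ℂ] H} {r : ℝ}
    (hr : 0 < r)
    (hZ : VanishesToOrder 1 Z (Metric.ball 0 r)) {w p : Fin 2 → H} (R : H →L[ℂ] H)
    (hp : ∀ i x, inner ℂ (p i) (R x) = inner ℂ (w i) x)
    (hpw : ∀ i j, inner ℂ (p i) (w j) = if i = j then (1 : ℂ) else 0) :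
    ∃ r' > 0, ∃ q : Fin 2 → Fin 2 → V → ℂ,
      (∀ i j, VanishesToOrder 2 (q i j) (Metric.ball 0 r')) ∧
      ∀ z ∈ Metric.ball (0 : V) r', ∀ x, R (-Z z x) = x - ∑ i, (inner ℂ (p i) x : ℂ) • w i →
        ((∀ i, ∑ j, (inner ℂ (w i) (Z z (w j)) + q i j z) * inner ℂ (p j) x = 0) ∧
        ((∀ i, inner ℂ (p i) x = 0) → x = 0)) := by
  obtain ⟨C, hC, hC1, hC2⟩ := id hZ
  -- The radius at which `‖R Z‖ ≤ 1/2`, so that `1 + R Z` has an inverse `N` with norm at most 2.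
  let r' := min r (1 / (2 * (‖R‖ * C + 1)))
  have hr' : 0 < r' := lt_min hr (by positivity)
  have hsub : Metric.ball (0 : V) r' ⊆ Metric.ball 0 r := Metric.ball_subset_ball (min_le_left _ _)
  have hsmall : ∀ z ∈ Metric.ball (0 : V) r', ‖R * Z z‖ ≤ 1 / 2 := by
    intro z hz
    have h1 : ‖z‖ ≤ 1 / (2 * (‖R‖ * C + 1)) :=
      ((mem_ball_zero_iff.1 hz).trans_le (min_le_right _ _)).le
    rw [le_div_iff₀ (by positivity)] at h1
    have h2 := hC1 z (hsub hz)
    rw [pow_one] at h2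
    calc ‖R * Z z‖ ≤ ‖R‖ * ‖Z z‖ := norm_mul_le _ _
      _ ≤ ‖R‖ * (C * ‖z‖) := by gcongr
      _ ≤ 1 / 2 := by nlinarith [norm_nonneg z]
  have hN : ∀ z, ∃ N : H →L[ℂ] H, z ∈ Metric.ball (0 : V) r' →
      (∀ x, (1 + R * Z z) (N x) = x) ∧ (∀ x, N ((1 + R * Z z) x) = x) ∧ ‖N‖ ≤ 2 := by
    intro z
    by_cases hz : z ∈ Metric.ball (0 : V) r'
    · obtain ⟨N, h1, h2, h3⟩ := exists_inverse_of_coercive (S := 1 + R * Z z) (δ := 1 / 2)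
        (by norm_num) (fun x => by
          have h1 : (inner ℂ x ((1 + R * Z z) x)).re = ‖x‖ ^ 2 + (inner ℂ x ((R * Z z) x)).re := by
            simp [inner_self_eq_norm_sq_to_K, ← Complex.ofReal_pow]
          have h2 : ‖inner ℂ x ((R * Z z) x)‖ ≤ 1 / 2 * ‖x‖ ^ 2 := by
            calc _ ≤ ‖x‖ * ‖(R * Z z) x‖ := norm_inner_le_norm _ _
              _ ≤ ‖x‖ * (‖R * Z z‖ * ‖x‖) := by gcongr; exact ContinuousLinearMap.le_opNorm _ _
              _ ≤ ‖x‖ * (1 / 2 * ‖x‖) := by gcongr; exact hsmall z hz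
              _ = _ := by ring
          have h3 := (abs_le.1 (Complex.abs_re_le_norm (inner ℂ x ((R * Z z) x)))).1
          rw [h1]
          linarith)
      exact ⟨N, fun _ => ⟨h1, h2, by norm_num at h3; exact h3⟩⟩
    · exact ⟨0, fun h => absurd h hz⟩
  choose N hN using hN
  have hNord : VanishesToOrder 0 N (Metric.ball 0 r') := by
    refine ⟨4 * ‖R‖ * C * 1 + 2, by positivity, fun z hz => ?_, fun z hz z' hz' h => ?_⟩
    · rw [pow_zero, mul_one]
      have := (hN z hz).2.2
      have : 0 ≤ 4 * ‖R‖ * C * 1 := by positivity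
      linarith
    · have e : N z - N z' = N z * (R * (Z z' - Z z)) * N z' := by
        ext x
        have h1 := (hN z hz).2.1 (N z' x)
        have h2 := congrArg (N z) ((hN z' hz').1 x)
        simp only [add_apply, one_apply_eq_self, mul_apply_eq_comp, map_add] at h1 h2
        simp only [sub_apply, mul_apply_eq_comp, map_sub]
        calc N z x - N z' x = (N z (N z' x) + N z (R (Z z' (N z' x)))) -
              (N z (N z' x) + N z (R (Z z (N z' x)))) := by rw [h1, h2]
          _ = _ := by abel
      have h3 := hC2 z (hsub hz) z' (hsub hz') h
      have h4 : ‖z‖ * ‖Z z' - Z z‖ ≤ C * ‖z‖ * ‖z - z'‖ := by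
        rw [norm_sub_rev]; simpa using h3
      rw [e, pow_zero]
      have h5 : ‖N z * (R * (Z z' - Z z)) * N z'‖ ≤ 2 * (‖R‖ * ‖Z z' - Z z‖) * 2 := by
        refine (norm_mul_le _ _).trans ?_
        gcongr
        · refine (norm_mul_le _ _).trans ?_
          gcongr
          · exact (hN z hz).2.2
          · exact norm_mul_le _ _
        · exact (hN z' hz').2.2
      have h6 : ‖z‖ * ‖N z * (R * (Z z' - Z z)) * N z'‖ ≤ 4 * ‖R‖ * (C * ‖z‖ * ‖z - z'‖) := by
        calc _ ≤ ‖z‖ * (2 * (‖R‖ * ‖Z z' - Z z‖) * 2) := by gcongr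
          _ = 4 * ‖R‖ * (‖z‖ * ‖Z z' - Z z‖) := by ring
          _ ≤ _ := by gcongr
      refine h6.trans ?_
      have h7 := hsmall z hz
      have h8 : ‖R‖ * C * ‖z‖ ≤ 1 / 2 := by
        have h1 : ‖z‖ ≤ 1 / (2 * (‖R‖ * C + 1)) :=
          ((mem_ball_zero_iff.1 hz).trans_le (min_le_right _ _)).le
        rw [le_div_iff₀ (by positivity)] at h1
        nlinarith [norm_nonneg z]
      have h9 : 0 ≤ 4 * ‖R‖ * C * 1 := by positivity
      nlinarith [norm_nonneg (z - z')]
  have hZ' := hZ.mono hsub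
  have hQ : VanishesToOrder 2 (fun z => Z z * R * Z z * N z) (Metric.ball 0 r') := by
    have := ((hZ'.mul (VanishesToOrder.const (c := R))).mul hZ').mul hNord
    simpa using this
  refine ⟨r', hr', fun i j z => -inner ℂ (w i) ((Z z * R * Z z * N z) (w j)), fun i j => ?_,
    fun z hz x hx => ?_⟩
  · refine VanishesToOrder.neg (hQ.map (g := fun T : H →L[ℂ] H => inner ℂ (w i) (T (w j)))
      (K := ‖w i‖ * ‖w j‖) (by positivity) (fun T => ?_) (fun T T' => ?_))
    · calc _ ≤ ‖w i‖ * ‖T (w j)‖ := norm_inner_le_norm _ _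
        _ ≤ ‖w i‖ * (‖T‖ * ‖w j‖) := by gcongr; exact T.le_opNorm _
        _ = _ := by ring
    · rw [← inner_sub_right, ← sub_apply]
      calc _ ≤ ‖w i‖ * ‖(T - T') (w j)‖ := norm_inner_le_norm _ _
        _ ≤ ‖w i‖ * (‖T - T'‖ * ‖w j‖) := by gcongr; exact (T - T').le_opNorm _
        _ = _ := by ring
  · obtain ⟨hN1, hN2, -⟩ := hN z hz
    set c : Fin 2 → ℂ := fun j => inner ℂ (p j) x with hc
    have hx1 : (1 + R * Z z) x = ∑ j, c j • w j := by
      rw [map_neg] at hx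
      simp only [add_apply, one_apply_eq_self, mul_apply_eq_comp]
      rw [← neg_neg (R (Z z x)), hx]
      abel
    have hx2 : x = ∑ j, c j • N z (w j) := by
      rw [← hN2 x, hx1, map_sum]
      simp
    -- Pairing `(1 + R Z) x = ∑ c_j w_j` with `p i` gives `c_i + ⟨w_i, Z x⟩ = c_i`. Inserting `x = ∑
    -- c_j N w_j` yields the matrix equation; expanding `Z N = Z - Z R Z N` isolates its remainder
    -- `q`.
    have hZx : ∀ i, inner ℂ (w i) (Z z x) = 0 := by
      intro i
      have h1 := congrArg (fun y => (inner ℂ (p i) y : ℂ)) hx1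
      simp only [add_apply, one_apply_eq_self, mul_apply_eq_comp, inner_add_right, hp, inner_sum,
        inner_smul_right, hpw] at h1
      simp only [mul_ite, mul_one, mul_zero, Finset.sum_ite_eq, Finset.mem_univ, if_true] at h1
      simpa [hc] using h1
    refine ⟨fun i => ?_, fun h0 => ?_⟩
    · have h3 := hZx i
      rw [hx2] at h3
      simp only [map_sum, map_smul, inner_sum, inner_smul_right] at h3
      rw [← h3]
      refine Finset.sum_congr rfl fun j _ => ?_
      have h4 : N z (w j) = w j - R (Z z (N z (w j))) := by
        have := hN1 (w j)
        simp only [add_apply, one_apply_eq_self, mul_apply_eq_comp] at this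
        exact eq_sub_of_add_eq this
      have h5 : Z z (N z (w j)) = Z z (w j) - Z z (R (Z z (N z (w j)))) := by
        rw [← map_sub, ← h4]
      rw [h5, inner_sub_right]
      simp only [mul_apply_eq_comp, hc]
      ring
    · rw [hx2]
      simp [hc, h0]

end Reduction

/-! ### Conical level sets -/

section Cone

/-- Roots `μ` of `μ² - υ² ‖κ‖² + S κ μ`, where `S` vanishes to third order, lie near the double cone
`|μ| = υ ‖κ‖`, and the slope on each sheet is Lipschitz continuous. -/
theorem cone_slope_estimate {V : Type*} [NormedAddCommGroup V] {S : V × ℝ → ℂ} {r υ C₀ : ℝ}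
    (hr : 0 < r) (hυ : 0 < υ) (hC₀ : 0 ≤ C₀) (hS : VanishesToOrder 3 S (Metric.ball 0 r)) :
    ∃ ζ > 0, ∃ C, 0 ≤ C ∧ ∀ κ : V, 0 < ‖κ‖ → ‖κ‖ < ζ → ∀ μ : ℝ, |μ| ≤ C₀ * ‖κ‖ →
      ((μ : ℂ) ^ 2 - (υ : ℂ) ^ 2 * (‖κ‖ : ℂ) ^ 2 + S (κ, μ) = 0) →
      μ ≠ 0 ∧ |(|μ| / ‖κ‖) - υ| ≤ C * ‖κ‖ ∧
      ∀ κ' : V, 0 < ‖κ'‖ → ‖κ'‖ ≤ ‖κ‖ → ∀ μ' : ℝ, |μ'| ≤ C₀ * ‖κ'‖ →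
        ((μ' : ℂ) ^ 2 - (υ : ℂ) ^ 2 * (‖κ'‖ : ℂ) ^ 2 + S (κ', μ') = 0) →
        0 < μ * μ' → |μ / ‖κ‖ - μ' / ‖κ'‖| ≤ C * ‖κ - κ'‖ := by
  obtain ⟨D, hD, hS1, hS2⟩ := hS
  -- For `|μ| ≤ C₀ ‖κ‖` the pair `(κ, μ)` has norm at most `a ‖κ‖`, so `S` is of third order in
  -- `‖κ‖` alone.
  set a := 1 + C₀ with ha
  have ha1 : 1 ≤ a := by linarith
  -- the constant for the Lipschitz estimate before absorption
  set D₁ := D * a ^ 3 with hD₁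
  have hD₁0 : 0 ≤ D₁ := by positivity
  -- The three bounds keep `(κ, μ)` inside the ball of radius `r`, force a slope of at least `υ /
  -- 2`, and allow the feedback term `D₁ ‖κ‖ |m - m'|` to be absorbed at the end.
  set ζ := min (r / a) (min (υ ^ 2 / (2 * (D₁ + 1))) (υ / (8 * (D₁ + 1)))) with hζ
  have hζ0 : 0 < ζ := by positivity
  have key : ∀ κ : V, 0 < ‖κ‖ → ‖κ‖ < ζ → ∀ μ : ℝ, |μ| ≤ C₀ * ‖κ‖ →
      ((μ : ℂ) ^ 2 - (υ : ℂ) ^ 2 * (‖κ‖ : ℂ) ^ 2 + S (κ, μ) = 0) →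
      (κ, μ) ∈ Metric.ball (0 : V × ℝ) r ∧ ‖(κ, μ)‖ ≤ a * ‖κ‖ ∧ ‖S (κ, μ)‖ ≤ D₁ * ‖κ‖ ^ 3 ∧
      (μ / ‖κ‖) ^ 2 = υ ^ 2 - (S (κ, μ)).re / ‖κ‖ ^ 2 ∧ |(μ / ‖κ‖) ^ 2 - υ ^ 2| ≤ D₁ * ‖κ‖ ∧
      υ / 2 ≤ |μ| / ‖κ‖ := by
    intro κ h0 h1 μ hμ hroot
    have h2 : ‖(κ, μ)‖ ≤ a * ‖κ‖ := by
      rw [Prod.norm_def]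
      refine max_le ?_ ?_
      · show ‖κ‖ ≤ a * ‖κ‖
        nlinarith
      · show |μ| ≤ a * ‖κ‖
        nlinarith
    have h3 : (κ, μ) ∈ Metric.ball (0 : V × ℝ) r := by
      rw [mem_ball_zero_iff]
      have : ‖κ‖ < r / a := h1.trans_le (min_le_left _ _)
      rw [lt_div_iff₀ (by linarith)] at this
      linarith
    have h4 : ‖S (κ, μ)‖ ≤ D₁ * ‖κ‖ ^ 3 := by
      refine (hS1 _ h3).trans ?_
      calc D * ‖(κ, μ)‖ ^ 3 ≤ D * (a * ‖κ‖) ^ 3 := by gcongr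
        _ = _ := by rw [hD₁]; ring
    have h5 : μ ^ 2 - υ ^ 2 * ‖κ‖ ^ 2 + (S (κ, μ)).re = 0 := by
      have := congrArg Complex.re hroot
      rw [Complex.add_re, Complex.sub_re, ← Complex.ofReal_pow, ← Complex.ofReal_pow,
        ← Complex.ofReal_pow, ← Complex.ofReal_mul, Complex.ofReal_re, Complex.ofReal_re] at this
      simpa using this
    have h6 : (μ / ‖κ‖) ^ 2 = υ ^ 2 - (S (κ, μ)).re / ‖κ‖ ^ 2 := by
      field_simp
      linarith
    have h7 : |(μ / ‖κ‖) ^ 2 - υ ^ 2| ≤ D₁ * ‖κ‖ := by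
      rw [h6, sub_sub_cancel_left, abs_neg, abs_div, abs_of_pos (show (0 : ℝ) < ‖κ‖ ^ 2 by positivity),
        div_le_iff₀ (by positivity)]
      calc _ ≤ ‖S (κ, μ)‖ := Complex.abs_re_le_norm _
        _ ≤ _ := h4
        _ = _ := by ring
    refine ⟨h3, h2, h4, h6, h7, ?_⟩
    have h8 : ‖κ‖ ≤ υ ^ 2 / (2 * (D₁ + 1)) :=
      (h1.trans_le ((min_le_right _ _).trans (min_le_left _ _))).le
    rw [le_div_iff₀ (by positivity)] at h8
    have h9 : (υ / 2) ^ 2 ≤ (|μ| / ‖κ‖) ^ 2 := by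
      rw [div_pow |μ|, sq_abs, ← div_pow]
      have := (abs_le.1 h7).1
      nlinarith
    exact (abs_le_of_sq_le_sq' h9 (by positivity)).2
  refine ⟨ζ, hζ0, max (D₁ / υ) (8 * D₁ * (1 + C₀) / υ + 8 * D₁ / υ), by positivity, ?_⟩
  intro κ h0 h1 μ hμ hroot
  obtain ⟨k1, k2, k3, k4, k5, k6⟩ := key κ h0 h1 μ hμ hroot
  refine ⟨?_, ?_, ?_⟩
  · rintro rfl
    simp at k6
    linarith
  · have e : (|μ| / ‖κ‖) ^ 2 = (μ / ‖κ‖) ^ 2 := by rw [div_pow, sq_abs, ← div_pow]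
    rw [← e] at k5
    have hpos : υ ≤ |μ| / ‖κ‖ + υ := by linarith [div_nonneg (abs_nonneg μ) h0.le]
    have h2 : |(|μ| / ‖κ‖) - υ| * (|μ| / ‖κ‖ + υ) ≤ D₁ * ‖κ‖ := by
      rw [← abs_of_pos (show 0 < |μ| / ‖κ‖ + υ by linarith), ← abs_mul]
      rwa [show ((|μ| / ‖κ‖) - υ) * (|μ| / ‖κ‖ + υ) = (|μ| / ‖κ‖) ^ 2 - υ ^ 2 by ring]
    have h3 : |(|μ| / ‖κ‖) - υ| * υ ≤ D₁ * ‖κ‖ :=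
      (mul_le_mul_of_nonneg_left hpos (abs_nonneg _)).trans h2
    calc _ ≤ D₁ * ‖κ‖ / υ := by rwa [le_div_iff₀ hυ]
      _ = D₁ / υ * ‖κ‖ := by ring
      _ ≤ _ := by gcongr; exact le_max_left _ _
  · intro κ' h0' hle μ' hμ' hroot' hsign
    obtain ⟨l1, l2, l3, l4, l5, l6⟩ := key κ' h0' (hle.trans_lt h1) μ' hμ' hroot'
    set m := μ / ‖κ‖ with hm
    set m' := μ' / ‖κ'‖ with hm'
    have hmabs : υ / 2 ≤ |m| := by rwa [hm, abs_div, abs_norm]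
    have hmabs' : υ / 2 ≤ |m'| := by rwa [hm', abs_div, abs_norm]
    have hmul : 0 < m * m' := by
      rw [hm, hm', div_mul_div_comm]; positivity
    -- Slopes on the same sheet have the same sign and size at least `υ / 2`. Division by `m + m'`
    -- thus turns a bound for `m² - m'²` into one for `m - m'`.
    have hsum : υ ≤ |m + m'| := by
      have : |m + m'| = |m| + |m'| := by
        rw [abs_add_eq_add_abs_iff]
        rcases pos_and_pos_or_neg_and_neg_of_mul_pos hmul with h | h
        · exact .inl ⟨h.1.le, h.2.le⟩
        · exact .inr ⟨h.1.le, h.2.le⟩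
      linarith
    set d := ‖κ - κ'‖ with hd
    have hdn : |‖κ‖ - ‖κ'‖| ≤ d := abs_norm_sub_norm_le _ _
    have hm'C : |m'| ≤ C₀ := by
      rw [hm', abs_div, abs_norm, div_le_iff₀ h0']; exact hμ'
    -- `S` depends on `μ` as well, so its variation reintroduces the unknown `|m - m'|`, but with
    -- the small factor `‖κ‖`.
    have hμd : |μ - μ'| ≤ ‖κ‖ * |m - m'| + C₀ * d := by
      have e : μ - μ' = ‖κ‖ * (m - m') + m' * (‖κ‖ - ‖κ'‖) := by
        rw [hm, hm']; field_simp; ring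
      rw [e]
      refine (abs_add_le _ _).trans ?_
      rw [abs_mul, abs_mul, abs_norm]
      gcongr
    have hzd : ‖(κ, μ) - (κ', μ')‖ ≤ (1 + C₀) * d + ‖κ‖ * |m - m'| := by
      rw [Prod.mk_sub_mk, Prod.norm_def]
      refine max_le ?_ ?_
      · show d ≤ _
        have : 0 ≤ ‖κ‖ * |m - m'| := by positivity
        have : 0 ≤ C₀ * d := by positivity
        linarith
      · show |μ - μ'| ≤ _
        have : 0 ≤ d := norm_nonneg _
        linarith
    -- difference of the values of `S`
    have hSd : ‖S (κ, μ) - S (κ', μ')‖ ≤ D₁ * ‖κ‖ ^ 2 * ((1 + C₀) * d + ‖κ‖ * |m - m'|) := by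
      have aux : ∀ z ∈ Metric.ball (0 : V × ℝ) r, ∀ z' ∈ Metric.ball (0 : V × ℝ) r, 0 < ‖z‖ →
          ‖z'‖ ≤ ‖z‖ → ‖z‖ ≤ a * ‖κ‖ → ‖S z - S z'‖ ≤ D₁ * ‖κ‖ ^ 2 * ‖z - z'‖ := by
        intro z hz z' hz' hzpos hzz hza
        have h2 := hS2 z hz z' hz' hzz
        have h3 : ‖S z - S z'‖ ≤ D * ‖z‖ ^ 2 * ‖z - z'‖ := by
          have : ‖z‖ * ‖S z - S z'‖ ≤ ‖z‖ * (D * ‖z‖ ^ 2 * ‖z - z'‖) := by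
            refine h2.trans (le_of_eq ?_); ring
          exact le_of_mul_le_mul_left this hzpos
        refine h3.trans (mul_le_mul_of_nonneg_right ?_ (norm_nonneg _))
        calc D * ‖z‖ ^ 2 ≤ D * (a * ‖κ‖) ^ 2 := by gcongr
          _ = D * a ^ 2 * ‖κ‖ ^ 2 := by ring
          _ ≤ D₁ * ‖κ‖ ^ 2 := by
            rw [hD₁]
            have : a ^ 2 ≤ a ^ 3 := pow_le_pow_right₀ ha1 (by norm_num)
            gcongr
      refine le_trans ?_ (mul_le_mul_of_nonneg_left hzd (by positivity))
      have hpz : 0 < ‖(κ, μ)‖ := lt_of_lt_of_le h0 (le_max_left _ _)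
      have hpz' : 0 < ‖(κ', μ')‖ := lt_of_lt_of_le h0' (le_max_left _ _)
      rcases le_total ‖(κ', μ')‖ ‖(κ, μ)‖ with h | h
      · exact aux _ k1 _ l1 hpz h k2
      · rw [norm_sub_rev, norm_sub_rev (κ, μ)]
        exact aux _ l1 _ k1 hpz' h (l2.trans (by gcongr))
    have hdiff : |m ^ 2 - m' ^ 2| ≤ D₁ * ((1 + C₀) * d + ‖κ‖ * |m - m'|) + 2 * D₁ * d := by
      -- The variation of `Re S / ‖κ‖²` is split into that of the numerator over the larger
      -- denominator and that of the denominator, paired with the value of `S` at the smaller point.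
      have e : m ^ 2 - m' ^ 2 = -(((S (κ, μ)).re - (S (κ', μ')).re) / ‖κ‖ ^ 2) +
          (S (κ', μ')).re * ((‖κ‖ ^ 2 - ‖κ'‖ ^ 2) / (‖κ‖ ^ 2 * ‖κ'‖ ^ 2)) := by
        rw [k4, l4]; field_simp; ring
      rw [e]
      refine (abs_add_le _ _).trans (add_le_add ?_ ?_)
      · rw [abs_neg, abs_div, abs_of_pos (show (0 : ℝ) < ‖κ‖ ^ 2 by positivity),
          div_le_iff₀ (by positivity), ← Complex.sub_re]
        refine (Complex.abs_re_le_norm _).trans (hSd.trans (le_of_eq ?_))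
        ring
      · rw [abs_mul, abs_div, abs_of_pos (show (0 : ℝ) < ‖κ‖ ^ 2 * ‖κ'‖ ^ 2 by positivity)]
        have h2 : |(S (κ', μ')).re| ≤ D₁ * ‖κ'‖ ^ 3 := (Complex.abs_re_le_norm _).trans l3
        have h3 : |‖κ‖ ^ 2 - ‖κ'‖ ^ 2| ≤ d * (2 * ‖κ‖) := by
          rw [sq_sub_sq, mul_comm, abs_mul]
          gcongr
          rw [abs_of_pos (by positivity)]
          linarith
        calc _ ≤ (D₁ * ‖κ'‖ ^ 3) * ((d * (2 * ‖κ‖)) / (‖κ‖ ^ 2 * ‖κ'‖ ^ 2)) := by gcongr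
          _ = 2 * D₁ * d * (‖κ'‖ / ‖κ‖) := by field_simp
          _ ≤ 2 * D₁ * d * 1 := by
            gcongr
            rwa [div_le_one h0]
          _ = _ := by ring
    have hfin : |m - m'| * υ ≤ D₁ * ((1 + C₀) * d + ‖κ‖ * |m - m'|) + 2 * D₁ * d := by
      refine le_trans ?_ hdiff
      rw [sq_sub_sq, abs_mul, mul_comm]
      gcongr
    have hκ : ‖κ‖ ≤ υ / (8 * (D₁ + 1)) :=
      (h1.trans_le ((min_le_right _ _).trans (min_le_right _ _))).le
    rw [le_div_iff₀ (by positivity)] at hκ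
    have habs : D₁ * (‖κ‖ * |m - m'|) ≤ υ / 8 * |m - m'| := by
      rw [← mul_assoc]
      refine mul_le_mul_of_nonneg_right ?_ (abs_nonneg _)
      linarith
    have hd0 : 0 ≤ d := norm_nonneg _
    have h9 : |m - m'| * υ ≤ (8 * D₁ * (1 + C₀) + 8 * D₁) * d := by
      have h1 : 0 ≤ |m - m'| * υ := by positivity
      have h2 : 0 ≤ D₁ * d := by positivity
      have h3 : 0 ≤ D₁ * C₀ * d := by positivity
      have e : D₁ * ((1 + C₀) * d + ‖κ‖ * |m - m'|) = D₁ * d + D₁ * C₀ * d +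
        D₁ * (‖κ‖ * |m - m'|) := by ring
      rw [e] at hfin
      linarith
    calc |m - m'| ≤ (8 * D₁ * (1 + C₀) + 8 * D₁) * d / υ := by rwa [le_div_iff₀ hυ]
      _ = (8 * D₁ * (1 + C₀) / υ + 8 * D₁ / υ) * d := by ring
      _ ≤ _ := by gcongr; exact le_max_right _ _

/-- Two distinct roots of `μ² - υ² ‖κ‖² + S κ μ`, as functions of `κ`, form a double cone. -/
theorem exists_conical_expansion {V : Type*} [NormedAddCommGroup V] {S : V × ℝ → ℂ}
    {r υ C₀ : ℝ} (hr : 0 < r) (hυ : 0 < υ) (hC₀ : 0 ≤ C₀)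
    (hS : VanishesToOrder 3 S (Metric.ball 0 r)) {lo hi : V → ℝ}
    (hlo : ∀ κ, ‖κ‖ < r → |lo κ| ≤ C₀ * ‖κ‖) (hhi : ∀ κ, ‖κ‖ < r → |hi κ| ≤ C₀ * ‖κ‖)
    (hlt : ∀ κ, 0 < ‖κ‖ → ‖κ‖ < r → lo κ < hi κ)
    (rlo : ∀ κ, ‖κ‖ < r → (lo κ : ℂ) ^ 2 - (υ : ℂ) ^ 2 * (‖κ‖ : ℂ) ^ 2 + S (κ, lo κ) = 0)
    (rhi : ∀ κ, ‖κ‖ < r → (hi κ : ℂ) ^ 2 - (υ : ℂ) ^ 2 * (‖κ‖ : ℂ) ^ 2 + S (κ, hi κ) = 0) :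
    ∃ ζ > 0, ∃ eplus eminus : V → ℝ, ∃ L : NNReal,
      LipschitzOnWith L eplus (Metric.ball 0 ζ) ∧ LipschitzOnWith L eminus (Metric.ball 0 ζ) ∧
      (∃ C : ℝ, ∀ κ ∈ Metric.ball (0 : V) ζ, |eplus κ| ≤ C * ‖κ‖ ∧ |eminus κ| ≤ C * ‖κ‖) ∧
      ∀ κ ∈ Metric.ball (0 : V) ζ, hi κ = υ * ‖κ‖ * (1 + eplus κ) ∧
        lo κ = -(υ * ‖κ‖ * (1 + eminus κ)) := by
  obtain ⟨ζ, hζ, C, hC, H⟩ := cone_slope_estimate hr hυ hC₀ hS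
  let ζ' := min ζ r
  have hζ' : 0 < ζ' := lt_min hζ hr
  have hhi0 : ∀ κ, 0 < ‖κ‖ → ‖κ‖ < ζ' → 0 < hi κ ∧ lo κ < 0 := by
    intro κ h0 h1
    have hz : ‖κ‖ < ζ := h1.trans_le (min_le_left _ _)
    have hr' : ‖κ‖ < r := h1.trans_le (min_le_right _ _)
    obtain ⟨a1, -, a3⟩ := H κ h0 hz _ (hhi κ hr') (rhi κ hr')
    obtain ⟨b1, -, -⟩ := H κ h0 hz _ (hlo κ hr') (rlo κ hr')
    -- Two roots of equal sign at the same `κ` coincide, by the slope estimate with `κ' = κ`. Two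
    -- distinct roots therefore lie on opposite sheets.
    have hneg : ¬ 0 < hi κ * lo κ := by
      intro h
      have := a3 κ h0 le_rfl _ (hlo κ hr') (rlo κ hr') h
      rw [sub_self, norm_zero, mul_zero] at this
      have h2 := abs_nonpos_iff.1 this
      rw [← sub_div, div_eq_zero_iff] at h2
      rcases h2 with h2 | h2
      · linarith [hlt κ h0 hr']
      · exact h0.ne' h2
    have hl := hlt κ h0 hr'
    constructor
    · by_contra h
      have h3 : hi κ < 0 := lt_of_le_of_ne (not_lt.1 h) a1
      exact hneg (mul_pos_of_neg_of_neg h3 (hl.trans h3))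
    · by_contra h
      have h3 : 0 < lo κ := lt_of_le_of_ne (not_lt.1 h) (Ne.symm b1)
      exact hneg (mul_pos (h3.trans hl) h3)
  -- the relative slope error of one sheet
  have main : ∀ (f : V → ℝ) (s : ℝ), |s| = 1 → (∀ κ, ‖κ‖ < r → |f κ| ≤ C₀ * ‖κ‖) →
      (∀ κ, ‖κ‖ < r → (f κ : ℂ) ^ 2 - (υ : ℂ) ^ 2 * (‖κ‖ : ℂ) ^ 2 + S (κ, f κ) = 0) →
      (∀ κ, 0 < ‖κ‖ → ‖κ‖ < ζ' → 0 < s * f κ) →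
      ∃ e : V → ℝ, LipschitzOnWith (Real.toNNReal (C / υ)) e (Metric.ball 0 ζ') ∧
        (∀ κ ∈ Metric.ball (0 : V) ζ', |e κ| ≤ C / υ * ‖κ‖) ∧
        ∀ κ ∈ Metric.ball (0 : V) ζ', s * f κ = υ * ‖κ‖ * (1 + e κ) := by
    intro f s hs hf rf hpos
    -- The sign `s = ±1` treats both sheets at once. The value 0 at the origin is the one forced by
    -- the bound `|e κ| ≤ C / υ * ‖κ‖`.
    let e : V → ℝ := fun κ => if ‖κ‖ = 0 then 0 else s * f κ / (υ * ‖κ‖) - 1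
    have he : ∀ κ ∈ Metric.ball (0 : V) ζ', |e κ| ≤ C / υ * ‖κ‖ := by
      intro κ hκ
      rw [mem_ball_zero_iff] at hκ
      by_cases h0 : ‖κ‖ = 0
      · simp [e, h0]
      · have hp : 0 < ‖κ‖ := lt_of_le_of_ne (norm_nonneg _) (Ne.symm h0)
        have hz : ‖κ‖ < ζ := hκ.trans_le (min_le_left _ _)
        have hr' : ‖κ‖ < r := hκ.trans_le (min_le_right _ _)
        obtain ⟨-, a2, -⟩ := H κ hp hz _ (hf κ hr') (rf κ hr')
        have h1 : |f κ| = s * f κ := by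
          rw [← abs_of_pos (hpos κ hp hκ), abs_mul, hs, one_mul]
        rw [h1] at a2
        have h2 : e κ = (s * f κ / ‖κ‖ - υ) / υ := by
          simp only [e, if_neg h0]; field_simp
        rw [h2, abs_div, abs_of_pos hυ, div_le_iff₀ hυ]
        calc _ ≤ C * ‖κ‖ := a2
          _ = _ := by field_simp
    refine ⟨e, ?_, he, fun κ hκ => ?_⟩
    -- The slope estimate requires ordered norms and non-zero points. The point `y = 0` is covered
    -- by the size bound, the other order by symmetry.
    · have half : ∀ x ∈ Metric.ball (0 : V) ζ', ∀ y ∈ Metric.ball (0 : V) ζ', ‖y‖ ≤ ‖x‖ →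
          |e x - e y| ≤ C / υ * ‖x - y‖ := by
        intro x hx y hy hxy
        by_cases hy0 : ‖y‖ = 0
        · have h1 : y = 0 := norm_eq_zero.1 hy0
          have h2 : e y = 0 := by simp [e, hy0]
          rw [h2, h1, sub_zero, sub_zero]
          exact he x hx
        · have hpy : 0 < ‖y‖ := lt_of_le_of_ne (norm_nonneg _) (Ne.symm hy0)
          have hpx : 0 < ‖x‖ := hpy.trans_le hxy
          rw [mem_ball_zero_iff] at hx hy
          have hr' : ‖x‖ < r := hx.trans_le (min_le_right _ _)
          have hr'' : ‖y‖ < r := hy.trans_le (min_le_right _ _)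
          obtain ⟨-, -, a3⟩ := H x hpx (hx.trans_le (min_le_left _ _)) _ (hf x hr') (rf x hr')
          have hss : s * s = 1 := by rw [← abs_mul_abs_self, hs, one_mul]
          have h3 : 0 < f x * f y := by
            have := mul_pos (hpos x hpx hx) (hpos y hpy hy)
            have e1 : s * f x * (s * f y) = f x * f y := by
              linear_combination (f x * f y) * hss
            rwa [e1] at this
          have h4 := a3 y hpy hxy _ (hf y hr'') (rf y hr'') h3
          have h5 : e x - e y = s * (f x / ‖x‖ - f y / ‖y‖) / υ := by
            simp only [e, if_neg hpx.ne', if_neg hy0]; field_simp; ring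
          rw [h5, abs_div, abs_mul, hs, one_mul, abs_of_pos hυ, div_le_iff₀ hυ]
          calc _ ≤ C * ‖x - y‖ := h4
            _ = _ := by field_simp
      refine LipschitzOnWith.of_dist_le_mul fun x hx y hy => ?_
      rw [Real.coe_toNNReal _ (by positivity), Real.dist_eq, dist_eq_norm]
      rcases le_total ‖y‖ ‖x‖ with h | h
      · exact half x hx y hy h
      · rw [abs_sub_comm, norm_sub_rev]
        exact half y hy x hx h
    · rw [mem_ball_zero_iff] at hκ
      by_cases h0 : ‖κ‖ = 0
      · have := hf κ (by rw [h0]; exact hr)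
        rw [h0, mul_zero] at this
        rw [abs_nonpos_iff.1 this, h0]; simp
      · simp only [e, if_neg h0]; field_simp; ring
  obtain ⟨ep, p1, p2, p3⟩ := main hi 1 (by simp) hhi rhi (fun κ h0 h1 => by
    rw [one_mul]; exact (hhi0 κ h0 h1).1)
  obtain ⟨em, m1, m2, m3⟩ := main lo (-1) (by simp) hlo rlo (fun κ h0 h1 => by
    have := (hhi0 κ h0 h1).2
    linarith)
  refine ⟨ζ', hζ', ep, em, _, p1, m1, ⟨C / υ, fun κ hκ => ⟨p2 κ hκ, m2 κ hκ⟩⟩, fun κ hκ => ?_⟩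
  exact ⟨by rw [← p3 κ hκ, one_mul], by rw [← m3 κ hκ]; ring⟩

end Cone

section

/-! ### Conical crossings of ordered eigenvalues -/

theorem VanishesToOrder.of_succ {V W : Type*} [NormedAddCommGroup V] [NormedAddCommGroup W]
    {n : ℕ} {f : V → W} {r : ℝ} (hf : VanishesToOrder (n + 1) f (Metric.ball 0 r)) :
    VanishesToOrder n f (Metric.ball 0 r) := by
  obtain ⟨C, hC, h1, h2⟩ := hf
  have key : ∀ z ∈ Metric.ball (0 : V) r, C * ‖z‖ ^ (n + 1) ≤ C * |r| * ‖z‖ ^ n := by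
    intro z hz
    have : ‖z‖ ≤ |r| := (mem_ball_zero_iff.1 hz).le.trans (le_abs_self r)
    calc _ = C * ‖z‖ * ‖z‖ ^ n := by ring
      _ ≤ _ := by gcongr
  refine ⟨C * |r|, by positivity, fun z hz => (h1 z hz).trans (key z hz),
    fun z hz z' hz' h => (h2 z hz z' hz' h).trans ?_⟩
  exact mul_le_mul_of_nonneg_right (key z hz) (norm_nonneg _)

/-- The order of the norms of two pairs need not be that of their first components. The Lipschitz
clause is therefore first made symmetric, with an arbitrary common bound `ρ` for both norms. -/
theorem VanishesToOrder.comp_fst {V V' W : Type*} [NormedAddCommGroup V] [NormedAddCommGroup V']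
    [NormedAddCommGroup W] {f : V → W} {r : ℝ}
    (hf : VanishesToOrder 2 f (Metric.ball 0 r)) :
    VanishesToOrder 2 (fun z : V × V' => f z.1) (Metric.ball 0 r) := by
  obtain ⟨C, hC, h1, h2⟩ := hf
  have hfst : ∀ z : V × V', ‖z.1‖ ≤ ‖z‖ := fun z => le_max_left _ _
  have hb : ∀ z ∈ Metric.ball (0 : V × V') r, z.1 ∈ Metric.ball (0 : V) r := fun z hz => by
    rw [mem_ball_zero_iff] at hz ⊢
    exact (hfst z).trans_lt hz
  -- a bound for the difference in terms of any upper bound of the norms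
  have key : ∀ x ∈ Metric.ball (0 : V) r, ∀ y ∈ Metric.ball (0 : V) r, ∀ ρ, ‖x‖ ≤ ρ → ‖y‖ ≤ ρ →
      ‖f x - f y‖ ≤ C * ρ * ‖x - y‖ := by
    have half : ∀ x ∈ Metric.ball (0 : V) r, ∀ y ∈ Metric.ball (0 : V) r, ‖y‖ ≤ ‖x‖ →
        ‖f x - f y‖ ≤ C * ‖x‖ * ‖x - y‖ := by
      intro x hx y hy hxy
      rcases eq_or_lt_of_le (norm_nonneg x) with h | h
      · have e1 : x = 0 := norm_eq_zero.1 h.symm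
        have e2 : y = 0 := norm_eq_zero.1 (le_antisymm (by rw [h]; exact hxy) (norm_nonneg _))
        rw [e1, e2]; simp
      · refine le_of_mul_le_mul_left ((h2 x hx y hy hxy).trans (le_of_eq ?_)) h
        ring
    intro x hx y hy ρ hxρ hyρ
    rcases le_total ‖y‖ ‖x‖ with h | h
    · exact (half x hx y hy h).trans (by gcongr)
    · rw [norm_sub_rev, norm_sub_rev x]
      exact (half y hy x hx h).trans (by gcongr)
  refine ⟨C, hC, fun z hz => (h1 _ (hb z hz)).trans (by gcongr; exact hfst z),
    fun z hz z' hz' h => ?_⟩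
  have h3 := key z.1 (hb z hz) z'.1 (hb z' hz') ‖z‖ (hfst z) ((hfst z').trans h)
  have h4 : ‖z.1 - z'.1‖ ≤ ‖z - z'‖ := hfst (z - z')
  calc ‖z‖ * ‖f z.1 - f z'.1‖ ≤ ‖z‖ * (C * ‖z‖ * ‖z - z'‖) := by
        gcongr
        exact h3.trans (by gcongr)
    _ = _ := by ring

variable {H : Type*} [NormedAddCommGroup H] [InnerProductSpace ℂ H] [CompleteSpace H]

/-- A double eigenvalue of `B w = E J² w` whose first order splitting is conical opens up to a
conical crossing of two consecutive ordered eigenvalues. -/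
theorem exists_conical_crossing {V : Type*} [NormedAddCommGroup V] {J : H →L[ℂ] H}
    (hJc : IsCompactOperator J) (hJs : J.IsSymmetric) {B : V → H →L[ℂ] H}
    (hBs : ∀ κ, (B κ).IsSymmetric) {c δ K r : ℝ} (hδ : 0 < δ) (hr : 0 < r) (hK : 0 ≤ K)
    (hco : ∀ κ, ‖κ‖ < r → CoerciveWith J (B κ) c δ)
    (hLip : ∀ κ κ', ‖κ‖ < r → ‖κ'‖ < r → ‖B κ - B κ'‖ ≤ K * ‖κ - κ'‖)
    {E : ℕ → V → ℝ} {b : V → HilbertBasis ℕ ℂ H} {w : V → ℕ → H}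
    (hE : ∀ κ, IsBands J (B κ) (fun n => E n κ) (b κ) (w κ)) {n : ℕ} {E₀ : ℝ}
    (hn : E n 0 = E₀) (hn1 : E (n + 1) 0 = E₀) {ψ : Fin 2 → H}
    (hψ : ∀ i, B 0 (ψ i) = (E₀ : ℂ) • J (J (ψ i)))
    (hort : ∀ i j, inner ℂ (J (ψ i)) (J (ψ j)) = if i = j then (1 : ℂ) else 0)
    (hker : ∀ x, B 0 x = (E₀ : ℂ) • J (J x) → x ∈ Submodule.span ℂ (Set.range ψ))
    {υ : ℝ} (hυ : 0 < υ) {h₁ h₂ : V → ℂ} {ρ : Fin 2 → Fin 2 → V → ℂ}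
    (hh₁ : VanishesToOrder 1 (fun z : V × ℝ => h₁ z.1) (Metric.ball 0 r))
    (hh₂ : VanishesToOrder 1 (fun z : V × ℝ => h₂ z.1) (Metric.ball 0 r))
    (hh : ∀ κ, h₁ κ * h₂ κ = (υ : ℂ) ^ 2 * (‖κ‖ : ℂ) ^ 2) (hhn : ∀ κ, ‖h₁ κ‖ = υ * ‖κ‖)
    (hρ : ∀ i j, VanishesToOrder 2 (ρ i j) (Metric.ball 0 r))
    (h00 : ∀ κ, inner ℂ (ψ 0) ((B κ - B 0) (ψ 0)) = ρ 0 0 κ)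
    (h11 : ∀ κ, inner ℂ (ψ 1) ((B κ - B 0) (ψ 1)) = ρ 1 1 κ)
    (h01 : ∀ κ, inner ℂ (ψ 0) ((B κ - B 0) (ψ 1)) = h₁ κ + ρ 0 1 κ)
    (h10 : ∀ κ, inner ℂ (ψ 1) ((B κ - B 0) (ψ 0)) = h₂ κ + ρ 1 0 κ) :
    ∃ ζ > 0, ∃ eplus eminus : V → ℝ, ∃ L : NNReal,
      LipschitzOnWith L eplus (Metric.ball 0 ζ) ∧ LipschitzOnWith L eminus (Metric.ball 0 ζ) ∧
      (∃ C : ℝ, ∀ κ ∈ Metric.ball (0 : V) ζ, |eplus κ| ≤ C * ‖κ‖ ∧ |eminus κ| ≤ C * ‖κ‖) ∧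
      ∀ κ ∈ Metric.ball (0 : V) ζ, E (n + 1) κ - E₀ = υ * ‖κ‖ * (1 + eplus κ) ∧
        E n κ - E₀ = -(υ * ‖κ‖ * (1 + eminus κ)) := by
  have hJ : ∀ u v, inner ℂ (J u) v = inner ℂ u (J v) := hJs
  -- the ordered eigenvalues are Lipschitz at the origin
  have hlipE : ∃ r₁ > 0, r₁ ≤ r ∧ ∃ C₀, 0 ≤ C₀ ∧ ∀ m, E m 0 = E₀ → ∀ κ, ‖κ‖ < r₁ →
      |E m κ - E₀| ≤ C₀ * ‖κ‖ := by
    have ha0 : 0 < E₀ + c := by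
      have := (hE 0).shift_pos hJs hδ (hco 0 (by simpa using hr)) n
      rwa [hn] at this
    set a₀ := E₀ + c
    set K' := ‖J‖ ^ 2 * (δ⁻¹) ^ 2 * K with hK'
    have hK'0 : 0 ≤ K' := by positivity
    -- Weyl's inequality controls `a⁻¹ - a₀⁻¹` for the shifted energies `a` and `a₀`. The radius
    -- ensures `a ≤ 2 a₀`, and `a - a₀ = -a a₀ (a⁻¹ - a₀⁻¹)` gives the constant `2 a₀² K'`.
    refine ⟨min r (1 / (2 * a₀ * (K' + 1))), by positivity, min_le_left _ _, 2 * a₀ ^ 2 * K',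
      by positivity, fun m hm κ hκ => ?_⟩
    have hκr : ‖κ‖ < r := hκ.trans_le (min_le_left _ _)
    have h0r : ‖(0 : V)‖ < r := by simpa using hr
    have hap := (hE κ).shift_pos hJs hδ (hco κ hκr) m
    have h1 := (hE κ).abs_inv_sub_inv_le (hE 0) hJs (hBs κ) (hBs 0) hδ (hco κ hκr) (hco 0 h0r) m
    have h2 : |(E m κ + c)⁻¹ - a₀⁻¹| ≤ K' * ‖κ‖ := by
      rw [hm] at h1
      refine h1.trans ?_
      have := hLip κ 0 hκr h0r
      rw [sub_zero] at this
      calc _ ≤ ‖J‖ ^ 2 * (δ⁻¹) ^ 2 * (K * ‖κ‖) := by gcongr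
        _ = _ := by rw [hK']; ring
    set a := E m κ + c with ha
    have h3 : K' * ‖κ‖ ≤ 1 / (2 * a₀) := by
      have : ‖κ‖ ≤ 1 / (2 * a₀ * (K' + 1)) := (hκ.trans_le (min_le_right _ _)).le
      rw [le_div_iff₀ (by positivity)] at this ⊢
      have h4 : 0 ≤ ‖κ‖ * a₀ := by positivity
      linarith
    have h4 : a ≤ 2 * a₀ := by
      have h5 := (abs_le.1 (h2.trans h3)).1
      have h6 : (2 * a₀)⁻¹ ≤ a⁻¹ := by
        have : a₀⁻¹ - 1 / (2 * a₀) = (2 * a₀)⁻¹ := by field_simp; norm_num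
        linarith
      exact (inv_le_inv₀ (by positivity) hap).1 h6
    have h5 : E m κ - E₀ = -(a * a₀ * (a⁻¹ - a₀⁻¹)) := by
      field_simp
      simp only [ha, a₀]; ring
    rw [h5, abs_neg, abs_mul, abs_of_pos (by positivity)]
    calc a * a₀ * |a⁻¹ - a₀⁻¹| ≤ (2 * a₀) * a₀ * (K' * ‖κ‖) := by gcongr
      _ = _ := by ring
  obtain ⟨r₁, hr₁, hr₁r, C₀, hC₀, hlipE⟩ := hlipE
  -- reduction to a matrix
  obtain ⟨R, hR1, hR2⟩ := exists_bordered_inverse hJc hJs (hBs 0) hδ (hco 0 (by simpa using hr))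
    hψ hort hker
  -- An eigenvector for the energy `E₀ + μ` solves `(B 0 - E₀ J²) x = -Z (κ, μ) x`. The energy
  -- offset `μ` is treated as one more small parameter.
  let Z : V × ℝ → H →L[ℂ] H := fun z => (B z.1 - B 0) - (z.2 : ℂ) • (J * J)
  have hZ : VanishesToOrder 1 Z (Metric.ball 0 r) := by
    have hfst : ∀ z : V × ℝ, ‖z.1‖ ≤ ‖z‖ := fun z => le_max_left _ _
    have hsnd : ∀ z : V × ℝ, ‖z.2‖ ≤ ‖z‖ := fun z => le_max_right _ _
    have hb : ∀ z ∈ Metric.ball (0 : V × ℝ) r, ‖z.1‖ < r := fun z hz =>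
      (hfst z).trans_lt (mem_ball_zero_iff.1 hz)
    have hdiff : ∀ z ∈ Metric.ball (0 : V × ℝ) r, ∀ z' ∈ Metric.ball (0 : V × ℝ) r,
        ‖Z z - Z z'‖ ≤ (K + ‖J * J‖) * ‖z - z'‖ := by
      intro z hz z' hz'
      have e : Z z - Z z' = (B z.1 - B z'.1) - ((z.2 - z'.2 : ℝ) : ℂ) • (J * J) := by
        simp only [Z]
        push_cast
        rw [sub_smul]
        abel
      rw [e]
      refine (norm_sub_le _ _).trans ?_
      rw [norm_smul, Complex.norm_real, add_mul]
      refine add_le_add ?_ ?_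
      · exact (hLip _ _ (hb z hz) (hb z' hz')).trans (by gcongr; exact hfst (z - z'))
      · rw [mul_comm]
        gcongr
        exact hsnd (z - z')
    refine VanishesToOrder.of_lipschitz (K := K + ‖J * J‖) (by positivity) (fun z hz => ?_) hdiff
    have := hdiff z hz 0 (by simpa using hr)
    have h0 : Z 0 = 0 := by simp [Z]
    rwa [h0, sub_zero, sub_zero] at this
  obtain ⟨r₂, hr₂, q, hq, hred⟩ := exists_reduced_matrix hr hZ R hR2 (w := ψ)
    (p := fun i => J (J (ψ i))) (fun i j => by rw [← hort i j]; exact hJ _ _)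
  set r₃ := min r₁ r₂ with hr₃
  have hr₃0 : 0 < r₃ := lt_min hr₁ hr₂
  have s1 : Metric.ball (0 : V × ℝ) r₃ ⊆ Metric.ball 0 r :=
    Metric.ball_subset_ball ((min_le_left _ _).trans hr₁r)
  have s2 : Metric.ball (0 : V × ℝ) r₃ ⊆ Metric.ball 0 r₂ :=
    Metric.ball_subset_ball (min_le_right _ _)
  let Q : Fin 2 → Fin 2 → V × ℝ → ℂ := fun i j z => ρ i j z.1 + q i j z
  have hQ : ∀ i j, VanishesToOrder 2 (Q i j) (Metric.ball 0 r₃) := fun i j =>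
    ((hρ i j).comp_fst.mono s1).add ((hq i j).mono s2)
  -- the eigenvector equation
  have hmat : ∀ κ μ, (κ, μ) ∈ Metric.ball (0 : V × ℝ) r₃ → ∀ x,
      B κ x = ((E₀ + μ : ℝ) : ℂ) • J (J x) →
      ((-(μ : ℂ) + Q 0 0 (κ, μ)) * inner ℂ (J (J (ψ 0))) x +
        (h₁ κ + Q 0 1 (κ, μ)) * inner ℂ (J (J (ψ 1))) x = 0) ∧
      ((h₂ κ + Q 1 0 (κ, μ)) * inner ℂ (J (J (ψ 0))) x +
        (-(μ : ℂ) + Q 1 1 (κ, μ)) * inner ℂ (J (J (ψ 1))) x = 0) ∧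
      (inner ℂ (J (J (ψ 0))) x = (0 : ℂ) → inner ℂ (J (J (ψ 1))) x = (0 : ℂ) → x = 0) := by
    intro κ μ hz x hx
    have h1 : -Z (κ, μ) x = B 0 x - (E₀ : ℂ) • J (J x) := by
      simp only [Z, sub_apply, smul_apply, mul_apply_eq_comp, hx]
      push_cast
      rw [add_smul]
      abel
    obtain ⟨h2, h3⟩ := hred (κ, μ) (s2 hz) x (by rw [h1, hR1])
    have hZψ : ∀ i j, inner ℂ (ψ i) (Z (κ, μ) (ψ j)) =
        inner ℂ (ψ i) ((B κ - B 0) (ψ j)) - μ * (if i = j then (1 : ℂ) else 0) := by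
      intro i j
      simp only [Z, sub_apply, smul_apply, mul_apply_eq_comp, inner_sub_right, inner_smul_right]
      rw [← hort i j, ← hJ]
    refine ⟨?_, ?_, fun g0 g1 => h3 fun i => ?_⟩
    · have := h2 0
      rw [Fin.sum_univ_two, hZψ, hZψ, h00, h01] at this
      simp only [if_true, Fin.isValue, zero_ne_one, if_false] at this
      simp only [Q]
      linear_combination this
    · have := h2 1
      rw [Fin.sum_univ_two, hZψ, hZψ, h11, h10] at this
      simp only [if_true, Fin.isValue, one_ne_zero, if_false] at this
      simp only [Q]
      linear_combination this
    · fin_cases i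
      · exact g0
      · exact g1
  -- The determinant of the reduced matrix minus its leading part `μ² - h₁ h₂`. Each term has a
  -- factor of second order and another of order at least one.
  let S : V × ℝ → ℂ := fun z => -((z.2 : ℂ) * (Q 0 0 z + Q 1 1 z)) + Q 0 0 z * Q 1 1 z
    - h₁ z.1 * Q 1 0 z - h₂ z.1 * Q 0 1 z - Q 0 1 z * Q 1 0 z
  have hμo : VanishesToOrder 1 (fun z : V × ℝ => (z.2 : ℂ)) (Metric.ball 0 r₃) := by
    refine VanishesToOrder.of_lipschitz zero_le_one (fun z _ => ?_) (fun z _ z' _ => ?_)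
    · rw [Complex.norm_real, one_mul]; exact le_max_right _ _
    · rw [← Complex.ofReal_sub, Complex.norm_real, one_mul]
      exact le_max_right _ ‖(z - z').2‖
  have hS : VanishesToOrder 3 S (Metric.ball 0 r₃) := by
    have t1 := (hμo.mul ((hQ 0 0).add (hQ 1 1))).neg
    have t2 := ((hQ 0 0).mul (hQ 1 1)).of_succ
    have t3 := (hh₁.mono s1).mul (hQ 1 0)
    have t4 := (hh₂.mono s1).mul (hQ 0 1)
    have t5 := ((hQ 0 1).mul (hQ 1 0)).of_succ
    exact (((t1.add t2).sub t3).sub t4).sub t5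
  obtain ⟨D, hD, hD1, -⟩ := hQ 0 1
  set a := 1 + C₀ with ha
  -- The second bound makes `υ ‖κ‖` exceed the error `D (a ‖κ‖)²`, so that the off-diagonal entry
  -- `h₁ + Q 0 1` cannot vanish for `κ ≠ 0`.
  set r₄ := min (r₃ / a) (υ / (D * a ^ 2 + 1)) with hr₄
  have ha1 : 1 ≤ a := by linarith
  have hr₄0 : 0 < r₄ := by positivity
  have hin : ∀ m, E m 0 = E₀ → ∀ κ, ‖κ‖ < r₄ → |E m κ - E₀| ≤ C₀ * ‖κ‖ ∧
      ‖(κ, E m κ - E₀)‖ ≤ a * ‖κ‖ ∧ (κ, E m κ - E₀) ∈ Metric.ball (0 : V × ℝ) r₃ := by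
    intro m hm κ hκ
    have h1 : ‖κ‖ < r₃ / a := hκ.trans_le (min_le_left _ _)
    rw [lt_div_iff₀ (by positivity)] at h1
    have hn0 := norm_nonneg κ
    have h1' : ‖κ‖ < r₁ := lt_of_le_of_lt (by nlinarith) (h1.trans_le (min_le_left _ _))
    have h2 := hlipE m hm κ h1'
    have h3 : ‖(κ, E m κ - E₀)‖ ≤ a * ‖κ‖ := by
      rw [Prod.norm_def]
      refine max_le ?_ ?_
      · show ‖κ‖ ≤ _
        nlinarith
      · show |E m κ - E₀| ≤ _
        nlinarith
    refine ⟨h2, h3, ?_⟩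
    rw [mem_ball_zero_iff]
    linarith
  have heig : ∀ m κ, B κ (w κ m) = ((E₀ + (E m κ - E₀) : ℝ) : ℂ) • J (J (w κ m)) := by
    intro m κ
    rw [(hE κ).apply_J, (hE κ).eigen]
    congr 2
    ring
  have hwne : ∀ m κ, w κ m ≠ 0 := by
    intro m κ h0
    have h1 := (hE κ).apply_J m
    rw [h0, map_zero] at h1
    have := (b κ).orthonormal.1 m
    rw [← h1] at this
    simp at this
  have hroot : ∀ m, E m 0 = E₀ → ∀ κ, ‖κ‖ < r₄ →
      (((E m κ - E₀ : ℝ) : ℂ) ^ 2 - (υ : ℂ) ^ 2 * (‖κ‖ : ℂ) ^ 2 + S (κ, E m κ - E₀) = 0) := by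
    intro m hm κ hκ
    obtain ⟨e1, e2, e3⟩ := hmat κ _ (hin m hm κ hκ).2.2 (w κ m) (heig m κ)
    have hdet : ∀ u v : ℂ, (((E m κ - E₀ : ℝ) : ℂ) ^ 2 - (υ : ℂ) ^ 2 * (‖κ‖ : ℂ) ^ 2 +
        S (κ, E m κ - E₀)) * u = 0 → u ≠ 0 → (((E m κ - E₀ : ℝ) : ℂ) ^ 2 -
        (υ : ℂ) ^ 2 * (‖κ‖ : ℂ) ^ 2 + S (κ, E m κ - E₀)) = 0 := fun u v h hu =>
      (mul_eq_zero.1 h).resolve_right hu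
    -- Multiplication by the adjugate matrix shows that the determinant annihilates both
    -- coefficients, and they do not both vanish because the eigenvector is non-zero.
    by_cases g0 : inner ℂ (J (J (ψ 0))) (w κ m) = (0 : ℂ)
    · have g1 : inner ℂ (J (J (ψ 1))) (w κ m) ≠ (0 : ℂ) := fun g1 => hwne m κ (e3 g0 g1)
      refine hdet _ 0 ?_ g1
      rw [← hh κ]
      simp only [S]
      linear_combination (-((E m κ - E₀ : ℝ) : ℂ) + Q 0 0 (κ, E m κ - E₀)) * e2 -
        (h₂ κ + Q 1 0 (κ, E m κ - E₀)) * e1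
    · refine hdet _ 0 ?_ g0
      rw [← hh κ]
      simp only [S]
      linear_combination (-((E m κ - E₀ : ℝ) : ℂ) + Q 1 1 (κ, E m κ - E₀)) * e1 -
        (h₁ κ + Q 0 1 (κ, E m κ - E₀)) * e2
  have hlt : ∀ κ, 0 < ‖κ‖ → ‖κ‖ < r₄ → E n κ < E (n + 1) κ := by
    intro κ h0 hκ
    -- If the two bands met, two independent eigenvectors would share one `μ`. Their coefficient
    -- vectors would be independent as well, so the reduced matrix would vanish altogether,
    -- including its entry `h₁ + Q 0 1`.
    refine lt_of_le_of_ne ((hE κ).mono (Nat.le_succ n)) fun heq => ?_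
    have hz := (hin n hn κ hκ).2.2
    have eigy : B κ (w κ (n + 1)) = ((E₀ + (E n κ - E₀) : ℝ) : ℂ) • J (J (w κ (n + 1))) := by
      rw [heq]; exact heig _ _
    obtain ⟨x1, x2, x3⟩ := hmat κ _ hz (w κ n) (heig n κ)
    obtain ⟨y1, y2, y3⟩ := hmat κ _ hz (w κ (n + 1)) eigy
    set X := w κ n
    set Y := w κ (n + 1)
    have hXY : ∀ s t : ℂ, s • X - t • Y = 0 → s = 0 ∧ t = 0 := by
      intro s t hst
      have h1 := congrArg J hst
      rw [map_sub, map_smul, map_smul, (hE κ).apply_J, (hE κ).apply_J, map_zero] at h1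
      have ho := (b κ).orthonormal
      constructor
      · have := congrArg (fun v => (inner ℂ (b κ n) v : ℂ)) h1
        simpa [inner_sub_right, inner_smul_right, ho.2 (Nat.succ_ne_self n).symm,
          inner_self_eq_norm_sq_to_K, ho.1] using this
      · have := congrArg (fun v => (inner ℂ (b κ (n + 1)) v : ℂ)) h1
        simpa [inner_sub_right, inner_smul_right, ho.2 (Nat.succ_ne_self n),
          inner_self_eq_norm_sq_to_K, ho.1] using this
    have hcomb : ∀ s t : ℂ, s * inner ℂ (J (J (ψ 0))) X = t * inner ℂ (J (J (ψ 0))) Y →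
        s * inner ℂ (J (J (ψ 1))) X = t * inner ℂ (J (J (ψ 1))) Y → s = 0 ∧ t = 0 := by
      intro s t g0 g1
      refine hXY s t ((hmat κ _ hz (s • X - t • Y) ?_).2.2 ?_ ?_)
      · simp only [map_sub, map_smul, heig n κ, eigy, X, Y]
        rw [smul_sub, smul_comm, smul_comm t]
      · rw [inner_sub_right, inner_smul_right, inner_smul_right, g0, sub_self]
      · rw [inner_sub_right, inner_smul_right, inner_smul_right, g1, sub_self]
    set cx0 : ℂ := inner ℂ (J (J (ψ 0))) X
    set cx1 : ℂ := inner ℂ (J (J (ψ 1))) X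
    set cy0 : ℂ := inner ℂ (J (J (ψ 0))) Y
    set cy1 : ℂ := inner ℂ (J (J (ψ 1))) Y
    have hD0 : cx0 * cy1 - cx1 * cy0 ≠ 0 := by
      intro hD0
      have g0 := hcomb cy0 cx0 (mul_comm _ _) (by linear_combination -hD0)
      have g1 := hcomb cy1 cx1 (by linear_combination hD0) (mul_comm _ _)
      exact hwne n κ (x3 g0.2 g1.2)
    have hM : h₁ κ + Q 0 1 (κ, E n κ - E₀) = 0 := by
      have : (h₁ κ + Q 0 1 (κ, E n κ - E₀)) * (cx0 * cy1 - cx1 * cy0) = 0 := by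
        linear_combination cx0 * y1 - cy0 * x1
      exact (mul_eq_zero.1 this).resolve_right hD0
    have h1 : ‖h₁ κ‖ ≤ D * (a * ‖κ‖) ^ 2 := by
      rw [eq_neg_of_add_eq_zero_left hM, norm_neg]
      refine (hD1 _ hz).trans ?_
      gcongr
      exact (hin n hn κ hκ).2.1
    rw [hhn] at h1
    have h2 : ‖κ‖ < υ / (D * a ^ 2 + 1) := hκ.trans_le (min_le_right _ _)
    rw [lt_div_iff₀ (by positivity)] at h2
    have h3 : υ ≤ D * a ^ 2 * ‖κ‖ := by
      refine le_of_mul_le_mul_right ?_ h0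
      calc _ ≤ _ := h1
        _ = _ := by ring
    linarith
  have := exists_conical_expansion (V := V) (S := S) (r := r₄) (υ := υ) (C₀ := C₀)
    (lo := fun κ => E n κ - E₀) (hi := fun κ => E (n + 1) κ - E₀) hr₄0 hυ hC₀
    (hS.mono (Metric.ball_subset_ball ((min_le_left _ _).trans (div_le_self hr₃0.le ha1))))
    (fun κ hκ => (hin n hn κ hκ).1) (fun κ hκ => (hin (n + 1) hn1 κ hκ).1)
    (fun κ h0 hκ => by have := hlt κ h0 hκ; linarith) (fun κ hκ => hroot n hn κ hκ)
    (fun κ hκ => hroot (n + 1) hn1 κ hκ)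
  exact this

end

/-! ### Lattice coordinates -/

theorem sqrt_three_sq : √3 * √3 = (3 : ℝ) := Real.mul_self_sqrt (by norm_num)

theorem sqrt_three_ne_zero : (√3 : ℝ) ≠ 0 := by positivity

/-- Coordinates with respect to the lattice basis `v₁`, `v₂`. -/
def coord : Plane ≃L[ℝ] (Fin 2 → ℝ) :=
  LinearEquiv.toContinuousLinearEquiv
  { toFun := fun x => ![x 0 / √3 + x 1, x 0 / √3 - x 1]
    invFun := fun y => y 0 • v₁ + y 1 • v₂
    map_add' := fun x y => by
      ext i; fin_cases i <;> simp <;> ring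
    map_smul' := fun c x => by
      ext i; fin_cases i <;> simp <;> ring
    left_inv := fun x => by
      have := sqrt_three_ne_zero
      have h3 := sqrt_three_sq
      ext i; fin_cases i
      · simp [v₁, v₂]; field_simp; ring
      · simp [v₁, v₂]; ring
    right_inv := fun y => by
      have := sqrt_three_ne_zero
      ext i; fin_cases i <;> simp [v₁, v₂] <;> field_simp <;> ring }

theorem coord_apply_zero (x : Plane) : coord x 0 = x 0 / √3 + x 1 := rfl

theorem coord_apply_one (x : Plane) : coord x 1 = x 0 / √3 - x 1 := rfl

theorem coord_symm_apply (y : Fin 2 → ℝ) : coord.symm y = y 0 • v₁ + y 1 • v₂ := rfl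

/-- The lattice vector with integer coordinates `n`. -/
def latticeVec (n : Fin 2 → ℤ) : Plane := coord.symm fun i => (n i : ℝ)

theorem coord_latticeVec (n : Fin 2 → ℤ) (i : Fin 2) : coord (latticeVec n) i = n i := by
  simp [latticeVec]

theorem mem_lattice_iff {v : Plane} : v ∈ lattice ↔ ∃ n, v = latticeVec n := by
  constructor
  · rintro ⟨m, n, rfl⟩
    exact ⟨![m, n], by simp [latticeVec, coord_symm_apply]⟩
  · rintro ⟨n, rfl⟩
    exact ⟨n 0, n 1, by simp [latticeVec, coord_symm_apply]⟩

theorem latticeVec_mem (n : Fin 2 → ℤ) : latticeVec n ∈ lattice := mem_lattice_iff.2 ⟨n, rfl⟩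

theorem neg_mem_lattice {v : Plane} (hv : v ∈ lattice) : -v ∈ lattice := by
  obtain ⟨m, n, rfl⟩ := hv
  exact ⟨-m, -n, by push_cast; module⟩

/-- The basis `v₁`, `v₂` of the plane. -/
def latticeBasis : Module.Basis (Fin 2) ℝ Plane := Module.Basis.ofEquivFun coord.toLinearEquiv

theorem latticeBasis_repr (x : Plane) (i : Fin 2) : latticeBasis.repr x i = coord x i := rfl

theorem mem_span_latticeBasis {v : Plane} :
    v ∈ Submodule.span ℤ (Set.range latticeBasis) ↔ v ∈ lattice := by
  rw [Module.Basis.mem_span_iff_repr_mem ℤ latticeBasis, mem_lattice_iff]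
  constructor
  · intro h
    choose n hn using h
    refine ⟨n, ?_⟩
    rw [latticeVec, ContinuousLinearEquiv.eq_symm_apply]
    funext i
    exact (hn i).symm
  · rintro ⟨n, rfl⟩ i
    exact ⟨n i, by rw [latticeBasis_repr, coord_latticeVec]; simp⟩

/-- The half open period cell. -/
abbrev halfCell : Set Plane := ZSpan.fundamentalDomain latticeBasis

theorem mem_halfCell {x : Plane} : x ∈ halfCell ↔ ∀ i, coord x i ∈ Set.Ico (0 : ℝ) 1 := by
  rw [halfCell, ZSpan.mem_fundamentalDomain]
  simp only [latticeBasis_repr]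

theorem mem_cell {x : Plane} : x ∈ cell ↔ ∀ i, coord x i ∈ Set.Icc (0 : ℝ) 1 := by
  constructor
  · rintro ⟨s, t, hs, ht, rfl⟩
    have : s • v₁ + t • v₂ = coord.symm ![s, t] := by simp [coord_symm_apply]
    rw [this]
    simp [Fin.forall_fin_two, hs.1, hs.2, ht.1, ht.2]
  · intro h
    refine ⟨coord x 0, coord x 1, h 0, h 1, ?_⟩
    rw [← coord_symm_apply, coord.symm_apply_apply]

theorem measurableSet_cell : MeasurableSet cell := by
  have : cell = coord ⁻¹' (Set.univ.pi fun _ => Set.Icc (0 : ℝ) 1) := by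
    ext x; simp only [mem_cell, Set.mem_preimage, Set.mem_univ_pi]
  rw [this]
  exact coord.continuous.measurable (MeasurableSet.univ_pi fun _ => measurableSet_Icc)

theorem isCompact_cell : IsCompact cell := by
  have : cell = coord.symm '' (Set.univ.pi fun _ => Set.Icc (0 : ℝ) 1) := by
    rw [ContinuousLinearEquiv.image_symm_eq_preimage]
    ext x; simp only [mem_cell, Set.mem_preimage, Set.mem_univ_pi]
  rw [this]
  exact (isCompact_univ_pi fun _ => isCompact_Icc).image coord.symm.continuous

instance : IsFiniteMeasure (volume.restrict cell : Measure Plane) :=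
  ⟨by simpa using isCompact_cell.measure_lt_top⟩

/-- Uniqueness of Haar measure. The value of the constant is irrelevant; it only has to be positive
and finite. -/
theorem exists_map_coord : ∃ c : ENNReal, c ≠ 0 ∧ c ≠ ⊤ ∧
    Measure.map coord (volume : Measure Plane) = c • (volume : Measure (Fin 2 → ℝ)) := by
  have h1 : (Measure.map coord (volume : Measure Plane)).IsAddHaarMeasure :=
    coord.toContinuousAddEquiv.isAddHaarMeasure_map volume
  refine ⟨_, ?_, ?_, Measure.isAddLeftInvariant_eq_smul _ _⟩
  · exact_mod_cast (Measure.addHaarScalarFactor_pos_of_isAddHaarMeasure _ _).ne'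
  · exact ENNReal.coe_ne_top

/-- The ratio of the Lebesgue measure on the plane and the one in lattice coordinates. -/
def cellVol : ENNReal := exists_map_coord.choose

theorem cellVol_ne_zero : cellVol ≠ 0 := exists_map_coord.choose_spec.1

theorem cellVol_ne_top : cellVol ≠ ⊤ := exists_map_coord.choose_spec.2.1

theorem map_coord : Measure.map coord (volume : Measure Plane) =
    cellVol • (volume : Measure (Fin 2 → ℝ)) := exists_map_coord.choose_spec.2.2

theorem halfCell_ae_eq_cell : halfCell =ᵐ[volume] cell := by
  have h1 : (Set.univ.pi fun _ : Fin 2 => Set.Ico (0 : ℝ) 1) =ᵐ[volume]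
      (Set.univ.pi fun _ => Set.Icc (0 : ℝ) 1) := by
    simp only [volume_pi]
    exact Measure.pi_Ico_ae_eq_pi_Icc
  have h2 : (Set.univ.pi fun _ : Fin 2 => Set.Ico (0 : ℝ) 1) =ᵐ[Measure.map coord volume]
      (Set.univ.pi fun _ => Set.Icc (0 : ℝ) 1) := by
    rw [map_coord]
    exact Measure.ae_smul_measure h1 _
  have h3 := ae_of_ae_map coord.continuous.measurable.aemeasurable (eventuallyEq_set.1 h2)
  filter_upwards [h3] with x hx
  have e1 : x ∈ halfCell ↔ coord x ∈ (Set.univ.pi fun _ : Fin 2 => Set.Ico (0 : ℝ) 1) := by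
    rw [mem_halfCell, Set.mem_univ_pi]
  have e2 : x ∈ cell ↔ coord x ∈ (Set.univ.pi fun _ : Fin 2 => Set.Icc (0 : ℝ) 1) := by
    rw [mem_cell, Set.mem_univ_pi]
  exact propext (e1.trans (hx.trans e2.symm))

theorem restrict_halfCell : (volume.restrict halfCell : Measure Plane) = volume.restrict cell :=
  Measure.restrict_congr_set halfCell_ae_eq_cell

/-! ### Integrals over the cell and over the torus -/

section Torus

local instance : MeasureSpace UnitAddCircle := ⟨AddCircle.haarAddCircle⟩

local instance : Measure.IsAddHaarMeasure (volume : Measure UnitAddCircle) :=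
  inferInstanceAs (Measure.IsAddHaarMeasure AddCircle.haarAddCircle)

local instance : IsProbabilityMeasure (volume : Measure UnitAddCircle) :=
  inferInstanceAs (IsProbabilityMeasure AddCircle.haarAddCircle)

/-- The projection onto the torus in lattice coordinates. -/
def toTorus (x : Plane) : UnitAddTorus (Fin 2) := fun i => (coord x i : UnitAddCircle)

theorem ioc_ae_eq : (Set.univ.pi fun _ : Fin 2 => Set.Icc (0 : ℝ) 1) =ᵐ[volume]
    {x : Fin 2 → ℝ | ∀ i, x i ∈ Set.Ioc ((fun _ => 0 : Fin 2 → ℝ) i) ((fun _ => 0 : Fin 2 → ℝ) i + 1)} := by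
  have h1 : (Set.univ.pi fun _ : Fin 2 => Set.Ioc (0 : ℝ) 1) =ᵐ[volume]
      (Set.univ.pi fun _ => Set.Icc (0 : ℝ) 1) := by
    simp only [volume_pi]
    exact Measure.pi_Ioc_ae_eq_pi_Icc
  refine h1.symm.trans (eventuallyEq_set.2 (Eventually.of_forall fun x => ?_))
  simp only [Set.mem_univ_pi, zero_add]
  rfl

theorem integral_coord (s : Set (Fin 2 → ℝ)) (f : (Fin 2 → ℝ) → ℂ) :
    ∫ x in coord ⁻¹' s, f (coord x) = cellVol.toReal * ∫ y in s, f y := by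
  have := coord.toHomeomorph.measurableEmbedding.setIntegral_map (μ := volume) f s
  have e : (coord.toHomeomorph : Plane → (Fin 2 → ℝ)) = coord := rfl
  rw [e] at this
  rw [← this, map_coord, Measure.restrict_smul, integral_smul_measure, Complex.real_smul]

theorem lintegral_coord (s : Set (Fin 2 → ℝ)) (f : (Fin 2 → ℝ) → ENNReal) :
    ∫⁻ x in coord ⁻¹' s, f (coord x) = cellVol * ∫⁻ y in s, f y := by
  have hm := coord.toHomeomorph.measurableEmbedding
  have e : (coord.toHomeomorph : Plane → (Fin 2 → ℝ)) = coord := rfl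
  rw [e] at hm
  rw [← smul_eq_mul, ← lintegral_smul_measure, ← Measure.restrict_smul, ← map_coord,
    hm.restrict_map, hm.lintegral_map]

theorem cell_eq_preimage : cell = coord ⁻¹' (Set.univ.pi fun _ => Set.Icc (0 : ℝ) 1) := by
  ext x; simp only [mem_cell, Set.mem_preimage, Set.mem_univ_pi]

theorem integral_cell_toTorus (f : UnitAddTorus (Fin 2) → ℂ) :
    ∫ x in cell, f (toTorus x) = cellVol.toReal * ∫ y, f y := by
  rw [cell_eq_preimage]
  refine (integral_coord _ (fun y => f fun i => (y i : UnitAddCircle))).trans ?_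
  rw [UnitAddTorus.integral_preimage f (fun _ => 0), setIntegral_congr_set ioc_ae_eq]

theorem lintegral_cell_toTorus (f : UnitAddTorus (Fin 2) → ENNReal) :
    ∫⁻ x in cell, f (toTorus x) = cellVol * ∫⁻ y, f y := by
  rw [cell_eq_preimage]
  refine (lintegral_coord _ (fun y => f fun i => (y i : UnitAddCircle))).trans ?_
  rw [UnitAddTorus.lintegral_preimage f (fun _ => 0), setLIntegral_congr ioc_ae_eq]

/-! ### The Fourier basis of `L²(cell)` -/

/-- The plane wave `exp (i k · x)`. -/
def wave (k x : Plane) : ℂ := Complex.exp (Complex.I * (inner ℝ k x : ℝ))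

theorem wave_add_left (k l x : Plane) : wave (k + l) x = wave k x * wave l x := by
  rw [wave, wave, wave, ← Complex.exp_add, inner_add_left]; push_cast; ring_nf

theorem wave_add_right (k x y : Plane) : wave k (x + y) = wave k x * wave k y := by
  rw [wave, wave, wave, ← Complex.exp_add, inner_add_right]; push_cast; ring_nf

theorem wave_neg_left (k x : Plane) : wave (-k) x = conj (wave k x) := by
  rw [wave, wave, ← Complex.exp_conj]; simp

theorem wave_neg_right (k x : Plane) : wave k (-x) = conj (wave k x) := by
  rw [wave, wave, ← Complex.exp_conj]; simp

theorem norm_wave (k x : Plane) : ‖wave k x‖ = 1 := by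
  rw [wave, mul_comm, Complex.norm_exp_ofReal_mul_I]

theorem conj_wave_mul_wave (k x : Plane) : conj (wave k x) * wave k x = 1 := by
  rw [← Complex.normSq_eq_conj_mul_self, Complex.normSq_eq_norm_sq, norm_wave]; simp

theorem wave_mul_conj_wave (k x : Plane) : wave k x * conj (wave k x) = 1 := by
  rw [mul_comm, conj_wave_mul_wave]

theorem continuous_wave (k : Plane) : Continuous (wave k) := by
  unfold wave; fun_prop

theorem contDiff_wave (k : Plane) {n : WithTop ℕ∞} : ContDiff ℝ n (wave k) := by
  unfold wave
  have h : ContDiff ℝ n fun x : Plane => (inner ℝ k x : ℝ) := contDiff_const.inner ℝ contDiff_id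
  exact (contDiff_const.mul (Complex.ofRealCLM.contDiff.comp h)).cexp

/-- The dual lattice vector with integer coordinates `n`. -/
def dualVec (n : Fin 2 → ℤ) : Plane := (n 0 : ℝ) • k₁ + (n 1 : ℝ) • k₂

theorem inner_k₁ (x : Plane) : inner ℝ k₁ x = 2 * Real.pi * coord x 0 := by
  have := sqrt_three_ne_zero
  simp [k₁, PiLp.inner_apply, coord_apply_zero]
  field_simp
  ring

theorem inner_k₂ (x : Plane) : inner ℝ k₂ x = 2 * Real.pi * coord x 1 := by
  have := sqrt_three_ne_zero
  simp [k₂, PiLp.inner_apply, coord_apply_one]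
  field_simp
  ring

theorem inner_dualVec (n : Fin 2 → ℤ) (x : Plane) :
    inner ℝ (dualVec n) x = 2 * Real.pi * (n 0 * coord x 0 + n 1 * coord x 1) := by
  rw [dualVec, inner_add_left, inner_smul_left, inner_smul_left, inner_k₁, inner_k₂]
  simp
  ring

theorem wave_dualVec_lattice (n : Fin 2 → ℤ) {v : Plane} (hv : v ∈ lattice) :
    wave (dualVec n) v = 1 := by
  obtain ⟨m, rfl⟩ := mem_lattice_iff.1 hv
  rw [wave, inner_dualVec, coord_latticeVec, coord_latticeVec, Complex.exp_eq_one_iff]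
  refine ⟨n 0 * m 0 + n 1 * m 1, ?_⟩
  push_cast
  ring

theorem mFourier_toTorus (n : Fin 2 → ℤ) (x : Plane) :
    UnitAddTorus.mFourier n (toTorus x) = wave (dualVec n) x := by
  simp only [UnitAddTorus.mFourier, ContinuousMap.coe_mk, toTorus, Fin.prod_univ_two,
    fourier_coe_apply]
  rw [← Complex.exp_add, wave, inner_dualVec]
  congr 1
  push_cast
  ring

/-- Square integrable functions on the period cell. -/
abbrev CellL2 : Type := Lp ℂ 2 (volume.restrict cell : Measure Plane)

theorem inner_toLp {f g : Plane → ℂ} (hf : MemLp f 2 (volume.restrict cell))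
    (hg : MemLp g 2 (volume.restrict cell)) :
    inner ℂ (hf.toLp f) (hg.toLp g) = ip f g := by
  rw [L2.inner_def, ip]
  refine integral_congr_ae ?_
  filter_upwards [hf.coeFn_toLp, hg.coeFn_toLp] with x h1 h2
  rw [h1, h2, RCLike.inner_apply, mul_comm]

theorem memLp_cell_of_continuous {f : Plane → ℂ} (hf : Continuous f) :
    MemLp f 2 (volume.restrict cell) := by
  obtain ⟨C, hC⟩ := isCompact_cell.exists_bound_of_continuousOn hf.continuousOn
  refine MemLp.of_bound hf.aestronglyMeasurable C ?_
  exact (ae_restrict_iff' measurableSet_cell).2 (Eventually.of_forall hC)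

theorem cellVol_toReal_pos : 0 < cellVol.toReal := ENNReal.toReal_pos cellVol_ne_zero cellVol_ne_top

/-- The normalized exponentials. -/
def expVec (n : Fin 2 → ℤ) : CellL2 :=
  (((√cellVol.toReal)⁻¹ : ℝ) : ℂ) • (memLp_cell_of_continuous (continuous_wave (dualVec n))).toLp _

theorem inner_expVec_toLp (n : Fin 2 → ℤ) {f : Plane → ℂ} (hf : MemLp f 2 (volume.restrict cell)) :
    inner ℂ (expVec n) (hf.toLp f) =
      (((√cellVol.toReal)⁻¹ : ℝ) : ℂ) * ∫ x in cell, conj (wave (dualVec n) x) * f x := by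
  rw [expVec, inner_smul_left, inner_toLp, Complex.conj_ofReal, ip]

theorem orthonormal_expVec : Orthonormal ℂ expVec := by
  rw [orthonormal_iff_ite]
  intro m n
  have h1 : ∫ x in cell, conj (wave (dualVec m) x) * wave (dualVec n) x =
      cellVol.toReal * if m = n then 1 else 0 := by
    have h2 := integral_cell_toTorus
      (fun y => conj (UnitAddTorus.mFourier m y) * UnitAddTorus.mFourier n y)
    simp only [mFourier_toTorus] at h2
    rw [h2]
    congr 1
    have h3 := orthonormal_iff_ite.1 (UnitAddTorus.orthonormal_mFourier (d := Fin 2)) m n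
    rw [← h3, L2.inner_def]
    refine integral_congr_ae ?_
    filter_upwards [UnitAddTorus.coeFn_mFourierLp 2 m, UnitAddTorus.coeFn_mFourierLp 2 n]
      with x e1 e2
    rw [e1, e2, RCLike.inner_apply, mul_comm]
  rw [expVec, expVec, inner_smul_left, inner_smul_right, inner_toLp, ip, h1, Complex.conj_ofReal,
    ← mul_assoc, ← mul_assoc, ← Complex.ofReal_mul, ← Complex.ofReal_mul]
  have : (√cellVol.toReal)⁻¹ * (√cellVol.toReal)⁻¹ * cellVol.toReal = 1 := by
    rw [← mul_inv, Real.mul_self_sqrt cellVol_toReal_pos.le,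
      inv_mul_cancel₀ cellVol_toReal_pos.ne']
  rw [this]
  simp

/-- Completeness of the exponentials is inherited from the torus. A measurable section `σ` of the
projection transports `u` to a function `F` with the same Fourier coefficients up to a non-zero
constant, and the two square integrals are proportional. -/
theorem eq_zero_of_inner_expVec (u : CellL2) (hu : ∀ n, inner ℂ (expVec n) u = 0) : u = 0 := by
  let σ : UnitAddTorus (Fin 2) → Plane := fun y =>
    coord.symm (UnitAddTorus.measurableEquivPiIoc (fun _ : Fin 2 => (0 : ℝ)) y).1
  have hσm : Measurable σ := coord.symm.continuous.measurable.comp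
    (measurable_subtype_coe.comp (UnitAddTorus.measurableEquivPiIoc _).measurable)
  have hσ : ∀ᵐ x ∂(volume.restrict cell : Measure Plane), σ (toTorus x) = x := by
    have h1 : ∀ᵐ x ∂(volume : Measure Plane), coord x ∈ (Set.univ.pi fun _ => Set.Icc (0 : ℝ) 1) ↔
        coord x ∈ {x : Fin 2 → ℝ | ∀ i, x i ∈
          Set.Ioc ((fun _ => 0 : Fin 2 → ℝ) i) ((fun _ => 0 : Fin 2 → ℝ) i + 1)} := by
      have h2 : ∀ᵐ y ∂(Measure.map coord (volume : Measure Plane)),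
          y ∈ (Set.univ.pi fun _ => Set.Icc (0 : ℝ) 1) ↔ y ∈ {x : Fin 2 → ℝ | ∀ i, x i ∈
          Set.Ioc ((fun _ => 0 : Fin 2 → ℝ) i) ((fun _ => 0 : Fin 2 → ℝ) i + 1)} := by
        rw [map_coord]
        exact Measure.ae_smul_measure (eventuallyEq_set.1 ioc_ae_eq) _
      exact ae_of_ae_map coord.continuous.measurable.aemeasurable h2
    rw [ae_restrict_iff' measurableSet_cell]
    filter_upwards [h1] with x hx hxc
    have h3 := hx.1 (by rw [cell_eq_preimage] at hxc; exact hxc)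
    have h4 : UnitAddTorus.measurableEquivPiIoc (fun _ : Fin 2 => (0 : ℝ)) (toTorus x) =
        ⟨coord x, h3⟩ := by
      have h5 : toTorus x = (UnitAddTorus.measurableEquivPiIoc (fun _ : Fin 2 => (0 : ℝ))).symm
        ⟨coord x, h3⟩ := rfl
      rw [h5, MeasurableEquiv.apply_symm_apply]
    simp only [σ, h4, ContinuousLinearEquiv.symm_apply_apply]
  let F : UnitAddTorus (Fin 2) → ℂ := fun y => u (σ y)
  have hFq : ∀ᵐ x ∂(volume.restrict cell : Measure Plane), F (toTorus x) = u x := by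
    filter_upwards [hσ] with x hx
    simp only [F, hx]
  have hFm : AEStronglyMeasurable F volume :=
    ((Lp.stronglyMeasurable u).comp_measurable hσm).aestronglyMeasurable
  have hlint : ∫⁻ x in cell, ‖u x‖ₑ ^ (2 : ℝ) = cellVol * ∫⁻ y, ‖F y‖ₑ ^ (2 : ℝ) := by
    rw [← lintegral_cell_toTorus]
    refine lintegral_congr_ae ?_
    filter_upwards [hFq] with x hx
    rw [hx]
  have hFL : MemLp F 2 volume := by
    refine ⟨hFm, ?_⟩
    have h1 := Lp.memLp u
    have h2 := lintegral_rpow_enorm_lt_top_of_eLpNorm_lt_top (by norm_num) (by norm_num) h1.2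
    rw [eLpNorm_lt_top_iff_lintegral_rpow_enorm_lt_top (by norm_num) (by norm_num)]
    simp only [ENNReal.toReal_ofNat] at h2 ⊢
    rw [hlint] at h2
    exact (ENNReal.mul_lt_top_iff.1 h2).elim (fun h => h.2) (fun h => by
      rcases h with h | h
      · exact absurd h cellVol_ne_zero
      · rw [h]; exact ENNReal.zero_lt_top)
  have hF0 : hFL.toLp F = 0 := by
    refine UnitAddTorus.mFourierBasis.repr.injective ?_
    rw [map_zero]
    ext n
    rw [UnitAddTorus.mFourierBasis.repr_apply_apply, UnitAddTorus.coe_mFourierBasis, L2.inner_def]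
    have h1 : ∫ y, inner ℂ (UnitAddTorus.mFourierLp 2 n y) (hFL.toLp F y) =
        ∫ y, conj (UnitAddTorus.mFourier n y) * F y := by
      refine integral_congr_ae ?_
      filter_upwards [UnitAddTorus.coeFn_mFourierLp 2 n, hFL.coeFn_toLp] with x e1 e2
      rw [e1, e2, RCLike.inner_apply, mul_comm]
    have h2 := integral_cell_toTorus (fun y => conj (UnitAddTorus.mFourier n y) * F y)
    have h3 := hu n
    have h4 : u = (Lp.memLp u).toLp u := (Lp.toLp_coeFn u _).symm
    rw [h4, inner_expVec_toLp] at h3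
    have h5 : ∫ x in cell, conj (wave (dualVec n) x) * u x = 0 := by
      refine (mul_eq_zero.1 h3).resolve_left ?_
      have := Real.sqrt_pos.2 cellVol_toReal_pos
      exact_mod_cast (inv_pos.2 this).ne'
    have h6 : ∫ x in cell, conj (UnitAddTorus.mFourier n (toTorus x)) * F (toTorus x) = 0 := by
      rw [← h5]
      refine integral_congr_ae ?_
      filter_upwards [hFq] with x hx
      rw [hx, mFourier_toTorus]
    rw [h6] at h2
    rw [h1]
    exact (mul_eq_zero.1 h2.symm).resolve_left (by exact_mod_cast cellVol_toReal_pos.ne')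
  have hFae : F =ᵐ[volume] 0 := (hFL.toLp_eq_toLp_iff (MemLp.zero' )).1 (by rw [hF0]; rfl)
  have hz : ∫⁻ x in cell, ‖u x‖ₑ ^ (2 : ℝ) = 0 := by
    rw [hlint, lintegral_congr_ae (g := fun _ => 0)]
    · simp
    · filter_upwards [hFae] with y hy
      rw [hy]; simp
  rw [lintegral_eq_zero_iff' ((Lp.stronglyMeasurable u).enorm.pow_const _).aemeasurable] at hz
  rw [Lp.eq_zero_iff_ae_eq_zero]
  filter_upwards [hz] with x hx
  simpa using hx

/-- The Fourier basis of `L²(cell)`. -/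
def expBasis : HilbertBasis (Fin 2 → ℤ) ℂ CellL2 :=
  HilbertBasis.mkOfOrthogonalEqBot orthonormal_expVec (by
    rw [Submodule.eq_bot_iff]
    intro u hu
    exact eq_zero_of_inner_expVec u fun n =>
      (Submodule.mem_orthogonal _ u).1 hu _ (Submodule.subset_span ⟨n, rfl⟩))

theorem coe_expBasis : ⇑expBasis = expVec := HilbertBasis.coe_mkOfOrthogonalEqBot _ _

theorem CellL2.ext_inner {u v : CellL2} (h : ∀ n, inner ℂ (expVec n) u = inner ℂ (expVec n) v) :
    u = v := by
  rw [← sub_eq_zero]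
  exact eq_zero_of_inner_expVec _ fun n => by rw [inner_sub_right, h, sub_self]

theorem not_finiteDimensional_cellL2 : ¬ FiniteDimensional ℂ CellL2 := by
  intro h
  have := orthonormal_expVec.linearIndependent.finite
  exact not_finite (Fin 2 → ℤ)

end Torus

/-! ### Quasi-periodic functions -/

/-- Locally square integrable functions with `f (x + v) = exp (i k · v) f x`. -/
def IsQuasi (k : Plane) (f : Plane → ℂ) : Prop :=
  LocL2 f ∧ ∀ v ∈ lattice, ∀ᵐ x ∂(volume : Measure Plane), f (x + v) = wave k v * f x

theorem IsQuasi.congr {k : Plane} {f g : Plane → ℂ} (hf : IsQuasi k f) (h : g =ᵐ[volume] f) :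
    IsQuasi k g := by
  refine ⟨hf.1.congr h, fun v hv => ?_⟩
  filter_upwards [h, ae_shift h v, hf.2 v hv] with x h1 h2 h3
  rw [h2, h3, h1]

theorem IsQuasi.add {k : Plane} {f g : Plane → ℂ} (hf : IsQuasi k f) (hg : IsQuasi k g) :
    IsQuasi k fun x => f x + g x := by
  refine ⟨hf.1.add hg.1, fun v hv => ?_⟩
  filter_upwards [hf.2 v hv, hg.2 v hv] with x h1 h2
  rw [h1, h2, mul_add]

theorem IsQuasi.const_mul {k : Plane} {f : Plane → ℂ} (hf : IsQuasi k f) (c : ℂ) :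
    IsQuasi k fun x => c * f x := by
  refine ⟨hf.1.const_mul c, fun v hv => ?_⟩
  filter_upwards [hf.2 v hv] with x h1
  rw [h1]; ring

theorem LocL2.of_continuous {f : Plane → ℂ} (hf : Continuous f) : LocL2 f := by
  intro S hS
  have : IsFiniteMeasure (volume.restrict S : Measure Plane) := ⟨by simpa using hS.measure_lt_top⟩
  obtain ⟨C, hC⟩ := hS.exists_bound_of_continuousOn hf.continuousOn
  exact MemLp.of_bound hf.aestronglyMeasurable C
    ((ae_restrict_iff' hS.measurableSet).2 (Eventually.of_forall hC))

theorem LocL2.aestronglyMeasurable {f : Plane → ℂ} (hf : LocL2 f) :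
    AEStronglyMeasurable f volume := hf.locallyIntegrable.aestronglyMeasurable

theorem LocL2.continuous_mul {a f : Plane → ℂ} (ha : Continuous a) (hf : LocL2 f) :
    LocL2 fun x => a x * f x := by
  intro S hS
  obtain ⟨C, hC⟩ := hS.exists_bound_of_continuousOn ha.continuousOn
  refine MemLp.of_le_mul (c := C) (hf S hS)
    (ha.aestronglyMeasurable.mul (hf S hS).aestronglyMeasurable)
    ((ae_restrict_iff' hS.measurableSet).2 (Eventually.of_forall fun x hx => ?_))
  rw [norm_mul]
  exact mul_le_mul_of_nonneg_right (hC x hx) (norm_nonneg _)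

theorem IsQuasi.periodic_mul {k : Plane} {a f : Plane → ℂ} (ha : Continuous a)
    (hp : ∀ v ∈ lattice, ∀ x, a (x + v) = a x) (hf : IsQuasi k f) :
    IsQuasi k fun x => a x * f x := by
  refine ⟨hf.1.continuous_mul ha, fun v hv => ?_⟩
  filter_upwards [hf.2 v hv] with x h1
  rw [h1, hp v hv]; ring

theorem isQuasi_wave (k : Plane) (n : Fin 2 → ℤ) : IsQuasi k (wave (k + dualVec n)) := by
  refine ⟨LocL2.of_continuous (continuous_wave _), fun v hv => Eventually.of_forall fun x => ?_⟩
  rw [wave_add_right, wave_add_left k _ v, wave_dualVec_lattice n hv]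
  ring

theorem memLp_toCell (k : Plane) {f : Plane → ℂ} (hf : LocL2 f) :
    MemLp (fun x => conj (wave k x) * f x) 2 (volume.restrict cell) :=
  (hf.continuous_mul (continuous_conj.comp (continuous_wave k))) cell isCompact_cell

/-- The periodic part of a quasi-periodic function, on the cell. -/
def toCell (k : Plane) {f : Plane → ℂ} (hf : IsQuasi k f) : CellL2 := (memLp_toCell k hf.1).toLp _

theorem coeFn_toCell (k : Plane) {f : Plane → ℂ} (hf : IsQuasi k f) :
    toCell k hf =ᵐ[volume.restrict cell] fun x => conj (wave k x) * f x :=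
  (memLp_toCell k hf.1).coeFn_toLp

theorem toCell_congr {k : Plane} {f g : Plane → ℂ} (hf : IsQuasi k f) (hg : IsQuasi k g)
    (h : f =ᵐ[volume] g) : toCell k hf = toCell k hg := by
  refine MemLp.toLp_congr _ _ (ae_restrict_of_ae ?_)
  filter_upwards [h] with x hx
  rw [hx]

theorem toCell_add {k : Plane} {f g : Plane → ℂ} (hf : IsQuasi k f) (hg : IsQuasi k g) :
    toCell k (hf.add hg) = toCell k hf + toCell k hg := by
  refine Lp.ext ?_
  filter_upwards [coeFn_toCell k (hf.add hg), coeFn_toCell k hf, coeFn_toCell k hg,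
    Lp.coeFn_add (toCell k hf) (toCell k hg)] with x h1 h2 h3 h4
  rw [h1, h4, Pi.add_apply, h2, h3]; ring

theorem toCell_const_mul {k : Plane} {f : Plane → ℂ} (hf : IsQuasi k f) (c : ℂ) :
    toCell k (hf.const_mul c) = c • toCell k hf := by
  refine Lp.ext ?_
  filter_upwards [coeFn_toCell k (hf.const_mul c), coeFn_toCell k hf,
    Lp.coeFn_smul c (toCell k hf)] with x h1 h2 h4
  rw [h1, h4, Pi.smul_apply, h2, smul_eq_mul]; ring

theorem inner_toCell {k : Plane} {f g : Plane → ℂ} (hf : IsQuasi k f) (hg : IsQuasi k g) :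
    inner ℂ (toCell k hf) (toCell k hg) = ip f g := by
  rw [toCell, toCell, inner_toLp, ip, ip]
  congr 1
  funext x
  rw [map_mul, Complex.conj_conj]
  linear_combination conj (f x) * g x * wave_mul_conj_wave k x

theorem expVec_eq_toCell (k : Plane) (n : Fin 2 → ℤ) :
    expVec n = (((√cellVol.toReal)⁻¹ : ℝ) : ℂ) • toCell k (isQuasi_wave k n) := by
  rw [expVec, toCell]
  congr 1
  refine MemLp.toLp_congr _ _ (Eventually.of_forall fun x => ?_)
  show wave (dualVec n) x = conj (wave k x) * wave (k + dualVec n) x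
  rw [wave_add_left, ← mul_assoc, conj_wave_mul_wave, one_mul]

/-! ### Reduction to the cell -/

/-- The integer parts of the lattice coordinates. -/
def latticeFloor (x : Plane) : Fin 2 → ℤ := fun i => ⌊coord x i⌋

/-- The translate of `x` in the half open cell. -/
def reduce (x : Plane) : Plane := x - latticeVec (latticeFloor x)

theorem coord_reduce (x : Plane) (i : Fin 2) : coord (reduce x) i = Int.fract (coord x i) := by
  rw [reduce, map_sub, Pi.sub_apply, coord_latticeVec]; rfl

theorem reduce_mem_halfCell (x : Plane) : reduce x ∈ halfCell := by
  rw [mem_halfCell]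
  intro i
  rw [coord_reduce]
  exact ⟨Int.fract_nonneg _, Int.fract_lt_one _⟩

theorem reduce_of_mem {x : Plane} (hx : x ∈ halfCell) : reduce x = x := by
  apply coord.injective
  funext i
  rw [coord_reduce]
  exact Int.fract_eq_self.2 ((mem_halfCell.1 hx) i)

theorem reduce_add {v : Plane} (hv : v ∈ lattice) (x : Plane) : reduce (x + v) = reduce x := by
  obtain ⟨n, rfl⟩ := mem_lattice_iff.1 hv
  apply coord.injective
  funext i
  rw [coord_reduce, coord_reduce, map_add, Pi.add_apply, coord_latticeVec, Int.fract_add_intCast]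

theorem halfCell_subset_cell : halfCell ⊆ cell := fun x hx => by
  rw [mem_cell]
  exact fun i => Set.Ico_subset_Icc_self ((mem_halfCell.1 hx) i)

theorem measurable_reduce : Measurable reduce := by
  have h : reduce = fun x => coord.symm fun i => Int.fract (coord x i) := by
    funext x
    rw [ContinuousLinearEquiv.eq_symm_apply]
    funext i
    exact coord_reduce x i
  rw [h]
  refine coord.symm.continuous.measurable.comp (measurable_pi_lambda _ fun i => ?_)
  exact measurable_fract.comp ((measurable_pi_apply i).comp coord.continuous.measurable)

/-- A property that holds almost everywhere on the cell holds at the reduction of almost every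
point. -/
theorem ae_reduce {p : Plane → Prop} (h : ∀ᵐ x ∂(volume.restrict cell : Measure Plane), p x) :
    ∀ᵐ x ∂(volume : Measure Plane), p (reduce x) := by
  rw [ae_restrict_iff' measurableSet_cell] at h
  have h1 : ∀ᵐ x ∂(volume : Measure Plane), ∀ n : Fin 2 → ℤ,
      x + latticeVec n ∈ cell → p (x + latticeVec n) :=
    ae_all_iff.2 fun n => ae_shift h _
  filter_upwards [h1] with x hx
  have e : reduce x = x + latticeVec (-latticeFloor x) := by
    have : latticeVec (-latticeFloor x) = -latticeVec (latticeFloor x) := by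
      rw [latticeVec, latticeVec, ← map_neg]
      congr 1
      funext i
      simp
    rw [this, reduce, sub_eq_add_neg]
  rw [e]
  exact hx _ (by rw [← e]; exact halfCell_subset_cell (reduce_mem_halfCell x))

/-- The lattice is countable, so one null set serves for all translations, including the translation
by `latticeFloor x`, which varies with `x`. -/
theorem IsQuasi.ae_reduce {k : Plane} {f : Plane → ℂ} (hf : ∀ v ∈ lattice,
    ∀ᵐ x ∂(volume : Measure Plane), f (x + v) = wave k v * f x) :
    ∀ᵐ x ∂(volume : Measure Plane), f (reduce x) = conj (wave k (latticeVec (latticeFloor x))) * f x := by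
  have h1 : ∀ᵐ x ∂(volume : Measure Plane), ∀ n : Fin 2 → ℤ,
      f (x + -latticeVec n) = wave k (-latticeVec n) * f x :=
    ae_all_iff.2 fun n => hf _ (neg_mem_lattice (latticeVec_mem n))
  filter_upwards [h1] with x hx
  rw [reduce, sub_eq_add_neg, hx, wave_neg_right]

theorem IsQuasi.ae_eq_of_cell {k : Plane} {f g : Plane → ℂ} (hf : IsQuasi k f) (hg : IsQuasi k g)
    (h : f =ᵐ[volume.restrict cell] g) : f =ᵐ[volume] g := by
  filter_upwards [Honeycomb.ae_reduce h, IsQuasi.ae_reduce hf.2, IsQuasi.ae_reduce hg.2]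
    with x h1 h2 h3
  rw [h2, h3] at h1
  have := congrArg (fun z => wave k (latticeVec (latticeFloor x)) * z) h1
  simpa only [← mul_assoc, wave_mul_conj_wave, one_mul] using this

theorem toCell_injective {k : Plane} {f g : Plane → ℂ} (hf : IsQuasi k f) (hg : IsQuasi k g)
    (h : toCell k hf = toCell k hg) : f =ᵐ[volume] g := by
  refine hf.ae_eq_of_cell hg ?_
  have h1 := coeFn_toCell k hf
  rw [h] at h1
  filter_upwards [h1, coeFn_toCell k hg] with x h2 h3
  rw [h3] at h2
  have := congrArg (fun z => wave k x * z) h2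
  simpa only [← mul_assoc, wave_mul_conj_wave, one_mul, eq_comm] using this

/-- A bounded set meets only finitely many translates of the cell. -/
theorem finite_lattice_inter {S : Set Plane} (hS : Bornology.IsBounded S) :
    {v | v ∈ lattice ∧ ∃ x ∈ halfCell, x + v ∈ S}.Finite := by
  obtain ⟨r, hr⟩ := hS.exists_norm_le
  obtain ⟨s, hs⟩ := (ZSpan.fundamentalDomain_isBounded latticeBasis).exists_norm_le
  have h1 := ZSpan.setFinite_inter latticeBasis
    (Metric.isBounded_closedBall (x := (0 : Plane)) (r := r + s))
  refine h1.subset fun v hv => ⟨?_, mem_span_latticeBasis.2 hv.1⟩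
  obtain ⟨x, hx, hxv⟩ := hv.2
  rw [mem_closedBall_zero_iff]
  calc ‖v‖ = ‖(x + v) - x‖ := by rw [add_sub_cancel_left]
    _ ≤ ‖x + v‖ + ‖x‖ := norm_sub_le _ _
    _ ≤ r + s := add_le_add (hr _ hxv) (hs _ hx)

/-- A compact set is covered by finitely many translates of the cell, and the phases do not change
`|f|`. -/
theorem locL2_of_cell {k : Plane} {f : Plane → ℂ} (hm : AEStronglyMeasurable f volume)
    (hf : ∀ v ∈ lattice, ∀ᵐ x ∂(volume : Measure Plane), f (x + v) = wave k v * f x)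
    (hc : MemLp f 2 (volume.restrict cell)) : LocL2 f := by
  intro S hS
  rw [memLp_two_iff_integrable_sq_norm hm.restrict]
  have hc' : IntegrableOn (fun x => ‖f x‖ ^ 2) cell :=
    (memLp_two_iff_integrable_sq_norm hm.restrict).1 hc
  have hfin := finite_lattice_inter hS.isBounded
  have hcover : S ⊆ ⋃ v ∈ {v | v ∈ lattice ∧ ∃ x ∈ halfCell, x + v ∈ S},
      (fun x => x + (-v)) ⁻¹' cell := by
    intro x hx
    refine Set.mem_biUnion (x := latticeVec (latticeFloor x))
      ⟨latticeVec_mem _, reduce x, reduce_mem_halfCell x, ?_⟩ ?_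
    · rw [reduce, sub_add_cancel]; exact hx
    · rw [Set.mem_preimage, ← sub_eq_add_neg]
      exact halfCell_subset_cell (reduce_mem_halfCell x)
  refine IntegrableOn.mono_set ?_ hcover
  rw [integrableOn_finite_biUnion hfin]
  intro v hv
  have hmp := measurePreserving_add_right (volume : Measure Plane) (-v)
  have h1 := (hmp.integrableOn_comp_preimage (measurableEmbedding_addRight (-v))
    (f := fun x => ‖f x‖ ^ 2) (s := cell)).2 hc'
  refine h1.congr (ae_restrict_of_ae ?_)
  filter_upwards [hf (-v) (neg_mem_lattice hv.1)] with x hx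
  simp only [Function.comp_apply]
  rw [hx, norm_mul, norm_wave, one_mul]

/-- The quasi-periodic extension of a function on the cell. -/
def extend (k : Plane) (u : CellL2) (x : Plane) : ℂ := wave k x * u (reduce x)

theorem extend_ae_eq_cell (k : Plane) (u : CellL2) :
    extend k u =ᵐ[volume.restrict cell] fun x => wave k x * u x := by
  have h : ∀ᵐ x ∂(volume.restrict cell : Measure Plane), x ∈ halfCell :=
    restrict_halfCell ▸ ae_restrict_mem (ZSpan.fundamentalDomain_measurableSet latticeBasis)
  filter_upwards [h] with x hx
  rw [extend, reduce_of_mem hx]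

theorem isQuasi_extend (k : Plane) (u : CellL2) : IsQuasi k (extend k u) := by
  have hper : ∀ v ∈ lattice, ∀ x, extend k u (x + v) = wave k v * extend k u x := by
    intro v hv x
    rw [extend, extend, reduce_add hv, wave_add_right]; ring
  have hm : AEStronglyMeasurable (extend k u) volume :=
    ((continuous_wave k).stronglyMeasurable.mul
      ((Lp.stronglyMeasurable u).comp_measurable measurable_reduce)).aestronglyMeasurable
  refine ⟨locL2_of_cell hm (fun v hv => Eventually.of_forall (hper v hv)) ?_,
    fun v hv => Eventually.of_forall (hper v hv)⟩
  rw [memLp_congr_ae (extend_ae_eq_cell k u)]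
  refine MemLp.of_le (Lp.memLp u) ((continuous_wave k).aestronglyMeasurable.mul
    (Lp.memLp u).aestronglyMeasurable) (Eventually.of_forall fun x => ?_)
  rw [norm_mul, norm_wave, one_mul]

theorem toCell_extend (k : Plane) (u : CellL2) : toCell k (isQuasi_extend k u) = u := by
  refine Lp.ext ?_
  filter_upwards [coeFn_toCell k (isQuasi_extend k u), extend_ae_eq_cell k u] with x h1 h2
  rw [h1, h2, ← mul_assoc, conj_wave_mul_wave, one_mul]

/-! ### Unfolding of integrals against compactly supported functions -/

/-- The support of `φ` meets finitely many translates of the half-open cell. Pulling each piece back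
to the cell produces the phase `wave k v`. The finite set depends on `φ` only, so one choice serves
all `k` and `f`. -/
theorem exists_unfolding {φ : Plane → ℂ} (hφ : Continuous φ) (hc : HasCompactSupport φ) :
    ∃ F : Finset Plane, (∀ v ∈ F, v ∈ lattice) ∧
      (∀ v ∈ lattice, v ∉ F → ∀ x ∈ halfCell, φ (x + v) = 0) ∧
      ∀ k f, IsQuasi k f → ∫ x, f x * φ x = ∫ x in cell, f x * ∑ v ∈ F, wave k v * φ (x + v) := by
  have hfin := finite_lattice_inter hc.isCompact.isBounded
  refine ⟨hfin.toFinset, fun v hv => (hfin.mem_toFinset.1 hv).1, fun v hv hvF x hx => ?_,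
    fun k f hf => ?_⟩
  · by_contra h
    exact hvF (hfin.mem_toFinset.2 ⟨hv, x, hx, subset_tsupport _ h⟩)
  · set F := hfin.toFinset with hF
    have hint : Integrable (fun x => f x * φ x) volume := hf.1.integrable_mul ⟨hφ, hc⟩
    let D : Plane → Set Plane := fun v => (fun x => x + (-v)) ⁻¹' halfCell
    have hDm : ∀ v ∈ F, MeasurableSet (D v) := fun v _ =>
      (measurable_add_const (-v)) (ZSpan.fundamentalDomain_measurableSet _)
    have hdisj : Set.Pairwise (F : Set Plane) (Function.onFun Disjoint D) := by
      intro v hv w hw hvw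
      refine Set.disjoint_left.2 fun x hx hx' => hvw ?_
      have hv' : v ∈ lattice := (hfin.mem_toFinset.1 hv).1
      have hw' : w ∈ lattice := (hfin.mem_toFinset.1 hw).1
      have h1 := reduce_of_mem (show x + -v ∈ halfCell from hx)
      have h2 := reduce_of_mem (show x + -w ∈ halfCell from hx')
      rw [reduce_add (neg_mem_lattice hv')] at h1
      rw [reduce_add (neg_mem_lattice hw'), h1] at h2
      simpa using h2
    have h1 : ∫ x, f x * φ x = ∫ x in ⋃ v ∈ F, D v, f x * φ x := by
      refine (setIntegral_eq_integral_of_forall_compl_eq_zero fun x hx => ?_).symm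
      by_contra h
      have hφx : φ x ≠ 0 := right_ne_zero_of_mul h
      refine hx (Set.mem_biUnion (x := latticeVec (latticeFloor x)) ?_ ?_)
      · refine hfin.mem_toFinset.2 ⟨latticeVec_mem _, reduce x, reduce_mem_halfCell x, ?_⟩
        rw [reduce, sub_add_cancel]
        exact subset_tsupport _ hφx
      · show x + -_ ∈ halfCell
        rw [← sub_eq_add_neg]
        exact reduce_mem_halfCell x
    rw [h1, integral_biUnion_finset F hDm hdisj (fun v _ => hint.integrableOn)]
    have h2 : ∀ v ∈ F, ∫ x in D v, f x * φ x = ∫ x in cell, f x * (wave k v * φ (x + v)) := by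
      intro v hv
      have hmp := measurePreserving_add_right (volume : Measure Plane) v
      have hpre : (fun x => x + v) ⁻¹' (D v) = halfCell := by
        ext x
        simp [D]
      rw [← hmp.setIntegral_preimage_emb (measurableEmbedding_addRight v), hpre, restrict_halfCell]
      refine integral_congr_ae (ae_restrict_of_ae ?_)
      filter_upwards [hf.2 v (hfin.mem_toFinset.1 hv).1] with x hx
      rw [hx]; ring
    rw [Finset.sum_congr rfl h2, ← integral_finsetSum]
    · simp_rw [Finset.mul_sum]
    · intro v _
      have hcont : Continuous fun x => wave k v * φ (x + v) := by fun_prop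
      have := (hf.1.continuous_mul hcont) cell isCompact_cell
      have := this.integrable (by norm_num)
      refine this.congr (Eventually.of_forall fun x => ?_)
      simp only [mul_comm]

/-- Integration against a compactly supported function as an inner product in `L²(cell)`. -/
theorem exists_testVec (k : Plane) {φ : Plane → ℂ} (hφ : Continuous φ ∧ HasCompactSupport φ) :
    ∃ p : CellL2, ∀ (f : Plane → ℂ) (hf : IsQuasi k f), ∫ x, f x * φ x = inner ℂ p (toCell k hf) := by
  obtain ⟨F, -, -, h⟩ := exists_unfolding hφ.1 hφ.2
  have hcont : Continuous fun x => conj (wave k x * ∑ v ∈ F, wave k v * φ (x + v)) := by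
    have h1 := continuous_wave k
    have h2 := hφ.1
    fun_prop
  refine ⟨(memLp_cell_of_continuous hcont).toLp _, fun f hf => ?_⟩
  rw [toCell, inner_toLp, h k f hf, ip]
  congr 1
  funext x
  rw [Complex.conj_conj]
  linear_combination -(f x * ∑ v ∈ F, wave k v * φ (x + v)) * wave_mul_conj_wave k x

/-- The vector that represents the integration against `φ`. -/
def testVec (k : Plane) (φ : Plane → ℂ) (hφ : Continuous φ ∧ HasCompactSupport φ) : CellL2 :=
  (exists_testVec k hφ).choose

theorem inner_testVec (k : Plane) {φ : Plane → ℂ} (hφ : Continuous φ ∧ HasCompactSupport φ)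
    {f : Plane → ℂ} (hf : IsQuasi k f) :
    inner ℂ (testVec k φ hφ) (toCell k hf) = ∫ x, f x * φ x :=
  ((exists_testVec k hφ).choose_spec f hf).symm

/-! ### Test functions -/

theorem IsTest.cc {φ : Plane → ℂ} (h : IsTest φ) : Continuous φ ∧ HasCompactSupport φ :=
  ⟨h.1.continuous, h.2⟩

theorem IsTest.mul {φ a : Plane → ℂ} (h : IsTest φ) (ha : ContDiff ℝ ∞ a) :
    IsTest fun x => a x * φ x :=
  ⟨ha.mul h.1, h.2.mul_left⟩

theorem IsTest.comp_add_right {φ : Plane → ℂ} (h : IsTest φ) (v : Plane) :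
    IsTest fun x => φ (x + v) :=
  ⟨h.1.comp (contDiff_id.add contDiff_const), h.2.comp_homeomorph (Homeomorph.addRight v)⟩

theorem pd_comp_add_right (φ : Plane → ℂ) (v : Plane) (j : Fin 2) (x : Plane) :
    pd j (fun y => φ (y + v)) x = pd j φ (x + v) := by
  rw [pd, pd, fderiv_comp_add_right]

theorem inner_single_one (k : Plane) (j : Fin 2) :
    inner ℝ k (EuclideanSpace.single j (1 : ℝ)) = k j := by
  simp [EuclideanSpace.inner_single_right]

theorem pd_wave (q : Plane) (j : Fin 2) (x : Plane) : pd j (wave q) x = I * q j * wave q x := by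
  have h1 : HasFDerivAt (fun x : Plane => ((inner ℝ q x : ℝ) : ℂ))
      (Complex.ofRealCLM.comp (innerSL ℝ q)) x :=
    Complex.ofRealCLM.hasFDerivAt.comp x (innerSL ℝ q).hasFDerivAt
  have h2 := ((h1.const_mul I).cexp).fderiv
  rw [pd]
  change fderiv ℝ (fun x => Complex.exp (I * ((inner ℝ q x : ℝ) : ℂ))) x _ = _
  rw [h2]
  have := inner_single_one q j
  simp only [smul_apply, ContinuousLinearMap.comp_apply, innerSL_apply_apply, this, wave,
    Complex.ofRealCLM_apply, smul_eq_mul]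
  ring

theorem pd_mul {f g : Plane → ℂ} {x : Plane} (hf : DifferentiableAt ℝ f x)
    (hg : DifferentiableAt ℝ g x) (j : Fin 2) :
    pd j (fun y => f y * g y) x = f x * pd j g x + pd j f x * g x := by
  have := (hf.hasFDerivAt.mul hg.hasFDerivAt).fderiv
  rw [pd, pd, pd]
  erw [this]
  simp [mul_comm]

theorem continuous_pd {f : Plane → ℂ} (hf : ContDiff ℝ ∞ f) (j : Fin 2) : Continuous (pd j f) :=
  (hf.continuous_fderiv (by simp)).clm_apply continuous_const

theorem contDiff_pd {f : Plane → ℂ} (hf : ContDiff ℝ ∞ f) (j : Fin 2) : ContDiff ℝ ∞ (pd j f) :=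
  (hf.fderiv_right (m := ∞) (by simp)).clm_apply contDiff_const

/-- Integration by parts. -/
theorem integral_mul_pd {f φ : Plane → ℂ} (hf : ContDiff ℝ ∞ f) (hφ : IsTest φ) (j : Fin 2) :
    ∫ x, f x * pd j φ x = -∫ x, pd j f x * φ x := by
  refine integral_mul_fderiv_eq_neg_fderiv_mul_of_integrable (μ := (volume : Measure Plane))
    (f := f) (g := φ) ?_ ?_ ?_ ?_ ?_
  · exact (LocL2.of_continuous (continuous_pd hf j)).integrable_mul hφ.cc
  · exact (LocL2.of_continuous hf.continuous).integrable_mul (hφ.pd j)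
  · exact (LocL2.of_continuous hf.continuous).integrable_mul hφ.cc
  · exact fun x _ => hf.differentiable (by simp) x
  · exact fun x _ => hφ.1.differentiable (by simp) x

/-- Integration by parts against a plane wave: differentiating a test function acts on Fourier
coefficients as multiplication by the symbol `-i (k + n)_j`, where `n` stands for the dual lattice
vector. -/
theorem inner_testVec_pd (k : Plane) {φ : Plane → ℂ} (hφ : IsTest φ) (j : Fin 2) (n : Fin 2 → ℤ) :
    inner ℂ (testVec k (pd j φ) (hφ.pd j)) (expVec n) =
      -(I * (k + dualVec n) j) * inner ℂ (testVec k φ hφ.cc) (expVec n) := by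
  rw [expVec_eq_toCell k, inner_smul_right, inner_smul_right, inner_testVec, inner_testVec,
    integral_mul_pd (contDiff_wave _) hφ]
  simp_rw [pd_wave, mul_assoc]
  rw [integral_const_mul, integral_const_mul]
  ring

/-! ### A smooth partition of unity over the lattice -/

/-- A smooth function on the line, with integer translates that sum up to one. -/
def tent (s : ℝ) : ℝ := Real.smoothTransition s - Real.smoothTransition (s - 1)

theorem tent_eq_zero {s : ℝ} (h : s ∉ Set.Icc (0 : ℝ) 2) : tent s = 0 := by
  rw [Set.mem_Icc, not_and_or, not_le, not_le] at h
  rw [tent]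
  rcases h with h | h
  · rw [Real.smoothTransition.zero_of_nonpos h.le, Real.smoothTransition.zero_of_nonpos (by linarith),
      sub_zero]
  · rw [Real.smoothTransition.one_of_one_le (by linarith),
      Real.smoothTransition.one_of_one_le (by linarith), sub_self]

theorem tent_add_tent {s : ℝ} (h : s ∈ Set.Icc (0 : ℝ) 1) : tent s + tent (s + 1) = 1 := by
  rw [tent, tent, add_sub_cancel_right,
    Real.smoothTransition.zero_of_nonpos (x := s - 1) (by linarith [h.2]),
    Real.smoothTransition.one_of_one_le (x := s + 1) (by linarith [h.1])]
  ring

theorem contDiff_tent : ContDiff ℝ ∞ tent :=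
  Real.smoothTransition.contDiff.sub
    (Real.smoothTransition.contDiff.comp (contDiff_id.sub contDiff_const))

/-- A smooth function with lattice translates that sum up to one. -/
def cutoff (x : Plane) : ℂ := ∏ i, (tent (coord x i) : ℂ)

theorem isTest_cutoff : IsTest cutoff := by
  refine ⟨contDiff_prod fun i _ => ?_, ?_⟩
  · refine Complex.ofRealCLM.contDiff.comp (contDiff_tent.comp ?_)
    exact (ContinuousLinearMap.proj (R := ℝ) (φ := fun _ : Fin 2 => ℝ) i).contDiff.comp coord.contDiff
  · refine HasCompactSupport.of_support_subset_isCompact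
      ((isCompact_univ_pi fun _ : Fin 2 => isCompact_Icc (a := (0 : ℝ)) (b := 2)).image
        coord.symm.continuous) fun x hx => ⟨coord x, fun i _ => ?_, coord.symm_apply_apply x⟩
    by_contra h
    refine hx (Finset.prod_eq_zero (Finset.mem_univ i) ?_)
    rw [tent_eq_zero h, Complex.ofReal_zero]

theorem latticeVec_injective : Function.Injective latticeVec := fun m n h => by
  funext i
  have := congrArg (fun v => coord v i) h
  simpa only [coord_latticeVec, Int.cast_inj] using this

/-- At a point of the half-open cell only the translates with integer coordinates 0 and 1
contribute, and the sum over them factors into one-dimensional sums equal to one. A general `F` is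
compared with this set `G` through their union. -/
theorem sum_cutoff_eq_one {F : Finset Plane} (hF : ∀ v ∈ F, v ∈ lattice) {x : Plane}
    (hx : x ∈ halfCell) (h0 : ∀ v ∈ lattice, v ∉ F → cutoff (x + v) = 0) :
    ∑ v ∈ F, cutoff (x + v) = 1 := by
  classical
  let G : Finset Plane := (Fintype.piFinset fun _ : Fin 2 => ({0, 1} : Finset ℤ)).image latticeVec
  have hx' := mem_halfCell.1 hx
  have hG : ∑ v ∈ G, cutoff (x + v) = 1 := by
    rw [Finset.sum_image fun _ _ _ _ h => latticeVec_injective h]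
    simp only [cutoff, map_add, Pi.add_apply, coord_latticeVec]
    rw [← Finset.prod_univ_sum (fun _ : Fin 2 => ({0, 1} : Finset ℤ))
      (fun i (m : ℤ) => (tent (coord x i + m) : ℂ))]
    refine Finset.prod_eq_one fun i _ => ?_
    rw [Finset.sum_pair (by norm_num)]
    have := tent_add_tent (Set.Ico_subset_Icc_self (hx' i))
    push_cast
    rw [add_zero]
    exact_mod_cast this
  have hG0 : ∀ v ∈ lattice, v ∉ G → cutoff (x + v) = 0 := by
    intro v hv hvG
    obtain ⟨n, rfl⟩ := mem_lattice_iff.1 hv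
    by_contra h
    refine hvG (Finset.mem_image_of_mem _ (Fintype.mem_piFinset.2 fun i => ?_))
    have hi : tent (coord x i + n i) ≠ 0 := by
      intro h'
      refine h (Finset.prod_eq_zero (Finset.mem_univ i) ?_)
      rw [map_add, Pi.add_apply, coord_latticeVec, h', Complex.ofReal_zero]
    have hmem := not_imp_comm.1 tent_eq_zero hi
    have h1 : (-1 : ℤ) < n i := by
      have := hmem.1
      have h2 := (hx' i).2
      have : (-1 : ℝ) < n i := by linarith
      exact_mod_cast this
    -- The closed support of `tent` leaves the translate by 2 as a boundary case; there both
    -- transition functions equal one and `tent` vanishes.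
    have h2 : n i < 2 ∨ n i = 2 := by
      have := hmem.2
      have h2 := (hx' i).1
      have : (n i : ℝ) ≤ 2 := by linarith
      exact lt_or_eq_of_le (by exact_mod_cast this)
    rcases h2 with h2 | h2
    · simp only [Finset.mem_insert, Finset.mem_singleton]; omega
    · exfalso
      apply hi
      rw [h2, tent, Real.smoothTransition.one_of_one_le (by push_cast; linarith [(hx' i).1]),
        Real.smoothTransition.one_of_one_le (by push_cast; linarith [(hx' i).1]), sub_self]
  rw [← hG, Finset.sum_subset (Finset.subset_union_left (s₁ := F) (s₂ := G)),
    Finset.sum_subset (Finset.subset_union_right (s₁ := F) (s₂ := G))]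
  · intro v hv hvG
    rcases Finset.mem_union.1 hv with h | h
    · exact hG0 v (hF v h) hvG
    · exact absurd h hvG
  · intro v hv hvF
    rcases Finset.mem_union.1 hv with h | h
    · exact absurd h hvF
    · obtain ⟨n, -, rfl⟩ := Finset.mem_image.1 h
      exact h0 _ (latticeVec_mem n) hvF

/-- The test function with the Fourier series `e_n` after multiplication with the phase. -/
def waveTest (k : Plane) (n : Fin 2 → ℤ) (x : Plane) : ℂ :=
  conj (wave (k + dualVec n) x) * cutoff x

theorem isTest_waveTest (k : Plane) (n : Fin 2 → ℤ) : IsTest (waveTest k n) :=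
  isTest_cutoff.mul (Complex.conjCLE.contDiff.comp (contDiff_wave _))

/-- Unfolding cancels the phases and sums the cutoffs to one, which leaves a single exponential on
the cell. Compactly supported test functions therefore detect each Fourier mode exactly. -/
theorem testVec_waveTest (k : Plane) (n : Fin 2 → ℤ) :
    testVec k (waveTest k n) (isTest_waveTest k n).cc = ((√cellVol.toReal : ℝ) : ℂ) • expVec n := by
  refine ext_inner_right ℂ fun u => ?_
  rw [← toCell_extend k u, inner_testVec, inner_smul_left, Complex.conj_ofReal,
    expVec_eq_toCell k, inner_smul_left, Complex.conj_ofReal, inner_toCell, ← mul_assoc,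
    ← Complex.ofReal_mul, mul_inv_cancel₀ (Real.sqrt_pos.2 cellVol_toReal_pos).ne',
    Complex.ofReal_one, one_mul]
  obtain ⟨F, hF, hF0, h⟩ := exists_unfolding (isTest_waveTest k n).1.continuous (isTest_waveTest k n).2
  rw [h k _ (isQuasi_extend k u), ip]
  have hc : ∀ᵐ x ∂(volume.restrict cell : Measure Plane), x ∈ halfCell :=
    restrict_halfCell ▸ ae_restrict_mem (ZSpan.fundamentalDomain_measurableSet latticeBasis)
  refine integral_congr_ae ?_
  filter_upwards [hc] with x hx
  have h1 : ∀ v ∈ F, wave k v * waveTest k n (x + v) =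
      conj (wave (k + dualVec n) x) * cutoff (x + v) := by
    intro v hv
    rw [waveTest, wave_add_right, map_mul, wave_add_left k _ v, wave_dualVec_lattice n (hF v hv),
      mul_one]
    linear_combination (conj (wave (k + dualVec n) x) * cutoff (x + v)) * wave_mul_conj_wave k v
  rw [Finset.sum_congr rfl h1, ← Finset.mul_sum, sum_cutoff_eq_one hF hx, mul_one, mul_comm]
  intro v hv hvF
  have := hF0 v hv hvF x hx
  rw [waveTest, mul_eq_zero] at this
  refine this.resolve_left fun h' => ?_
  have := wave_mul_conj_wave (k + dualVec n) (x + v)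
  rw [h', mul_zero] at this
  exact zero_ne_one this

/-! ### Weak equations in terms of Fourier coefficients -/

/-- Weak identities amount to identities between Fourier coefficients. One direction tests with
`waveTest`; the other sums the coefficient identities by Parseval. Both weak gradients and the weak
eigenvalue equation are instances. -/
theorem forall_testVec_iff (k : Plane) (F : Fin 2 → CellL2) (u : CellL2) :
    (∀ φ (hφ : IsTest φ), ∑ i, inner ℂ (testVec k (pd i φ) (hφ.pd i)) (F i) =
        inner ℂ (testVec k φ hφ.cc) u) ↔
      ∀ n, ∑ i, -(I * (k + dualVec n) i) * inner ℂ (expVec n) (F i) = inner ℂ (expVec n) u := by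
  constructor
  · intro h n
    have hne : ((√cellVol.toReal : ℝ) : ℂ) ≠ 0 := by
      exact_mod_cast (Real.sqrt_pos.2 cellVol_toReal_pos).ne'
    have h1 : ∀ i, testVec k (pd i (waveTest k n)) ((isTest_waveTest k n).pd i) =
        conj (-(I * (k + dualVec n) i)) • (((√cellVol.toReal : ℝ) : ℂ) • expVec n) := by
      intro i
      refine CellL2.ext_inner fun m => ?_
      rw [← inner_conj_symm, inner_testVec_pd k (isTest_waveTest k n), testVec_waveTest, inner_smul_right, map_mul,
        inner_conj_symm]
      rcases eq_or_ne m n with rfl | hmn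
      · rfl
      · rw [inner_smul_right, orthonormal_expVec.2 hmn]; simp
    have h2 := h _ (isTest_waveTest k n)
    simp only [h1, testVec_waveTest, inner_smul_left, Complex.conj_conj, Complex.conj_ofReal] at h2
    apply mul_left_cancel₀ hne
    rw [← h2, Finset.mul_sum]
    exact Finset.sum_congr rfl fun i _ => by ring
  · intro h φ hφ
    have h1 : ∀ i, HasSum (fun n => inner ℂ (testVec k φ hφ.cc) (expVec n) *
        (-(I * (k + dualVec n) i) * inner ℂ (expVec n) (F i)))
        (inner ℂ (testVec k (pd i φ) (hφ.pd i)) (F i)) := by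
      intro i
      have := expBasis.hasSum_inner_mul_inner (testVec k (pd i φ) (hφ.pd i)) (F i)
      rw [coe_expBasis] at this
      have e : ∀ n, inner ℂ (testVec k (pd i φ) (hφ.pd i)) (expVec n) * inner ℂ (expVec n) (F i) =
          inner ℂ (testVec k φ hφ.cc) (expVec n) *
            (-(I * (k + dualVec n) i) * inner ℂ (expVec n) (F i)) := fun n => by
        rw [inner_testVec_pd k hφ]; ring
      simpa only [e] using this
    have h2 := hasSum_sum fun i (_ : i ∈ Finset.univ) => h1 i
    simp_rw [← Finset.mul_sum, h] at h2
    have h3 := expBasis.hasSum_inner_mul_inner (testVec k φ hφ.cc) u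
    rw [coe_expBasis] at h3
    exact h2.unique h3

theorem weakDeriv_iff {k : Plane} {f g : Plane → ℂ} (hf : IsQuasi k f) (hg : IsQuasi k g)
    (j : Fin 2) :
    (∀ φ, IsTest φ → ∫ x, f x * pd j φ x = -∫ x, g x * φ x) ↔
      ∀ n, inner ℂ (expVec n) (toCell k hg) =
        I * (k + dualVec n) j * inner ℂ (expVec n) (toCell k hf) := by
  have h := forall_testVec_iff k (fun i => if i = j then toCell k hf else 0) (-toCell k hg)
  simp only [apply_ite (inner ℂ _), inner_zero_right, Finset.sum_ite_eq', Finset.mem_univ, if_true,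
    mul_ite, mul_zero, inner_neg_right, inner_testVec] at h
  rw [h]
  exact forall_congr' fun n => by rw [eq_comm, neg_mul, neg_inj]

theorem eq_of_weakDeriv {g g' : Plane → ℂ} (hg : LocL2 g) (hg' : LocL2 g')
    (h : ∀ φ, IsTest φ → ∫ x, g x * φ x = ∫ x, g' x * φ x) : g =ᵐ[volume] g' := by
  refine ae_eq_of_integral_contDiff_smul_eq hg.locallyIntegrable hg'.locallyIntegrable
    fun φ hφ hc => ?_
  have := h (fun x => (φ x : ℂ)) ⟨Complex.ofRealCLM.contDiff.comp hφ,
    hc.comp_left (g := fun r : ℝ => (r : ℂ)) Complex.ofReal_zero⟩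
  simpa only [mul_comm, Complex.real_smul] using this

theorem IsWeakGrad.ae_eq {f : Plane → ℂ} {g g' : Fin 2 → Plane → ℂ} (hg : IsWeakGrad f g)
    (hg' : IsWeakGrad f g') (j : Fin 2) : g j =ᵐ[volume] g' j :=
  eq_of_weakDeriv (hg j).1 (hg' j).1 fun φ hφ => by
    rw [← neg_inj, ← (hg j).2 φ hφ, ← (hg' j).2 φ hφ]

theorem LocL2.comp_add_right {f : Plane → ℂ} (hf : LocL2 f) (v : Plane) :
    LocL2 fun x => f (x + v) := by
  intro S hS
  have hmp := measurePreserving_add_right (volume : Measure Plane) v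
  have h1 := hf ((fun x => x + v) '' S) (hS.image (continuous_id.add continuous_const))
  have h2 := hmp.restrict_preimage_emb (measurableEmbedding_addRight v) ((fun x => x + v) '' S)
  rw [Set.preimage_image_eq _ (add_left_injective v)] at h2
  exact h1.comp_measurePreserving h2

/-- Translating `g j` and multiplying it by the phase give weak derivatives of the same function, so
they agree by uniqueness. -/
theorem IsWeakGrad.isQuasi {k : Plane} {f : Plane → ℂ} {g : Fin 2 → Plane → ℂ}
    (hf : IsQuasi k f) (hg : IsWeakGrad f g) (j : Fin 2) : IsQuasi k (g j) := by
  refine ⟨(hg j).1, fun v hv => ?_⟩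
  refine eq_of_weakDeriv ((hg j).1.comp_add_right v) ((hg j).1.const_mul _) fun φ hφ => ?_
  have ht : IsTest fun x => φ (x + -v) := hφ.comp_add_right (-v)
  have key : ∀ (F ψ : Plane → ℂ), ∫ x, F (x + v) * ψ x = ∫ x, F x * ψ (x + -v) := by
    intro F ψ
    rw [← integral_add_right_eq_self (fun x => F x * ψ (x + -v)) v]
    simp
  have h1 := (hg j).2 _ ht
  rw [key, ← neg_inj, ← h1]
  simp_rw [pd_comp_add_right φ (-v) j]
  rw [← key f (pd j φ), integral_congr_mul (hf.2 v hv), integral_smul_mul, integral_smul_mul,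
    (hg j).2 φ hφ]
  ring

/-! ### Diagonal operators -/

section Diagonal

variable {ι H : Type*} [NormedAddCommGroup H] [InnerProductSpace ℂ H]

theorem HilbertBasis.ext_inner (b : HilbertBasis ι ℂ H) {u v : H}
    (h : ∀ n, inner ℂ (b n) u = inner ℂ (b n) v) : u = v := by
  apply b.repr.injective
  ext n
  rw [b.repr_apply_apply, b.repr_apply_apply, h]

theorem exists_diagonal (b : HilbertBasis ι ℂ H) (d : ι → ℂ) {C : ℝ} (hC : 0 ≤ C)
    (hd : ∀ n, ‖d n‖ ≤ C) :
    ∃ D : H →L[ℂ] H, (∀ n u, inner ℂ (b n) (D u) = d n * inner ℂ (b n) u) ∧ ‖D‖ ≤ C := by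
  have hmem : ∀ u : lp (fun _ : ι => ℂ) 2, Memℓp (fun n => d n * u n) 2 := fun u =>
    Memℓp.mono (g := fun n => C * ‖u n‖) ((lp.memℓp u).norm.const_mul C) fun n => by
      rw [norm_mul]
      exact mul_le_mul_of_nonneg_right (hd n) (norm_nonneg _)
  let L : lp (fun _ : ι => ℂ) 2 →ₗ[ℂ] lp (fun _ : ι => ℂ) 2 :=
    { toFun := fun u => ⟨_, hmem u⟩
      map_add' := fun u v => by ext n; exact mul_add _ _ _
      map_smul' := fun c u => by ext n; exact mul_left_comm _ _ _ }
  have hL : ∀ u, ‖L u‖ ≤ C * ‖u‖ := by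
    intro u
    have h0 : ‖L u‖ ≤ ‖(C : ℂ) • u‖ := lp.norm_mono (by norm_num) fun n => by
      show ‖d n * u n‖ ≤ ‖(C : ℂ) * u n‖
      rw [norm_mul, norm_mul, Complex.norm_real, Real.norm_of_nonneg hC]
      exact mul_le_mul_of_nonneg_right (hd n) (norm_nonneg _)
    rwa [norm_smul, Complex.norm_real, Real.norm_of_nonneg hC] at h0
  refine ⟨(L.comp b.repr.toLinearEquiv.toLinearMap |> fun M =>
    (b.repr.symm.toLinearEquiv.toLinearMap.comp M)).mkContinuous C fun u => ?_, fun n u => ?_,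
    LinearMap.mkContinuous_norm_le _ hC _⟩
  · have := hL (b.repr u)
    simpa using this
  · rw [← b.repr_apply_apply, ← b.repr_apply_apply]
    simp [L]

/-- The operator is the norm limit of its finite rank truncations: the tail is again diagonal, with
norm at most the supremum of the discarded entries. -/
theorem isCompactOperator_of_diagonal (b : HilbertBasis ι ℂ H) [CompleteSpace H] {d : ι → ℂ}
    (hd : Tendsto d cofinite (𝓝 0))
    {D : H →L[ℂ] H} (hD : ∀ n u, inner ℂ (b n) (D u) = d n * inner ℂ (b n) u) :
    IsCompactOperator D := by
  classical
  let F : Finset ι → (H →L[ℂ] H) := fun s =>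
    ∑ n ∈ s, (ContinuousLinearMap.toSpanSingleton ℂ (d n • b n)).comp (innerSL ℂ (b n))
  have hF : ∀ s n u, inner ℂ (b n) (F s u) = (if n ∈ s then d n else 0) * inner ℂ (b n) u := by
    intro s n u
    simp only [F, sum_apply, ContinuousLinearMap.comp_apply, innerSL_apply_apply,
      ContinuousLinearMap.toSpanSingleton_apply, inner_sum, inner_smul_right]
    simp only [orthonormal_iff_ite.1 b.orthonormal n, mul_ite, mul_one, mul_zero, Finset.sum_ite_eq]
    split_ifs <;> ring
  refine isCompactOperator_of_tendsto (F := F) (l := atTop) ?_ (Eventually.of_forall fun s => ?_)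
  · rw [Metric.tendsto_atTop]
    intro ε hε
    have h1 : ∀ᶠ n in cofinite, ‖d n‖ < ε / 2 := by
      have := hd.eventually (Metric.ball_mem_nhds 0 (half_pos hε))
      simpa using this
    refine ⟨(eventually_cofinite.1 h1).toFinset, fun s hs => ?_⟩
    obtain ⟨G, hG, hGn⟩ := exists_diagonal b (fun n => if n ∈ s then 0 else -d n) (half_pos hε).le
      (fun n => by
        by_cases hn : n ∈ s
        · simp only [hn, if_true, norm_zero]; exact (half_pos hε).le
        · simp only [hn, if_false, norm_neg]
          by_contra h
          exact hn (hs ((Set.Finite.mem_toFinset _).2 fun h' => h h'.le)))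
    have : F s - D = G := by
      ext u
      refine HilbertBasis.ext_inner b fun n => ?_
      rw [hG, sub_apply, inner_sub_right, hF, hD]
      split_ifs <;> ring
    rw [dist_eq_norm, this]
    linarith
  · show IsCompactOperator (F s)
    refine Finset.sum_induction _ (fun T : H →L[ℂ] H => IsCompactOperator T)
      (fun _ _ h1 h2 => h1.add h2) isCompactOperator_zero fun n _ => ?_
    exact (isCompactOperator_id (E := ℂ)).comp_clm (innerSL ℂ (b n)) |>.clm_comp
      (ContinuousLinearMap.toSpanSingleton ℂ (d n • b n))

theorem isSymmetric_of_diagonal (b : HilbertBasis ι ℂ H) {d : ι → ℝ}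
    {D : H →L[ℂ] H} (hD : ∀ n u, inner ℂ (b n) (D u) = d n * inner ℂ (b n) u) :
    D.IsSymmetric := by
  intro u v
  have h1 := b.hasSum_inner_mul_inner (D u) v
  have h2 := b.hasSum_inner_mul_inner u (D v)
  have e : ∀ n, inner ℂ (D u) (b n) * inner ℂ (b n) v = inner ℂ u (b n) * inner ℂ (b n) (D v) := by
    intro n
    rw [hD, ← inner_conj_symm, hD, map_mul, Complex.conj_ofReal, inner_conj_symm]
    ring
  simp_rw [e] at h1
  exact h1.unique h2

end Diagonal

/-! ### Bessel potentials and their derivatives on periodic functions. -/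

/-- The Fourier multiplier of `(1 - Δ)^(-1/2)`. -/
def besselCoef (n : Fin 2 → ℤ) : ℝ := (√(1 + ‖dualVec n‖ ^ 2))⁻¹

theorem besselCoef_pos (n : Fin 2 → ℤ) : 0 < besselCoef n :=
  inv_pos.2 (Real.sqrt_pos.2 (by positivity))

theorem besselCoef_sq (n : Fin 2 → ℤ) : besselCoef n ^ 2 * (1 + ‖dualVec n‖ ^ 2) = 1 := by
  rw [besselCoef, inv_pow, Real.sq_sqrt (by positivity), inv_mul_cancel₀ (by positivity)]

theorem norm_sq_plane (x : Plane) : ‖x‖ ^ 2 = x 0 ^ 2 + x 1 ^ 2 := by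
  rw [EuclideanSpace.norm_sq_eq, Fin.sum_univ_two, Real.norm_eq_abs, Real.norm_eq_abs, sq_abs, sq_abs]

theorem besselCoef_le_one (n : Fin 2 → ℤ) : besselCoef n ≤ 1 := by
  have := besselCoef_sq n
  have := besselCoef_pos n
  nlinarith [mul_nonneg (sq_nonneg (besselCoef n)) (sq_nonneg ‖dualVec n‖)]

theorem abs_dualVec_mul_besselCoef_le (n : Fin 2 → ℤ) (j : Fin 2) :
    |dualVec n j * besselCoef n| ≤ 1 := by
  rw [← sq_le_one_iff_abs_le_one, mul_pow]
  have h := besselCoef_sq n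
  rw [norm_sq_plane] at h
  fin_cases j <;> simp only [Fin.zero_eta, Fin.mk_one] <;>
    nlinarith [mul_nonneg (sq_nonneg (besselCoef n)) (sq_nonneg (dualVec n 0)),
      mul_nonneg (sq_nonneg (besselCoef n)) (sq_nonneg (dualVec n 1)), sq_nonneg (besselCoef n)]

theorem dualVec_apply_zero (n : Fin 2 → ℤ) :
    dualVec n 0 = 2 * Real.pi / √3 * (n 0 + n 1) := by
  simp [dualVec, k₁, k₂]; ring

theorem dualVec_apply_one (n : Fin 2 → ℤ) : dualVec n 1 = 2 * Real.pi * (n 0 - n 1) := by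
  simp [dualVec, k₁, k₂]
  have := sqrt_three_ne_zero
  field_simp
  ring

theorem abs_le_norm_dualVec (n : Fin 2 → ℤ) (i : Fin 2) : |(n i : ℝ)| ≤ ‖dualVec n‖ := by
  have h3 : √3 ≤ 2 := by rw [Real.sqrt_le_left (by norm_num)]; norm_num
  have hpi := Real.pi_gt_three
  have h0 : |(n 0 + n 1 : ℝ)| ≤ ‖dualVec n‖ := by
    have h := PiLp.norm_apply_le (dualVec n) 0
    rw [dualVec_apply_zero, norm_mul, Real.norm_eq_abs, Real.norm_eq_abs,
      abs_of_nonneg (by positivity)] at h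
    have : 1 ≤ 2 * Real.pi / √3 := by
      rw [le_div_iff₀ (by positivity)]; linarith
    nlinarith [abs_nonneg (n 0 + n 1 : ℝ)]
  have h1 : |(n 0 - n 1 : ℝ)| ≤ ‖dualVec n‖ := by
    have h := PiLp.norm_apply_le (dualVec n) 1
    rw [dualVec_apply_one, norm_mul, Real.norm_eq_abs, Real.norm_eq_abs,
      abs_of_nonneg (by positivity)] at h
    nlinarith [abs_nonneg (n 0 - n 1 : ℝ)]
  rw [abs_le] at *
  fin_cases i <;> simp only [Fin.zero_eta, Fin.mk_one] <;> constructor <;> linarith [h0.1, h0.2, h1.1, h1.2]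

theorem tendsto_besselCoef : Tendsto (fun n => (besselCoef n : ℂ)) cofinite (𝓝 0) := by
  have h1 : Tendsto (fun n => ‖dualVec n‖) cofinite atTop := by
    rw [tendsto_atTop]
    intro r
    rw [eventually_cofinite]
    refine (Set.finite_coe_iff.1 (Fintype.piFinset fun _ : Fin 2 =>
      Finset.Icc (-⌈|r|⌉) ⌈|r|⌉).finite_toSet).subset fun n hn => ?_
    rw [Set.mem_ofPred_eq, not_le] at hn
    refine Finset.mem_coe.2 (Fintype.mem_piFinset.2 fun i => Finset.mem_Icc.2 ?_)
    rw [← abs_le]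
    have : |(n i : ℝ)| ≤ ⌈|r|⌉ :=
      (abs_le_norm_dualVec n i).trans (hn.le.trans ((le_abs_self r).trans (Int.le_ceil _)))
    exact_mod_cast this
  rw [← Complex.ofReal_zero]
  refine (Complex.continuous_ofReal.tendsto 0).comp ?_
  exact tendsto_inv_atTop_zero.comp (tendsto_atTop_mono (f := fun n => ‖dualVec n‖)
    (fun n => Real.le_sqrt_of_sq_le (by linarith)) h1)

theorem exists_opJ : ∃ D : CellL2 →L[ℂ] CellL2,
    (∀ n u, inner ℂ (expBasis n) (D u) = (besselCoef n : ℂ) * inner ℂ (expBasis n) u) ∧ ‖D‖ ≤ 1 :=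
  exists_diagonal expBasis _ zero_le_one fun n => by
    rw [Complex.norm_real, Real.norm_of_nonneg (besselCoef_pos n).le]
    exact besselCoef_le_one n

theorem exists_opT (j : Fin 2) : ∃ D : CellL2 →L[ℂ] CellL2,
    (∀ n u, inner ℂ (expBasis n) (D u) =
      ((dualVec n j * besselCoef n : ℝ) : ℂ) * inner ℂ (expBasis n) u) ∧ ‖D‖ ≤ 1 :=
  exists_diagonal expBasis _ zero_le_one fun n => by
    rw [Complex.norm_real]
    exact abs_dualVec_mul_besselCoef_le n j

/-- The operator `(1 - Δ)^(-1/2)` on periodic functions. -/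
def opJ : CellL2 →L[ℂ] CellL2 := exists_opJ.choose

/-- The operator `(1/i) ∂_j (1 - Δ)^(-1/2)` on periodic functions. -/
def opT (j : Fin 2) : CellL2 →L[ℂ] CellL2 := (exists_opT j).choose

/-- The operator `((1/i) ∂_j + k_j) (1 - Δ)^(-1/2)` on periodic functions. -/
def opS (k : Plane) (j : Fin 2) : CellL2 →L[ℂ] CellL2 := opT j + (k j : ℂ) • opJ

theorem inner_opJ (n : Fin 2 → ℤ) (u : CellL2) :
    inner ℂ (expVec n) (opJ u) = (besselCoef n : ℂ) * inner ℂ (expVec n) u := by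
  have : inner ℂ (expBasis n) (opJ u) = (besselCoef n : ℂ) * inner ℂ (expBasis n) u :=
    exists_opJ.choose_spec.1 n u
  rwa [coe_expBasis] at this

theorem inner_opT (j : Fin 2) (n : Fin 2 → ℤ) (u : CellL2) :
    inner ℂ (expVec n) (opT j u) =
      ((dualVec n j * besselCoef n : ℝ) : ℂ) * inner ℂ (expVec n) u := by
  have : inner ℂ (expBasis n) (opT j u) =
      ((dualVec n j * besselCoef n : ℝ) : ℂ) * inner ℂ (expBasis n) u :=
    (exists_opT j).choose_spec.1 n u
  rwa [coe_expBasis] at this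

theorem inner_opS (k : Plane) (j : Fin 2) (n : Fin 2 → ℤ) (u : CellL2) :
    inner ℂ (expVec n) (opS k j u) =
      ((k + dualVec n) j : ℂ) * ((besselCoef n : ℂ) * inner ℂ (expVec n) u) := by
  rw [opS, add_apply, inner_add_right, inner_opT, smul_apply, inner_smul_right, inner_opJ]
  simp only [PiLp.add_apply]
  push_cast
  ring

theorem isSymmetric_opJ : (opJ : CellL2 →L[ℂ] CellL2).IsSymmetric :=
  isSymmetric_of_diagonal expBasis (fun n u => by rw [coe_expBasis, inner_opJ])

theorem isSymmetric_opS (k : Plane) (j : Fin 2) : (opS k j).IsSymmetric :=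
  isSymmetric_of_diagonal (d := fun n => (k + dualVec n) j * besselCoef n) expBasis (fun n u => by
    rw [coe_expBasis, inner_opS]; push_cast; ring)

theorem isCompactOperator_opJ : IsCompactOperator opJ :=
  isCompactOperator_of_diagonal expBasis tendsto_besselCoef
    (fun n u => by rw [coe_expBasis, inner_opJ])

theorem opJ_injective {u : CellL2} (h : opJ u = 0) : u = 0 := by
  refine eq_zero_of_inner_expVec u fun n => ?_
  have := inner_opJ n u
  rw [h, inner_zero_right, eq_comm, mul_eq_zero] at this
  exact this.resolve_left (by exact_mod_cast (besselCoef_pos n).ne')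

/-- The symbol identity `(1 + |n|²) / (1 + |n|²) = 1`, with `n` the dual lattice vector. In the form
of `norm_sq_opJ_add_opT` it says that the gradient part controls `w` up to `J w`, which is the
source of coercivity. -/
theorem opJ_sq_add_opT_sq (u : CellL2) :
    opJ (opJ u) + ∑ j, opT j (opT j u) = u := by
  refine CellL2.ext_inner fun n => ?_
  simp only [inner_add_right, inner_opJ, Fin.sum_univ_two, inner_opT]
  have h := besselCoef_sq n
  rw [norm_sq_plane] at h
  have h' : ((besselCoef n ^ 2 * (1 + (dualVec n 0 ^ 2 + dualVec n 1 ^ 2)) : ℝ) : ℂ) = 1 := by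
    rw [h, Complex.ofReal_one]
  push_cast at h' ⊢
  linear_combination inner ℂ (expVec n) u * h'

theorem norm_sq_opJ_add_opT (u : CellL2) :
    ‖opJ u‖ ^ 2 + (‖opT 0 u‖ ^ 2 + ‖opT 1 u‖ ^ 2) = ‖u‖ ^ 2 := by
  have hT : ∀ j, (opT j).IsSymmetric := fun j =>
    isSymmetric_of_diagonal expBasis (fun n u => by rw [coe_expBasis, inner_opT])
  have h := congrArg (fun v => inner ℂ u v) (opJ_sq_add_opT_sq u)
  have e1 : inner ℂ u (opJ (opJ u)) = inner ℂ (opJ u) (opJ u) := (isSymmetric_opJ _ _).symm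
  have e2 : ∀ j, inner ℂ u (opT j (opT j u)) = inner ℂ (opT j u) (opT j u) :=
    fun j => (hT j _ _).symm
  simp only [inner_add_right, Fin.sum_univ_two, e1, e2, inner_self_eq_norm_sq_to_K] at h
  exact_mod_cast h

/-! ### Multiplication operators -/

theorem exists_mulOp {a : Plane → ℂ} (ha : Continuous a) : ∃ M : CellL2 →L[ℂ] CellL2,
    ∀ u : CellL2, M u =ᵐ[volume.restrict cell] fun x => a x * u x := by
  obtain ⟨C, hC⟩ := isCompact_cell.exists_bound_of_continuousOn ha.continuousOn
  have hC' : ∀ᵐ x ∂(volume.restrict cell : Measure Plane), ‖a x‖ ≤ C :=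
    (ae_restrict_iff' measurableSet_cell).2 (Eventually.of_forall hC)
  have hmem : ∀ u : CellL2, MemLp (fun x => a x * u x) 2 (volume.restrict cell) := fun u => by
    refine MemLp.of_le_mul (c := C) (Lp.memLp u)
      (ha.aestronglyMeasurable.mul (Lp.memLp u).aestronglyMeasurable) ?_
    filter_upwards [hC'] with x hx
    rw [norm_mul]
    exact mul_le_mul_of_nonneg_right hx (norm_nonneg _)
  let L : CellL2 →ₗ[ℂ] CellL2 :=
    { toFun := fun u => (hmem u).toLp _
      map_add' := fun u v => Lp.ext (by
        filter_upwards [(hmem (u + v)).coeFn_toLp, (hmem u).coeFn_toLp, (hmem v).coeFn_toLp,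
          Lp.coeFn_add u v, Lp.coeFn_add ((hmem u).toLp _) ((hmem v).toLp _)] with x h1 h2 h3 h4 h5
        rw [h1, h5, Pi.add_apply, h2, h3, h4, Pi.add_apply, mul_add])
      map_smul' := fun c u => Lp.ext (by
        filter_upwards [(hmem (c • u)).coeFn_toLp, (hmem u).coeFn_toLp,
          Lp.coeFn_smul c u, Lp.coeFn_smul c ((hmem u).toLp _)] with x h1 h2 h3 h4
        rw [h1, RingHom.id_apply, h4, Pi.smul_apply, h2, h3, Pi.smul_apply, smul_eq_mul,
          smul_eq_mul, mul_left_comm]) }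
  refine ⟨L.mkContinuous C fun u => ?_, fun u => (hmem u).coeFn_toLp⟩
  refine Lp.norm_le_mul_norm_of_ae_le_mul ?_
  filter_upwards [hC', (hmem u).coeFn_toLp] with x hx h1
  show ‖((hmem u).toLp _ : CellL2) x‖ ≤ _
  rw [h1, norm_mul]
  exact mul_le_mul_of_nonneg_right hx (norm_nonneg _)

/-- Multiplication by a continuous function. -/
def mulOp (a : Plane → ℂ) (ha : Continuous a) : CellL2 →L[ℂ] CellL2 := (exists_mulOp ha).choose

theorem coeFn_mulOp {a : Plane → ℂ} (ha : Continuous a) (u : CellL2) :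
    mulOp a ha u =ᵐ[volume.restrict cell] fun x => a x * u x := (exists_mulOp ha).choose_spec u

theorem toCell_mul {k : Plane} {a f : Plane → ℂ} (ha : Continuous a) (hf : IsQuasi k f)
    (haf : IsQuasi k fun x => a x * f x) : toCell k haf = mulOp a ha (toCell k hf) := by
  refine Lp.ext ?_
  filter_upwards [coeFn_toCell k haf, coeFn_mulOp ha (toCell k hf), coeFn_toCell k hf] with x h1 h2 h3
  rw [h1, h2, h3]; ring

theorem inner_mulOp {a : Plane → ℂ} (ha : Continuous a) (u v : CellL2) :
    inner ℂ u (mulOp a ha v) = ∫ x in cell, a x * (conj (u x) * v x) := by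
  rw [L2.inner_def]
  refine integral_congr_ae ?_
  filter_upwards [coeFn_mulOp ha v] with x h
  rw [h, RCLike.inner_apply]; ring

theorem integrable_conj_mul (u v : CellL2) :
    Integrable (fun x => conj (u x) * v x) (volume.restrict cell) := by
  refine (L2.integrable_inner (𝕜 := ℂ) u v).congr (Eventually.of_forall fun x => ?_)
  simp only [RCLike.inner_apply, mul_comm]

theorem integrable_mul_conj_mul {a : Plane → ℂ} (ha : Continuous a) (u v : CellL2) :
    Integrable (fun x => a x * (conj (u x) * v x)) (volume.restrict cell) := by
  refine (integrable_conj_mul u (mulOp a ha v)).congr ?_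
  filter_upwards [coeFn_mulOp ha v] with x h
  rw [h]; ring

theorem inner_mulOp_symm {a b : Plane → ℂ} (ha : Continuous a) (hb : Continuous b)
    (hab : ∀ x, conj (a x) = b x) (u v : CellL2) :
    inner ℂ (mulOp a ha u) v = inner ℂ u (mulOp b hb v) := by
  rw [← inner_conj_symm, inner_mulOp, inner_mulOp, ← integral_conj]
  congr 1
  funext x
  rw [map_mul, hab, map_mul, Complex.conj_conj, mul_comm (v x)]

/-! ### The Bloch operators -/

section Bloch

variable {A : Plane → Matrix (Fin 2) (Fin 2) ℂ} (hA : IsHoneycombMedium A)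

/-- Multiplication by the coefficient `A i j`. -/
def coefOp (hA : IsHoneycombMedium A) (i j : Fin 2) : CellL2 →L[ℂ] CellL2 :=
  mulOp (fun x => A x i j) (hA.smooth i j).continuous

theorem coefOp_symm (i j : Fin 2) (u v : CellL2) :
    inner ℂ (coefOp hA i j u) v = inner ℂ u (coefOp hA j i v) :=
  inner_mulOp_symm _ _ (fun x => (hA.hermitian x).apply j i) u v

/-- The operator `(1 - Δ)^(-1/2) L_k (1 - Δ)^(-1/2)`, where `L_k` is the conjugation of
`-∇ · A ∇` with `exp (i k · x)`. -/
def bloch (hA : IsHoneycombMedium A) (k : Plane) : CellL2 →L[ℂ] CellL2 :=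
  ∑ i, ∑ j, opS k i * (coefOp hA i j * opS k j)

theorem bloch_apply (k : Plane) (w : CellL2) :
    bloch hA k w = ∑ i, ∑ j, opS k i (coefOp hA i j (opS k j w)) := by
  simp only [bloch, sum_apply, mul_apply_eq_comp]

theorem inner_bloch (k : Plane) (v w : CellL2) :
    inner ℂ v (bloch hA k w) = ∑ i, ∑ j, inner ℂ (opS k i v) (coefOp hA i j (opS k j w)) := by
  simp only [bloch_apply, inner_sum]
  exact Finset.sum_congr rfl fun i _ => Finset.sum_congr rfl fun j _ =>
    (isSymmetric_opS k i _ _).symm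

theorem isSymmetric_bloch (k : Plane) : (bloch hA k).IsSymmetric := by
  intro v w
  show inner ℂ (bloch hA k v) w = inner ℂ v (bloch hA k w)
  rw [← inner_conj_symm, inner_bloch, inner_bloch, map_sum, Finset.sum_comm]
  simp only [map_sum, inner_conj_symm, coefOp_symm]

/-- The pointwise lower ellipticity bound at `ξ = (y 0 x, y 1 x)`, integrated over the cell. -/
theorem coefOp_elliptic {c : ℝ} (hc : ∀ (x : Plane) (ξ : Fin 2 → ℂ),
    c * ∑ i, ‖ξ i‖ ^ 2 ≤ (star ξ ⬝ᵥ (A x).mulVec ξ).re) (y : Fin 2 → CellL2) :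
    c * ∑ i, ‖y i‖ ^ 2 ≤ (∑ i, ∑ j, inner ℂ (y i) (coefOp hA i j (y j))).re := by
  have h1 : ∀ i j, Integrable (fun x => A x i j * (conj (y i x) * y j x)) (volume.restrict cell) :=
    fun i j => integrable_mul_conj_mul (hA.smooth i j).continuous (y i) (y j)
  have h2 : ∑ i, ∑ j, inner ℂ (y i) (coefOp hA i j (y j)) =
      ∫ x in cell, star (fun i => y i x) ⬝ᵥ (A x).mulVec (fun i => y i x) := by
    simp only [coefOp, inner_mulOp]
    rw [Finset.sum_congr rfl fun i _ => (integral_finsetSum _ fun j _ => h1 i j).symm,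
      ← integral_finsetSum _ fun i _ => integrable_finsetSum _ fun j _ => h1 i j]
    congr 1
    funext x
    simp only [dotProduct, Matrix.mulVec, Finset.mul_sum]
    exact Finset.sum_congr rfl fun i _ => Finset.sum_congr rfl fun j _ => by
      simp only [Pi.star_apply, RCLike.star_def]; ring
  have hint : Integrable (fun x => star (fun i => y i x) ⬝ᵥ (A x).mulVec (fun i => y i x))
      (volume.restrict cell) := by
    refine (integrable_finsetSum Finset.univ fun i _ => integrable_finsetSum Finset.univ
      fun j _ => h1 i j).congr (Eventually.of_forall fun x => ?_)
    simp only [dotProduct, Matrix.mulVec, Finset.mul_sum]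
    exact Finset.sum_congr rfl fun i _ => Finset.sum_congr rfl fun j _ => by
      simp only [Pi.star_apply, RCLike.star_def]; ring
  have h3 : ∀ i, Integrable (fun x => ‖y i x‖ ^ 2) (volume.restrict cell) := fun i =>
    (memLp_two_iff_integrable_sq_norm (Lp.memLp (y i)).aestronglyMeasurable).1 (Lp.memLp (y i))
  have h4 : ∀ i, ‖y i‖ ^ 2 = ∫ x in cell, ‖y i x‖ ^ 2 := by
    intro i
    rw [norm_sq_eq_re_inner (𝕜 := ℂ), L2.inner_def]
    refine (integral_re (L2.integrable_inner (𝕜 := ℂ) (y i) (y i))).symm.trans ?_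
    congr 1
    funext x
    exact (norm_sq_eq_re_inner (𝕜 := ℂ) (y i x)).symm
  have h5 : (∫ x in cell, star (fun i => y i x) ⬝ᵥ (A x).mulVec (fun i => y i x)).re =
      ∫ x in cell, (star (fun i => y i x) ⬝ᵥ (A x).mulVec (fun i => y i x)).re :=
    (integral_re hint).symm
  rw [h2, h5, Finset.sum_congr rfl fun i _ => h4 i, ← integral_finsetSum _ fun i _ => h3 i,
    ← integral_const_mul]
  exact integral_mono ((integrable_finsetSum _ fun i _ => h3 i).const_mul c) hint.re
    fun x => hc x _

/-- A Gårding inequality. Ellipticity bounds the form below by `c ∑ ‖S_j w‖²`. From `T_j = S_j - k_j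
J` one gets `‖S_j w‖² ≥ ‖T_j w‖² / 2 - k_j² ‖J w‖²`, and `∑ ‖T_j w‖² = ‖w‖² - ‖J w‖²`. Hence the
constants `c / 2` and `c (1 / 2 + r²)`. -/
theorem exists_coercive (r : ℝ) : ∃ δ > 0, ∃ c, ∀ k : Plane, ‖k‖ ≤ r →
    CoerciveWith opJ (bloch hA k) c δ := by
  obtain ⟨c, _, hc, _, h⟩ := hA.elliptic
  refine ⟨c / 2, by positivity, c * (1 / 2 + r ^ 2), fun k hk w => ?_⟩
  have h1 := coefOp_elliptic hA (fun x ξ => (h x ξ).1) fun i => opS k i w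
  rw [← inner_bloch, Fin.sum_univ_two] at h1
  have h2 : ∀ j, ‖opT j w‖ ^ 2 / 2 - k j ^ 2 * ‖opJ w‖ ^ 2 ≤ ‖opS k j w‖ ^ 2 := by
    intro j
    have e : opT j w = opS k j w - (k j : ℂ) • opJ w := by
      rw [opS, add_apply, smul_apply, add_sub_cancel_right]
    have e2 : ‖opT j w‖ ≤ ‖opS k j w‖ + |k j| * ‖opJ w‖ := by
      rw [e]
      refine (norm_sub_le _ _).trans_eq ?_
      rw [norm_smul, Complex.norm_real, Real.norm_eq_abs]
    have e3 := pow_le_pow_left₀ (norm_nonneg _) e2 2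
    have e4 : |k j| ^ 2 = k j ^ 2 := sq_abs _
    nlinarith [sq_nonneg (‖opS k j w‖ - |k j| * ‖opJ w‖)]
  have h3 := norm_sq_opJ_add_opT w
  have h4 : k 0 ^ 2 + k 1 ^ 2 ≤ r ^ 2 := by
    rw [← norm_sq_plane]
    exact pow_le_pow_left₀ (norm_nonneg _) hk 2
  have h5 := h2 0
  have h6 := h2 1
  have h7 : (‖w‖ ^ 2 - ‖opJ w‖ ^ 2) / 2 - r ^ 2 * ‖opJ w‖ ^ 2 ≤
      ‖opS k 0 w‖ ^ 2 + ‖opS k 1 w‖ ^ 2 := by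
    nlinarith [mul_le_mul_of_nonneg_right h4 (sq_nonneg ‖opJ w‖)]
  have h8 := mul_le_mul_of_nonneg_left h7 hc.le
  nlinarith

/-! ### Eigenspaces in terms of the Bloch operators -/

/-- A weak gradient in `L²_loc` puts the periodic part `u` of `f` into the range of `J`. With `γ j =
-i ∂_j u`, the witness `J u + ∑ T_j γ_j` represents `(1 - Δ)^(1/2) u` without an unbounded operator.
-/
theorem exists_opJ_eq {k : Plane} {f : Plane → ℂ} {g : Fin 2 → Plane → ℂ} (hf : IsQuasi k f)
    (hg : IsWeakGrad f g) : ∃ w, toCell k hf = opJ w := by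
  let γ : Fin 2 → CellL2 := fun j =>
    (-I) • toCell k (hg.isQuasi hf j) - (k j : ℂ) • toCell k hf
  refine ⟨opJ (toCell k hf) + ∑ j, opT j (γ j), CellL2.ext_inner fun n => ?_⟩
  have h1 : ∀ j, inner ℂ (expVec n) (γ j) = dualVec n j * inner ℂ (expVec n) (toCell k hf) := by
    intro j
    have := (weakDeriv_iff hf (hg.isQuasi hf j) j).1 (hg j).2 n
    simp only [γ, inner_sub_right, inner_smul_right, this, PiLp.add_apply, Complex.ofReal_add]
    linear_combination -(k j + dualVec n j) * inner ℂ (expVec n) (toCell k hf) * I_sq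
  simp only [inner_opJ, inner_add_right, Fin.sum_univ_two, inner_opT, h1]
  have h := besselCoef_sq n
  rw [norm_sq_plane] at h
  have h' : ((besselCoef n ^ 2 * (1 + (dualVec n 0 ^ 2 + dualVec n 1 ^ 2)) : ℝ) : ℂ) = 1 := by
    rw [h, Complex.ofReal_one]
  push_cast at h' ⊢
  linear_combination -inner ℂ (expVec n) (toCell k hf) * h'

theorem weakDeriv_iff_opS {k : Plane} {f g : Plane → ℂ} (hf : IsQuasi k f) (hg : IsQuasi k g)
    {w : CellL2} (hw : toCell k hf = opJ w) (j : Fin 2) :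
    (∀ φ, IsTest φ → ∫ x, f x * pd j φ x = -∫ x, g x * φ x) ↔ toCell k hg = I • opS k j w := by
  have e : ∀ n, I * (k + dualVec n) j * inner ℂ (expVec n) (toCell k hf) =
      inner ℂ (expVec n) (I • opS k j w) := by
    intro n
    rw [inner_smul_right, inner_opS, hw, inner_opJ]; ring
  rw [weakDeriv_iff hf hg]
  simp_rw [e]
  exact ⟨CellL2.ext_inner, fun h n => by rw [h]⟩

theorem isQuasi_coef {k : Plane} {f : Plane → ℂ} (hA : IsHoneycombMedium A) (hf : IsQuasi k f)
    (i j : Fin 2) : IsQuasi k fun x => A x i j * f x :=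
  hf.periodic_mul (hA.smooth i j).continuous fun v hv x => by rw [hA.periodic x v hv]

theorem isQuasi_flux {k : Plane} {g : Fin 2 → Plane → ℂ} (hA : IsHoneycombMedium A)
    (hg : ∀ j, IsQuasi k (g j)) (i : Fin 2) : IsQuasi k (flux A g i) := by
  have e : flux A g i = fun x => A x i 0 * g 0 x + A x i 1 * g 1 x := by
    funext x
    rw [flux, Fin.sum_univ_two]
  rw [e]
  exact (isQuasi_coef hA (hg 0) i 0).add (isQuasi_coef hA (hg 1) i 1)

theorem toCell_flux {k : Plane} {g : Fin 2 → Plane → ℂ} (hg : ∀ j, IsQuasi k (g j)) (i : Fin 2) :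
    toCell k (isQuasi_flux hA hg i) = ∑ j, coefOp hA i j (toCell k (hg j)) := by
  rw [toCell_congr (g := fun x => A x i 0 * g 0 x + A x i 1 * g 1 x) (isQuasi_flux hA hg i)
    ((isQuasi_coef hA (hg 0) i 0).add (isQuasi_coef hA (hg 1) i 1))
    (Eventually.of_forall fun x => by rw [flux, Fin.sum_univ_two]),
    toCell_add (isQuasi_coef hA (hg 0) i 0) (isQuasi_coef hA (hg 1) i 1),
    toCell_mul (hA.smooth i 0).continuous (hg 0) (isQuasi_coef hA (hg 0) i 0),
    toCell_mul (hA.smooth i 1).continuous (hg 1) (isQuasi_coef hA (hg 1) i 1),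
    Fin.sum_univ_two]
  rfl

/-- The Fourier coefficients of the two equations differ by the factor `besselCoef n`, which never
vanishes. -/
theorem weakEq_iff {k : Plane} {f : Plane → ℂ} {g : Fin 2 → Plane → ℂ} (hf : IsQuasi k f)
    (hg : ∀ j, IsQuasi k (g j)) {w : CellL2} (hw : toCell k hf = opJ w)
    (hgw : ∀ j, toCell k (hg j) = I • opS k j w) (E : ℝ) :
    (∀ φ, IsTest φ → ∑ i, ∫ x, flux A g i x * pd i φ x = (E : ℂ) * ∫ x, f x * φ x) ↔
      bloch hA k w = (E : ℂ) • opJ (opJ w) := by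
  have h := forall_testVec_iff k (fun i => toCell k (isQuasi_flux hA hg i)) ((E : ℂ) • toCell k hf)
  simp only [inner_smul_right, inner_testVec] at h
  rw [h]
  have e1 : ∀ n, ∑ i, -(I * (k + dualVec n) i) * inner ℂ (expVec n) (toCell k (isQuasi_flux hA hg i))
      = ∑ i, ((k + dualVec n) i : ℂ) * inner ℂ (expVec n) (∑ j, coefOp hA i j (opS k j w)) := by
    intro n
    refine Finset.sum_congr rfl fun i _ => ?_
    rw [toCell_flux hA hg]
    simp only [hgw, map_smul, ← Finset.smul_sum, inner_smul_right]
    linear_combination -((k + dualVec n) i : ℂ) *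
      inner ℂ (expVec n) (∑ j, coefOp hA i j (opS k j w)) * I_sq
  have e2 : ∀ n, inner ℂ (expVec n) (bloch hA k w) = besselCoef n *
      ∑ i, ((k + dualVec n) i : ℂ) * inner ℂ (expVec n) (∑ j, coefOp hA i j (opS k j w)) := by
    intro n
    rw [bloch_apply, inner_sum, Finset.mul_sum]
    refine Finset.sum_congr rfl fun i _ => ?_
    rw [← map_sum, inner_opS]; ring
  constructor
  · intro h
    refine CellL2.ext_inner fun n => ?_
    rw [e2, ← e1, h, hw, inner_smul_right, inner_opJ n (opJ w)]; ring
  · intro h n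
    have hb : (besselCoef n : ℂ) ≠ 0 := by exact_mod_cast (besselCoef_pos n).ne'
    apply mul_left_cancel₀ hb
    rw [e1, ← e2, h, hw, inner_smul_right, inner_opJ n (opJ w)]; ring

/-- The dictionary between weak solutions on the plane and the bounded problem `B w = E J² w`. In
the converse direction the weak gradient is the quasi-periodic extension of `i S_j w`. -/
theorem mem_eigenspace_iff {k : Plane} {E : ℝ} {f : Fn} :
    f ∈ eigenspace A k E ↔ ∃ (hf : IsQuasi k f) (w : CellL2), toCell k hf = opJ w ∧
      bloch hA k w = (E : ℂ) • opJ (opJ w) := by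
  constructor
  · rintro ⟨hf, g, hg, -, hs⟩
    obtain ⟨w, hw⟩ := exists_opJ_eq hf hg
    exact ⟨hf, w, hw, (weakEq_iff hA hf (fun j => hg.isQuasi hf j) hw
      (fun j => (weakDeriv_iff_opS hf (hg.isQuasi hf j) hw j).1 (hg j).2) E).1 hs⟩
  · rintro ⟨hf, w, hw, hB⟩
    have hq : ∀ j, IsQuasi k (extend k (I • opS k j w)) := fun j => isQuasi_extend k _
    have ht : ∀ j, toCell k (hq j) = I • opS k j w := fun j => toCell_extend k _
    exact ⟨hf, fun j => extend k (I • opS k j w), fun j => ⟨(hq j).1,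
      (weakDeriv_iff_opS hf (hq j) hw j).2 (ht j)⟩, fun i => (isQuasi_flux hA hq i).1,
      (weakEq_iff hA hf hq hw ht E).2 hB⟩

/-- The quasi-periodic function with the given periodic part, modulo equality almost
everywhere. -/
def blochFn (k : Plane) (u : CellL2) : Fn :=
  AEEqFun.mk (extend k u) (isQuasi_extend k u).1.aestronglyMeasurable

theorem isQuasi_blochFn (k : Plane) (u : CellL2) : IsQuasi k (blochFn k u) :=
  (isQuasi_extend k u).congr (AEEqFun.coeFn_mk _ _)

theorem toCell_blochFn (k : Plane) (u : CellL2) : toCell k (isQuasi_blochFn k u) = u := by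
  rw [toCell_congr (isQuasi_blochFn k u) (isQuasi_extend k u) (AEEqFun.coeFn_mk _ _), toCell_extend]

theorem fn_ext_toCell {k : Plane} {f g : Fn} (hf : IsQuasi k f) (hg : IsQuasi k g)
    (h : toCell k hf = toCell k hg) : f = g :=
  AEEqFun.ext (toCell_injective hf hg h)

theorem toCell_fn_add {k : Plane} {f g : Fn} (hf : IsQuasi k f) (hg : IsQuasi k g)
    (hfg : IsQuasi k (f + g : Fn)) : toCell k hfg = toCell k hf + toCell k hg := by
  rw [toCell_congr hfg (hf.add hg) (coeFn_add' f g), toCell_add]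

theorem toCell_fn_smul {k : Plane} {f : Fn} (hf : IsQuasi k f) (c : ℂ)
    (hcf : IsQuasi k (c • f : Fn)) : toCell k hcf = c • toCell k hf := by
  rw [toCell_congr hcf (hf.const_mul c) (coeFn_smul' c f), toCell_const_mul]

theorem isQuasi_fn_zero (k : Plane) : IsQuasi k (0 : Fn) := (L2k k).zero_mem

theorem toCell_fn_zero (k : Plane) : toCell k (isQuasi_fn_zero k) = 0 := by
  have h0 : IsQuasi k ((0 : ℂ) • (0 : Fn) : Fn) := (L2k k).smul_mem 0 (L2k k).zero_mem
  have h1 := toCell_fn_smul (isQuasi_fn_zero k) 0 h0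
  rw [zero_smul] at h1
  rw [← h1]
  refine toCell_congr _ _ ?_
  filter_upwards [coeFn_smul' 0 (0 : Fn), coeFn_zero'] with x h2 h3
  rw [h2, h3, zero_mul]

/-! ### The band structure from the Bloch operators. -/

theorem exists_isBands_bloch (k : Plane) : ∃ E b w, IsBands opJ (bloch hA k) E b w := by
  obtain ⟨δ, hδ, c, h⟩ := exists_coercive hA ‖k‖
  exact exists_isBands not_finiteDimensional_cellL2 isCompactOperator_opJ isSymmetric_opJ
    (fun x => opJ_injective) (isSymmetric_bloch hA k) hδ (h k le_rfl)

theorem isBandStructure_of_isBands {E : ℕ → Plane → ℝ} {b : Plane → HilbertBasis ℕ ℂ CellL2}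
    {w : Plane → ℕ → CellL2}
    (h : ∀ k, IsBands opJ (bloch hA k) (fun n => E n k) (b k) (w k)) :
    IsBandStructure A E fun n k => blochFn k (b k n) where
  mono k := (h k).mono
  unbounded k := (h k).tendsto
  eigen n k := by
    refine ⟨(mem_eigenspace_iff hA).2 ⟨isQuasi_blochFn k _, w k n, ?_, ?_⟩, fun h0 => ?_⟩
    · rw [toCell_blochFn, (h k).apply_J]
    · rw [(h k).eigen, (h k).apply_J]
    · refine (b k).orthonormal.ne_zero n ?_
      rw [← toCell_blochFn k (b k n), ← toCell_fn_zero k]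
      refine toCell_congr _ _ ?_
      rw [h0]
  orthonormal k m n := by
    rw [← inner_toCell (isQuasi_blochFn k _) (isQuasi_blochFn k _), toCell_blochFn, toCell_blochFn,
      orthonormal_iff_ite.1 (b k).orthonormal]
  complete k f hf h0 := by
    refine fn_ext_toCell hf (isQuasi_fn_zero k) ?_
    rw [toCell_fn_zero]
    refine HilbertBasis.ext_inner (b k) fun n => ?_
    rw [inner_zero_right, ← h0 n, ← inner_toCell (isQuasi_blochFn k _) hf, toCell_blochFn]

end Bloch

/-! ### The velocity operators -/

section Velocity

variable {A : Plane → Matrix (Fin 2) (Fin 2) ℂ}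

/-- The derivative of the Bloch operator in the component `l` of the quasi-momentum. -/
def velOp (hA : IsHoneycombMedium A) (k : Plane) (l : Fin 2) : CellL2 →L[ℂ] CellL2 :=
  ∑ m, (opJ * (coefOp hA l m * opS k m) + opS k m * (coefOp hA m l * opJ))

theorem inner_velOp (hA : IsHoneycombMedium A) (k : Plane) (l : Fin 2) (v w : CellL2) :
    inner ℂ v (velOp hA k l w) = ∑ m, (inner ℂ (opJ v) (coefOp hA l m (opS k m w)) +
      inner ℂ v (opS k m (coefOp hA m l (opJ w)))) := by
  simp only [velOp, sum_apply, add_apply, mul_apply_eq_comp, inner_sum, inner_add_right]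
  exact Finset.sum_congr rfl fun m _ => by
    rw [show inner ℂ (opJ v) _ = inner ℂ v (opJ _) from isSymmetric_opJ _ _]

theorem inner_velOp_symm (hA : IsHoneycombMedium A) (k : Plane) (l : Fin 2) (v w : CellL2) :
    inner ℂ v (velOp hA k l w) = conj (inner ℂ w (velOp hA k l v)) := by
  rw [inner_velOp, inner_velOp, map_sum]
  refine Finset.sum_congr rfl fun m _ => ?_
  rw [map_add, inner_conj_symm, inner_conj_symm, add_comm, coefOp_symm]
  congr 1
  · exact (isSymmetric_opS k m _ _).symm
  · rw [show inner ℂ (opS k m (coefOp hA m l (opJ v))) w =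
      inner ℂ (coefOp hA m l (opJ v)) (opS k m w) from isSymmetric_opS k m _ _, coefOp_symm]

/-- Each `opS` is affine in the quasi-momentum, so the expansion is exact: `velOp` is the derivative
and the remainder is an explicit quadratic form in `κ`. -/
theorem bloch_add (hA : IsHoneycombMedium A) (k κ : Plane) :
    bloch hA (k + κ) = bloch hA k + ∑ l, (κ l : ℂ) • velOp hA k l +
      ∑ i, ∑ j, ((κ j * κ i : ℝ) : ℂ) • (opJ * (coefOp hA i j * opJ)) := by
  have hS : ∀ j, opS (k + κ) j = opS k j + (κ j : ℂ) • opJ := by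
    intro j
    rw [opS, opS, PiLp.add_apply, Complex.ofReal_add, add_smul, add_assoc]
  simp only [bloch, velOp, hS, Fin.sum_univ_two, add_mul, mul_add, smul_mul_assoc, mul_smul_comm,
    smul_add, Complex.ofReal_mul, mul_smul]
  abel

theorem inner_bloch_sub (hA : IsHoneycombMedium A) (k κ : Plane) (v w : CellL2) :
    inner ℂ v ((bloch hA (k + κ) - bloch hA k) w) =
      ∑ l, (κ l : ℂ) * inner ℂ v (velOp hA k l w) +
      ∑ i, ∑ j, ((κ j * κ i : ℝ) : ℂ) * inner ℂ (opJ v) (coefOp hA i j (opJ w)) := by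
  rw [bloch_add, add_assoc, add_sub_cancel_left]
  simp only [add_apply, sum_apply, smul_apply, mul_apply_eq_comp, inner_add_right, inner_sum,
    inner_smul_right]
  congr 1
  exact Finset.sum_congr rfl fun i _ => Finset.sum_congr rfl fun j _ => by
    rw [show inner ℂ (opJ v) _ = inner ℂ v (opJ _) from isSymmetric_opJ _ _]

theorem contDiff_bloch (hA : IsHoneycombMedium A) : ContDiff ℝ ∞ (bloch hA) := by
  have hS : ∀ j, ContDiff ℝ ∞ fun k => opS k j := by
    intro j
    refine contDiff_const.add (ContDiff.smul (𝕜 := ℝ) (𝕜' := ℂ) (Complex.ofRealCLM.contDiff.comp ?_) contDiff_const)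
    exact (EuclideanSpace.proj (𝕜 := ℝ) j).contDiff
  unfold bloch
  refine ContDiff.sum fun i _ => ContDiff.sum fun j _ => ?_
  exact (hS i).mul (contDiff_const.mul (hS j))

theorem weakGrad_spec {f : Plane → ℂ} (h : ∃ g, IsWeakGrad f g) : IsWeakGrad f (weakGrad f) := by
  rw [weakGrad, dif_pos h]
  exact h.choose_spec

theorem exists_isWeakGrad {k : Plane} {f : Plane → ℂ} (hf : IsQuasi k f) {w : CellL2}
    (hw : toCell k hf = opJ w) : ∃ g, IsWeakGrad f g :=
  ⟨fun j => extend k (I • opS k j w), fun j => ⟨(isQuasi_extend k _).1,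
    (weakDeriv_iff_opS hf (isQuasi_extend k _) hw j).2 (toCell_extend k _)⟩⟩

/-- The product rule for weak derivatives. -/
theorem weakDeriv_mul {a f g : Plane → ℂ} (ha : ContDiff ℝ ∞ a) (hf : LocL2 f) (hg : LocL2 g)
    {j : Fin 2} (h : ∀ φ, IsTest φ → ∫ x, f x * pd j φ x = -∫ x, g x * φ x) (φ : Plane → ℂ)
    (hφ : IsTest φ) :
    ∫ x, (a x * f x) * pd j φ x = -∫ x, (pd j a x * f x + a x * g x) * φ x := by
  have h1 := h _ (hφ.mul ha)
  have h2 : ∀ x, f x * pd j (fun y => a y * φ y) x =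
      a x * f x * pd j φ x + pd j a x * f x * φ x := by
    intro x
    rw [pd_mul (ha.differentiable (by simp) x) (hφ.1.differentiable (by simp) x)]
    ring
  have i1 : Integrable (fun x => a x * f x * pd j φ x) volume :=
    (hf.continuous_mul ha.continuous).integrable_mul (hφ.pd j)
  have i2 : Integrable (fun x => pd j a x * f x * φ x) volume :=
    (hf.continuous_mul (continuous_pd ha j)).integrable_mul hφ.cc
  simp_rw [h2] at h1
  rw [integral_add i1 i2] at h1
  rw [integral_add_mul (hf.continuous_mul (continuous_pd ha j)) (hg.continuous_mul ha.continuous)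
    hφ.cc, eq_sub_iff_add_eq.2 h1, neg_add, sub_eq_neg_add]
  congr 3
  funext x
  ring

theorem isQuasi_pd_coef {k : Plane} {f : Plane → ℂ} (hA : IsHoneycombMedium A) (hf : IsQuasi k f)
    (l i j : Fin 2) : IsQuasi k fun x => pd l (fun y => A y i j) x * f x :=
  hf.periodic_mul (continuous_pd (hA.smooth i j) l) fun v hv x => by
    rw [← pd_comp_add_right]
    simp_rw [hA.periodic _ v hv]

/-- The link from the Fermi velocity to perturbation theory: in the variables with the factor `J`
removed, `𝒜` is the first variation of the Bloch operator. -/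
theorem ip_opA (hA : IsHoneycombMedium A) {k : Plane} {f g : Fn} (hf : IsQuasi k f)
    (hg : IsQuasi k g) {v w : CellL2} (hv : toCell k hf = opJ v) (hw : toCell k hg = opJ w)
    (l : Fin 2) : ip f (opA A g l) = inner ℂ v (velOp hA k l w) := by
  have hG := weakGrad_spec (exists_isWeakGrad hg hw)
  have hGq := fun j => hG.isQuasi hg j
  have hGw := fun j => (weakDeriv_iff_opS hg (hGq j) hw j).1 (hG j).2
  have h1 : ∀ m, IsQuasi k fun x => A x l m * weakGrad g m x := fun m => isQuasi_coef hA (hGq m) l m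
  have h2 : ∀ m, IsQuasi k fun x => pd m (fun y => A y m l) x * g x + A x m l * weakGrad g m x :=
    fun m => (isQuasi_pd_coef hA hg m m l).add (isQuasi_coef hA (hGq m) m l)
  -- The term `(1/i) ∂_m (A_ml g)` is a weak derivative by the product rule. Moving `J` from the
  -- left argument of the inner product onto it produces `S_m (A_ml J w)`.
  have h3 : ∀ m, opJ ((-I) • toCell k (h2 m)) = opS k m (coefOp hA m l (opJ w)) := by
    intro m
    have hq := isQuasi_coef hA hg m l
    have e := (weakDeriv_iff hq (h2 m) m).1
      (weakDeriv_mul (hA.smooth m l) hg.1 (hGq m).1 (hG m).2)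
    refine CellL2.ext_inner fun n => ?_
    rw [inner_opJ, inner_smul_right, e n, inner_opS,
      toCell_mul (hA.smooth m l).continuous hg hq, hw, coefOp]
    linear_combination -(besselCoef n : ℂ) * (k + dualVec n) m *
      inner ℂ (expVec n) (mulOp (fun x => A x m l) (hA.smooth m l).continuous (opJ w)) * I_sq
  have h4 : ∀ m, IsQuasi k fun x => (-I) * (A x l m * weakGrad g m x) +
      (-I) * (pd m (fun y => A y m l) x * g x + A x m l * weakGrad g m x) := fun m =>
    ((h1 m).const_mul (-I)).add ((h2 m).const_mul (-I))
  have h5 : opA A g l = fun x => ((-I) * (A x l 0 * weakGrad g 0 x) +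
      (-I) * (pd 0 (fun y => A y 0 l) x * g x + A x 0 l * weakGrad g 0 x)) +
      ((-I) * (A x l 1 * weakGrad g 1 x) +
      (-I) * (pd 1 (fun y => A y 1 l) x * g x + A x 1 l * weakGrad g 1 x)) := by
    funext x
    rw [opA, Fin.sum_univ_two, one_div, Complex.inv_I]
    ring
  have h6 : ∀ m, inner ℂ (opJ v) (toCell k (h4 m)) = inner ℂ (opJ v) (coefOp hA l m (opS k m w)) +
      inner ℂ v (opS k m (coefOp hA m l (opJ w))) := by
    intro m
    rw [toCell_add ((h1 m).const_mul (-I)) ((h2 m).const_mul (-I)), toCell_const_mul (h1 m),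
      toCell_const_mul (h2 m), inner_add_right, ← h3,
      toCell_mul (hA.smooth l m).continuous (hGq m) (h1 m), hGw, map_smul, smul_smul]
    congr 1
    · rw [neg_mul, I_mul_I, neg_neg, one_smul]; rfl
    · exact isSymmetric_opJ _ _
  rw [h5, ← inner_toCell hf ((h4 0).add (h4 1)), toCell_add (h4 0) (h4 1), hv, inner_add_right, h6,
    h6, inner_velOp, Fin.sum_univ_two]

end Velocity

/-! ### Conical points of the dispersion relation -/

/-- The vectors `J (ψ i)` have components only along those `b n` with `E n = E₀`. If there were a
single such index, two orthonormal vectors would be multiples of the same `b n`. Monotonicity then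
makes two such indices adjacent. -/
theorem IsBands.exists_double {H : Type*} [NormedAddCommGroup H] [InnerProductSpace ℂ H]
    [CompleteSpace H] {J B : H →L[ℂ] H} (hJs : J.IsSymmetric) (hBs : B.IsSymmetric) {E : ℕ → ℝ}
    {b : HilbertBasis ℕ ℂ H} {w : ℕ → H} (h : IsBands J B E b w) {E₀ : ℝ} {ψ : Fin 2 → H}
    (hψ : ∀ i, B (ψ i) = (E₀ : ℂ) • J (J (ψ i)))
    (hort : ∀ i j, inner ℂ (J (ψ i)) (J (ψ j)) = if i = j then (1 : ℂ) else 0) :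
    ∃ n, E n = E₀ ∧ E (n + 1) = E₀ := by
  have hcoef : ∀ i n, E n ≠ E₀ → inner ℂ (b n) (J (ψ i)) = 0 := by
    intro i n hn
    have h1 : inner ℂ (w n) (B (ψ i)) = inner ℂ (B (w n)) (ψ i) := (hBs _ _).symm
    rw [hψ, h.eigen, inner_smul_right, inner_smul_left, Complex.conj_ofReal,
      show inner ℂ (w n) (J (J (ψ i))) = inner ℂ (J (w n)) (J (ψ i)) from (hJs _ _).symm, h.apply_J,
      show inner ℂ (J (b n)) (ψ i) = inner ℂ (b n) (J (ψ i)) from hJs _ _] at h1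
    have h2 : ((E₀ - E n : ℝ) : ℂ) * inner ℂ (b n) (J (ψ i)) = 0 := by
      push_cast
      linear_combination h1
    rcases mul_eq_zero.1 h2 with h3 | h3
    · exact absurd (sub_eq_zero.1 (by exact_mod_cast h3)).symm hn
    · exact h3
  have hne : ∀ i, ∃ n, inner ℂ (b n) (J (ψ i)) ≠ 0 := by
    intro i
    by_contra! h0
    have h1 : J (ψ i) = 0 := HilbertBasis.ext_inner b fun n => by rw [h0, inner_zero_right]
    have := hort i i
    rw [h1, inner_zero_left, if_pos rfl] at this
    exact zero_ne_one this
  have key : ∃ m n, m < n ∧ E m = E₀ ∧ E n = E₀ := by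
    by_contra! hS
    have huniq : ∀ m n, E m = E₀ → E n = E₀ → m = n := by
      intro m n hm hn
      rcases lt_trichotomy m n with hl | hl | hl
      · exact absurd hn (hS m n hl hm)
      · exact hl
      · exact absurd hm (hS n m hl hn)
    obtain ⟨n, hn⟩ := hne 0
    obtain ⟨m, hm⟩ := hne 1
    have hnE : E n = E₀ := by_contra fun h' => hn (hcoef 0 n h')
    have hmE : E m = E₀ := by_contra fun h' => hm (hcoef 1 m h')
    obtain rfl := huniq m n hmE hnE
    have h1 := b.hasSum_inner_mul_inner (J (ψ 0)) (J (ψ 1))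
    have h2 := h1.unique (hasSum_single m fun l hl => by
      rw [hcoef 1 l fun h' => hl (huniq l m h' hmE), mul_zero])
    rw [hort, if_neg (by decide), eq_comm, mul_eq_zero] at h2
    rcases h2 with h2 | h2
    · rw [← inner_conj_symm, map_eq_zero] at h2
      exact hn h2
    · exact hm h2
  obtain ⟨m, n, hmn, hm, hn⟩ := key
  refine ⟨m, hm, le_antisymm ?_ ?_⟩
  · rw [← hn]; exact h.mono hmn
  · rw [← hm]; exact h.mono (Nat.le_succ m)

theorem vanishesToOrder_coordinate (i : Fin 2) (s : Set Plane) :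
    VanishesToOrder 1 (fun κ : Plane => (κ i : ℂ)) s :=
  VanishesToOrder.of_lipschitz zero_le_one
    (fun z _ => by
      rw [one_mul, Complex.norm_real]
      exact PiLp.norm_apply_le z i)
    (fun z _ z' _ => by
      rw [one_mul, ← Complex.ofReal_sub, Complex.norm_real]
      exact PiLp.norm_apply_le (z - z') i)

theorem vanishesToOrder_quadratic (a : Fin 2 → Fin 2 → ℂ) (s : Set Plane) :
    VanishesToOrder 2 (fun κ : Plane => ∑ i, ∑ j, ((κ j * κ i : ℝ) : ℂ) * a i j) s := by
  have h : ∀ i j, VanishesToOrder 2 (fun κ : Plane => ((κ j * κ i : ℝ) : ℂ) * a i j) s := by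
    intro i j
    simp_rw [Complex.ofReal_mul]
    exact ((vanishesToOrder_coordinate j s).mul (vanishesToOrder_coordinate i s)).mul
      (VanishesToOrder.const (c := a i j))
  simp_rw [Fin.sum_univ_two]
  exact ((h 0 0).add (h 0 1)).add ((h 1 0).add (h 1 1))

theorem norm_complex_coordinate (κ : Plane) : ‖(κ 0 : ℂ) + I * κ 1‖ = ‖κ‖ := by
  rw [mul_comm, Complex.norm_add_mul_I, EuclideanSpace.norm_eq, Fin.sum_univ_two, Real.norm_eq_abs,
    Real.norm_eq_abs, sq_abs, sq_abs]

theorem finrank_span_pair_of_ip {k : Plane} {Φ₁ Φ₂ : Fn} (q1 : IsQuasi k Φ₁) (q2 : IsQuasi k Φ₂)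
    (h11 : ip Φ₁ Φ₁ = 1) (h12 : ip Φ₁ Φ₂ = 0) (h22 : ip Φ₂ Φ₂ = 1) :
    Module.finrank ℂ (Submodule.span ℂ {Φ₁, Φ₂}) = 2 := by
  have h21 : ip Φ₂ Φ₁ = 0 := by
    rw [← inner_toCell q2 q1, ← inner_conj_symm, inner_toCell, h12, map_zero]
  have hli : LinearIndependent ℂ ![Φ₁, Φ₂] := by
    rw [LinearIndependent.pair_iff]
    intro s t hst
    have q1' : IsQuasi k (s • Φ₁ : Fn) := (L2k k).smul_mem s q1
    have q2' : IsQuasi k (t • Φ₂ : Fn) := (L2k k).smul_mem t q2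
    have q3 : IsQuasi k (s • Φ₁ + t • Φ₂ : Fn) := (L2k k).add_mem q1' q2'
    have e : s • toCell k q1 + t • toCell k q2 = 0 := by
      rw [← toCell_fn_smul q1 s q1', ← toCell_fn_smul q2 t q2', ← toCell_fn_add q1' q2' q3,
        ← toCell_fn_zero k]
      exact toCell_congr _ _ (by rw [hst])
    have e1 := congrArg (fun u => inner ℂ (toCell k q1) u) e
    have e2 := congrArg (fun u => inner ℂ (toCell k q2) u) e
    simp only [inner_add_right, inner_smul_right, inner_toCell, h11, h12, h21, h22,
      inner_zero_right, mul_one, mul_zero, add_zero, zero_add] at e1 e2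
    exact ⟨e1, e2⟩
  have := finrank_span_eq_card hli
  rw [Matrix.range_cons, Matrix.range_cons, Matrix.range_empty, Set.union_empty,
    Set.singleton_union] at this
  rw [this, Fintype.card_fin]

/-- Symmetry enters only through the shape of the velocities: no diagonal part, and an off-diagonal
part `c (κ₀ + i κ₁)`, whose modulus is isotropic. The conical crossing then opens with slope `|c|`.
-/
theorem isDiracPointWith_of_velocity {A : Plane → Matrix (Fin 2) (Fin 2) ℂ}
    (hA : IsHoneycombMedium A) {K : Plane} (hK : K ∈ brillouinZone) {E_D : ℝ} {Φ₁ Φ₂ : Fn}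
    (h1 : Φ₁ ∈ L2kσ K τ) (h2 : Φ₂ = opPC Φ₁) (h2' : Φ₂ ∈ L2kσ K (conj τ)) (h11 : ip Φ₁ Φ₁ = 1)
    (h22 : ip Φ₂ Φ₂ = 1) (h12 : ip Φ₁ Φ₂ = 0)
    (hspan : eigenspace A K E_D = Submodule.span ℂ {Φ₁, Φ₂}) {c : ℂ} (hc : c ≠ 0)
    (hV : ∀ κ : Plane, ∑ l, (κ l : ℂ) * ip Φ₁ (opA A Φ₂ l) = c * (κ 0 + I * κ 1))
    (hV1 : ∀ l, ip Φ₁ (opA A Φ₁ l) = 0) (hV2 : ∀ l, ip Φ₂ (opA A Φ₂ l) = 0) :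
    IsDiracPointWith A K E_D Φ₁ Φ₂ ‖c‖ := by
  have m1 : Φ₁ ∈ eigenspace A K E_D := hspan ▸ Submodule.subset_span (by simp)
  have m2 : Φ₂ ∈ eigenspace A K E_D := hspan ▸ Submodule.subset_span (by simp)
  obtain ⟨q1, w1, hw1, hB1⟩ := (mem_eigenspace_iff hA).1 m1
  obtain ⟨q2, w2, hw2, hB2⟩ := (mem_eigenspace_iff hA).1 m2
  choose E' b' w' hE' using fun k => exists_isBands_bloch hA k
  let E : ℕ → Plane → ℝ := fun n k => E' k n
  have hE : ∀ k, IsBands opJ (bloch hA k) (fun n => E n k) (b' k) (w' k) := hE'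
  let ψ : Fin 2 → CellL2 := ![w1, w2]
  have hψ : ∀ i, bloch hA K (ψ i) = (E_D : ℂ) • opJ (opJ (ψ i)) := by
    intro i
    fin_cases i
    · exact hB1
    · exact hB2
  have h21 : ip Φ₂ Φ₁ = 0 := by
    rw [← inner_toCell q2 q1, ← inner_conj_symm, inner_toCell, h12, map_zero]
  have hort : ∀ i j, inner ℂ (opJ (ψ i)) (opJ (ψ j)) = if i = j then (1 : ℂ) else 0 := by
    have e11 : inner ℂ (opJ w1) (opJ w1) = (1 : ℂ) := by rw [← hw1, inner_toCell, h11]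
    have e12 : inner ℂ (opJ w1) (opJ w2) = (0 : ℂ) := by rw [← hw1, ← hw2, inner_toCell, h12]
    have e21 : inner ℂ (opJ w2) (opJ w1) = (0 : ℂ) := by rw [← hw1, ← hw2, inner_toCell, h21]
    have e22 : inner ℂ (opJ w2) (opJ w2) = (1 : ℂ) := by rw [← hw2, inner_toCell, h22]
    intro i j
    fin_cases i <;> fin_cases j
    · exact e11
    · exact e12
    · exact e21
    · exact e22
  obtain ⟨n, hn, hn'⟩ := (hE K).exists_double isSymmetric_opJ (isSymmetric_bloch hA K) hψ hort
  -- A kernel vector `x` gives the eigenfunction with periodic part `J x`; its expansion in the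
  -- modes transfers back because `J` is injective.
  have hker : ∀ x, bloch hA K x = (E_D : ℂ) • opJ (opJ x) → x ∈ Submodule.span ℂ (Set.range ψ) := by
    intro x hx
    have hm : blochFn K (opJ x) ∈ eigenspace A K E_D :=
      (mem_eigenspace_iff hA).2 ⟨isQuasi_blochFn K _, x, toCell_blochFn K _, hx⟩
    rw [hspan, Submodule.mem_span_pair] at hm
    obtain ⟨s, t, hst⟩ := hm
    have q1' : IsQuasi K (s • Φ₁ : Fn) := (L2k K).smul_mem s q1
    have q2' : IsQuasi K (t • Φ₂ : Fn) := (L2k K).smul_mem t q2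
    have q3 : IsQuasi K (s • Φ₁ + t • Φ₂ : Fn) := (L2k K).add_mem q1' q2'
    have e : opJ (x - (s • w1 + t • w2)) = 0 := by
      have e1 := toCell_blochFn K (opJ x)
      rw [toCell_congr _ q3 (by rw [hst]), toCell_fn_add q1' q2', toCell_fn_smul q1, toCell_fn_smul q2,
        hw1, hw2] at e1
      rw [map_sub, map_add, map_smul, map_smul, e1, sub_self]
    rw [sub_eq_zero.1 (opJ_injective e)]
    exact Submodule.add_mem _ (Submodule.smul_mem _ _ (Submodule.subset_span ⟨0, rfl⟩))
      (Submodule.smul_mem _ _ (Submodule.subset_span ⟨1, rfl⟩))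
  have hv := fun l => ip_opA hA q1 q2 hw1 hw2 l
  have hV21 : ∀ κ : Plane, ∑ l, (κ l : ℂ) * inner ℂ w2 (velOp hA K l w1) =
      conj (c * (κ 0 + I * κ 1)) := by
    intro κ
    rw [← hV, map_sum]
    refine Finset.sum_congr rfl fun l _ => ?_
    rw [inner_velOp_symm, map_mul, Complex.conj_ofReal, hv]
  -- The radius `‖K‖ + 1` covers every `K + κ` with `‖κ‖ < r`, since `r ≤ 1` below.
  obtain ⟨δ, hδ, c', hco⟩ := exists_coercive hA (‖K‖ + 1)
  obtain ⟨L, t, ht, hL⟩ := ((contDiff_bloch hA).contDiffAt (x := K)).of_le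
    (show (1 : WithTop ℕ∞) ≤ ∞ by norm_num) |>.exists_lipschitzOnWith
  obtain ⟨r₀, hr₀, hrt⟩ := Metric.mem_nhds_iff.1 ht
  let r := min r₀ 1
  have hr : 0 < r := lt_min hr₀ one_pos
  have hmem : ∀ κ : Plane, ‖κ‖ < r → K + κ ∈ t := fun κ hκ => hrt (by
    rw [Metric.mem_ball, dist_eq_norm, add_sub_cancel_left]
    exact hκ.trans_le (min_le_left _ _))
  let ρ : Fin 2 → Fin 2 → Plane → ℂ := fun a b κ => ∑ i, ∑ j, ((κ j * κ i : ℝ) : ℂ) *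
    inner ℂ (opJ (ψ a)) (coefOp hA i j (opJ (ψ b)))
  have hlin : ∀ (h : Plane → ℂ), (∀ κ, ‖h κ‖ = ‖c‖ * ‖κ‖) → (∀ κ κ', h κ - h κ' = h (κ - κ')) →
      VanishesToOrder 1 (fun z : Plane × ℝ => h z.1) (Metric.ball 0 r) := by
    intro h hh hs
    refine VanishesToOrder.of_lipschitz (norm_nonneg c) (fun z _ => ?_) (fun z _ z' _ => ?_)
    · rw [hh]
      exact mul_le_mul_of_nonneg_left (norm_fst_le z) (norm_nonneg _)
    · rw [hs, hh]
      exact mul_le_mul_of_nonneg_left (norm_fst_le (z - z')) (norm_nonneg _)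
  have hn1 : ∀ κ : Plane, ‖c * ((κ 0 : ℂ) + I * κ 1)‖ = ‖c‖ * ‖κ‖ := fun κ => by
    rw [norm_mul, norm_complex_coordinate]
  have hs1 : ∀ κ κ' : Plane, c * ((κ 0 : ℂ) + I * κ 1) - c * ((κ' 0 : ℂ) + I * κ' 1) =
      c * (((κ - κ') 0 : ℂ) + I * (κ - κ') 1) := by
    intro κ κ'
    rw [PiLp.sub_apply, PiLp.sub_apply]
    push_cast
    ring
  have hK0 : K + 0 = K := add_zero K
  obtain ⟨ζ, hζ, ep, em, Lip, hp, hm, ⟨C, hC⟩, hexp⟩ := exists_conical_crossing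
    (V := Plane) (J := opJ) isCompactOperator_opJ isSymmetric_opJ (B := fun κ => bloch hA (K + κ))
    (fun κ => isSymmetric_bloch hA _) hδ hr (K := L) L.coe_nonneg
    (fun κ hκ => hco _ ((norm_add_le _ _).trans
      (add_le_add_right (hκ.le.trans (min_le_right _ _)) _)))
    (fun κ κ' hκ hκ' => by
      have := hL.norm_sub_le (hmem κ hκ) (hmem κ' hκ')
      rwa [add_sub_add_left_eq_sub] at this)
    (E := fun n κ => E n (K + κ)) (fun κ => hE (K + κ)) (n := n) (E₀ := E_D)
    (by simpa only [hK0] using hn) (by simpa only [hK0] using hn') (ψ := ψ)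
    (by simpa only [hK0] using hψ) hort (by simpa only [hK0] using hker)
    (υ := ‖c‖) (norm_pos_iff.2 hc) (h₁ := fun κ => c * (κ 0 + I * κ 1))
    (h₂ := fun κ => conj (c * (κ 0 + I * κ 1))) (ρ := ρ)
    (hlin _ hn1 hs1)
    (hlin _ (fun κ => by rw [RCLike.norm_conj, hn1]) (fun κ κ' => by rw [← map_sub, hs1]))
    (fun κ => by
      rw [Complex.mul_conj, Complex.normSq_eq_norm_sq, hn1]
      push_cast
      ring)
    hn1 (fun i j => vanishesToOrder_quadratic _ _)
    (fun κ => by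
      simp only [hK0]
      rw [inner_bloch_sub]
      have := fun l => (ip_opA hA q1 q1 hw1 hw1 l).symm.trans (hV1 l)
      simp [ψ, ρ, this])
    (fun κ => by
      simp only [hK0]
      rw [inner_bloch_sub]
      have := fun l => (ip_opA hA q2 q2 hw2 hw2 l).symm.trans (hV2 l)
      simp [ψ, ρ, this])
    (fun κ => by
      simp only [hK0]
      rw [inner_bloch_sub, ← hV κ]
      simp only [hv]
      rfl)
    (fun κ => by
      simp only [hK0]
      rw [inner_bloch_sub, ← hV21 κ]
      rfl)
  have hball : ∀ k ∈ Metric.ball K ζ, k - K ∈ Metric.ball (0 : Plane) ζ := fun k hk => by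
    rwa [mem_ball_zero_iff, ← dist_eq_norm]
  have hcomp : ∀ e : Plane → ℝ, LipschitzOnWith Lip e (Metric.ball 0 ζ) →
      LipschitzOnWith Lip (fun k => e (k - K)) (Metric.ball K ζ) := by
    intro e he
    refine LipschitzOnWith.of_dist_le_mul fun x hx y hy => ?_
    have := he.dist_le_mul _ (hball x hx) _ (hball y hy)
    rwa [dist_sub_right] at this
  refine ⟨hK, E, _, isBandStructure_of_isBands hA hE, n, hn, hn', ?_, h1, h2, h2', h11, h22, h12,
    hspan, norm_pos_iff.2 hc, ζ, hζ, fun k => ep (k - K), fun k => em (k - K), ⟨Lip, hcomp _ hp⟩,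
    ⟨Lip, hcomp _ hm⟩, ⟨C, fun k hk => hC _ (hball k hk)⟩, fun k hk => ?_⟩
  · rw [hspan, finrank_span_pair_of_ip q1 q2 h11 h12 h22]
  · have := hexp _ (hball k hk)
    rwa [add_sub_cancel] at this

/-! ### The rotation and the lattices -/

theorem R_apply_zero (x : Plane) : R x 0 = -(1 / 2) * x 0 + √3 / 2 * x 1 := rfl

theorem R_apply_one (x : Plane) : R x 1 = -(√3 / 2) * x 0 - 1 / 2 * x 1 := rfl

theorem R_symm_apply_zero (x : Plane) : R.symm x 0 = -(1 / 2) * x 0 - √3 / 2 * x 1 := rfl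

theorem R_symm_apply_one (x : Plane) : R.symm x 1 = √3 / 2 * x 0 - 1 / 2 * x 1 := rfl

theorem plane_ext {x y : Plane} (h0 : x 0 = y 0) (h1 : x 1 = y 1) : x = y := by
  ext i
  fin_cases i
  · exact h0
  · exact h1

theorem R_v₁ : R v₁ = v₂ - v₁ := by
  refine plane_ext ?_ ?_
  · rw [R_apply_zero]; simp [v₁, v₂]; ring
  · rw [R_apply_one]; simp [v₁, v₂]; linear_combination -(1 / 4) * sqrt_three_sq

theorem R_v₂ : R v₂ = -v₁ := by
  refine plane_ext ?_ ?_
  · rw [R_apply_zero]; simp [v₁, v₂]; ring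
  · rw [R_apply_one]; simp [v₁, v₂]; linear_combination -(1 / 4) * sqrt_three_sq

theorem R_k₁ : R k₁ = k₂ := by
  rw [k₁, k₂, map_smul]
  congr 1
  refine plane_ext ?_ ?_
  · rw [R_apply_zero]; simp; linear_combination (1 / 4) * sqrt_three_sq
  · rw [R_apply_one]; simp; ring

theorem R_k₂ : R k₂ = -(k₁ + k₂) := by
  rw [k₁, k₂, map_smul, ← smul_add, ← smul_neg]
  congr 1
  refine plane_ext ?_ ?_
  · rw [R_apply_zero]; simp; linear_combination -(1 / 4) * sqrt_three_sq
  · rw [R_apply_one]; simp; ring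

theorem R_mem_lattice {v : Plane} (hv : v ∈ lattice) : R v ∈ lattice := by
  obtain ⟨m, n, rfl⟩ := hv
  refine ⟨-m - n, m, ?_⟩
  rw [map_add, map_smul, map_smul, R_v₁, R_v₂]
  push_cast
  module

theorem R_R_R (x : Plane) : R (R (R x)) = x := by
  refine plane_ext ?_ ?_
  · simp only [R_apply_zero, R_apply_one]
    linear_combination (3 / 8 * x 0 - √3 * x 1 / 8) * sqrt_three_sq
  · simp only [R_apply_zero, R_apply_one]
    linear_combination (3 / 8 * x 1 + √3 * x 0 / 8) * sqrt_three_sq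

theorem R_symm_eq (x : Plane) : R.symm x = R (R x) := by
  rw [LinearIsometryEquiv.symm_apply_eq, R_R_R]

theorem R_symm_mem_lattice {v : Plane} (hv : v ∈ lattice) : R.symm v ∈ lattice := by
  rw [R_symm_eq]
  exact R_mem_lattice (R_mem_lattice hv)

theorem R_mem_dualLattice {g : Plane} (hg : g ∈ dualLattice) : R g ∈ dualLattice := by
  obtain ⟨m, n, rfl⟩ := hg
  refine ⟨-n, m - n, ?_⟩
  rw [map_add, map_smul, map_smul, R_k₁, R_k₂]
  push_cast
  module

theorem wave_dualLattice {g v : Plane} (hg : g ∈ dualLattice) (hv : v ∈ lattice) : wave g v = 1 := by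
  obtain ⟨m, n, rfl⟩ := hg
  exact wave_dualVec_lattice ![m, n] hv

theorem IsQuasi.of_sub_mem {k l : Plane} (h : l - k ∈ dualLattice) {f : Plane → ℂ}
    (hf : IsQuasi k f) : IsQuasi l f := by
  refine ⟨hf.1, fun v hv => ?_⟩
  have e : wave l v = wave k v := by
    have := wave_add_left k (l - k) v
    rwa [add_sub_cancel, wave_dualLattice h hv, mul_one] at this
  rw [e]
  exact hf.2 v hv

theorem neg_mem_dualLattice {g : Plane} (hg : g ∈ dualLattice) : -g ∈ dualLattice := by
  obtain ⟨m, n, rfl⟩ := hg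
  exact ⟨-m, -n, by push_cast; module⟩

theorem L2k_eq_of_sub_mem {k l : Plane} (h : l - k ∈ dualLattice) : L2k l = L2k k := by
  ext f
  refine ⟨fun hf => IsQuasi.of_sub_mem ?_ hf, fun hf => IsQuasi.of_sub_mem h hf⟩
  rw [← neg_sub]
  exact neg_mem_dualLattice h

theorem eigenspace_eq_of_sub_mem (A : Plane → Matrix (Fin 2) (Fin 2) ℂ) {k l : Plane}
    (h : l - k ∈ dualLattice) (E : ℝ) : eigenspace A l E = eigenspace A k E := by
  ext f
  show f ∈ L2k l ∧ _ ↔ f ∈ L2k k ∧ _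
  rw [L2k_eq_of_sub_mem h]

/-! ### Composition with isometries -/

theorem LocL2.comp_isometry {f : Plane → ℂ} (hf : LocL2 f) (L : Plane ≃ₗᵢ[ℝ] Plane) :
    LocL2 fun x => f (L x) := by
  intro S hS
  have h1 := hf (L '' S) (hS.image L.continuous)
  have h2 := L.measurePreserving.restrict_preimage_emb
    L.toHomeomorph.measurableEmbedding (L '' S)
  rw [Set.preimage_image_eq _ L.injective] at h2
  exact h1.comp_measurePreserving h2

theorem integral_comp_isometry (L : Plane ≃ₗᵢ[ℝ] Plane) (F : Plane → ℂ) :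
    ∫ x, F (L x) = ∫ x, F x :=
  L.measurePreserving.integral_comp L.toHomeomorph.measurableEmbedding F

theorem IsTest.comp_isometry {φ : Plane → ℂ} (h : IsTest φ) (L : Plane ≃ₗᵢ[ℝ] Plane) :
    IsTest fun x => φ (L x) :=
  ⟨h.1.comp L.toContinuousLinearEquiv.contDiff, h.2.comp_homeomorph L.toHomeomorph⟩

theorem clm_apply_eq_sum (T : Plane →L[ℝ] ℂ) (v : Plane) :
    T v = ∑ m, (v m : ℂ) * T (EuclideanSpace.single m 1) := by
  conv_lhs => rw [← (EuclideanSpace.basisFun (Fin 2) ℝ).sum_repr v]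
  rw [map_sum]
  refine Finset.sum_congr rfl fun m _ => ?_
  rw [map_smul, Complex.real_smul]
  simp

theorem pd_comp_isometry (L : Plane ≃ₗᵢ[ℝ] Plane) (φ : Plane → ℂ) (j : Fin 2) (x : Plane) :
    pd j (fun y => φ (L y)) x = ∑ m, (L (EuclideanSpace.single j 1) m : ℂ) * pd m φ (L x) := by
  have h := L.toContinuousLinearEquiv.comp_right_fderiv (f := φ) (x := x)
  have h' : fderiv ℝ (fun y => φ (L y)) x = (fderiv ℝ φ (L x)).comp
    (L.toContinuousLinearEquiv : Plane →L[ℝ] Plane) := h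
  rw [pd, h']
  exact clm_apply_eq_sum (fderiv ℝ φ (L x)) (L (EuclideanSpace.single j 1))

theorem pd_conj (φ : Plane → ℂ) (j : Fin 2) (x : Plane) :
    pd j (fun y => conj (φ y)) x = conj (pd j φ x) := by
  have h := Complex.conjCLE.comp_fderiv (f := φ) (x := x)
  have h' : fderiv ℝ (fun y => conj (φ y)) x = (Complex.conjCLE : ℂ →L[ℝ] ℂ).comp (fderiv ℝ φ x) := h
  rw [pd, h']
  rfl

theorem IsTest.conj {φ : Plane → ℂ} (h : IsTest φ) : IsTest fun x => conj (φ x) :=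
  ⟨Complex.conjCLE.contDiff.comp h.1, h.2.comp_left (g := fun z : ℂ => (starRingEnd ℂ) z) (map_zero _)⟩

theorem LocL2.conj {f : Plane → ℂ} (hf : LocL2 f) : LocL2 fun x => conj (f x) := fun S hS =>
  (hf S hS).star

theorem IsWeakGrad.comp_isometry {f : Plane → ℂ} {g : Fin 2 → Plane → ℂ} (h : IsWeakGrad f g)
    (hf : LocL2 f)
    (L : Plane ≃ₗᵢ[ℝ] Plane) : IsWeakGrad (fun x => f (L x)) fun j x =>
      ∑ m, (L (EuclideanSpace.single j 1) m : ℂ) * g m (L x) := by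
  intro j
  have hl : ∀ m, LocL2 fun x => (L (EuclideanSpace.single j 1) m : ℂ) * g m x :=
    fun m => (h m).1.const_mul _
  have hl' : LocL2 fun x => ∑ m, (L (EuclideanSpace.single j 1) m : ℂ) * g m x := by
    simp_rw [Fin.sum_univ_two]
    exact (hl 0).add (hl 1)
  refine ⟨hl'.comp_isometry L, fun φ hφ => ?_⟩
  have hψ := hφ.comp_isometry L.symm
  have e1 : ∫ x, f (L x) * pd j φ x = ∫ y, f y * pd j φ (L.symm y) := by
    have := integral_comp_isometry L fun y => f y * pd j φ (L.symm y)
    simpa only [LinearIsometryEquiv.symm_apply_apply] using this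
  have e2 : ∫ x, (∑ m, (L (EuclideanSpace.single j 1) m : ℂ) * g m (L x)) * φ x =
      ∫ y, (∑ m, (L (EuclideanSpace.single j 1) m : ℂ) * g m y) * φ (L.symm y) := by
    have := integral_comp_isometry L fun y =>
      (∑ m, (L (EuclideanSpace.single j 1) m : ℂ) * g m y) * φ (L.symm y)
    simpa only [LinearIsometryEquiv.symm_apply_apply] using this
  have e3 : ∀ y, pd j φ (L.symm y) = ∑ m, (L (EuclideanSpace.single j 1) m : ℂ) *
      pd m (fun x => φ (L.symm x)) y := by
    intro y
    have := pd_comp_isometry L (fun x => φ (L.symm x)) j (L.symm y)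
    simpa using this
  rw [e1, e2]
  simp_rw [e3, Fin.sum_univ_two]
  rw [integral_add_mul (hl 0) (hl 1) hψ.cc, integral_smul_mul, integral_smul_mul]
  have i : ∀ m, Integrable (fun y => f y * ((L (EuclideanSpace.single j 1) m : ℂ) *
      pd m (fun x => φ (L.symm x)) y)) volume := by
    intro m
    refine ((hf.integrable_mul (hψ.pd m)).const_mul (L (EuclideanSpace.single j 1) m : ℂ)).congr
      (Eventually.of_forall fun y => ?_)
    simp only [mul_left_comm]
  simp_rw [mul_add]
  rw [integral_add (i 0) (i 1)]
  simp_rw [mul_left_comm (f _)]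
  rw [integral_const_mul, integral_const_mul, (h 0).2 _ hψ, (h 1).2 _ hψ]
  ring

theorem IsWeakGrad.conj {f : Plane → ℂ} {g : Fin 2 → Plane → ℂ} (h : IsWeakGrad f g) :
    IsWeakGrad (fun x => conj (f x)) fun j x => conj (g j x) := by
  intro j
  refine ⟨(h j).1.conj, fun φ hφ => ?_⟩
  have := congrArg (starRingEnd ℂ) ((h j).2 _ hφ.conj)
  rw [map_neg, ← integral_conj, ← integral_conj] at this
  simpa only [map_mul, Complex.conj_conj, pd_conj] using this

theorem IsWeakGrad.congr {f f' : Plane → ℂ} {g : Fin 2 → Plane → ℂ} (h : IsWeakGrad f g)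
    (hf : f' =ᵐ[volume] f) : IsWeakGrad f' g := fun j =>
  ⟨(h j).1, fun φ hφ => by rw [integral_congr_mul hf]; exact (h j).2 φ hφ⟩

/-! ### The weak equation in terms of the formal adjoint -/

/-- Hermitian symmetry turns the conjugated operator into the transposed one, which is the operator
that integration by parts puts on a test function paired without conjugation. -/
theorem conj_divForm_conj {A : Plane → Matrix (Fin 2) (Fin 2) ℂ} (hA : IsHoneycombMedium A)
    {φ : Plane → ℂ} (hφ : ContDiff ℝ ∞ φ) (x : Plane) :
    conj (divForm A (fun y => conj (φ y)) x) =
      -∑ i, ∑ j, pd i (fun y => A y j i * pd j φ y) x := by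
  rw [divForm, map_neg, map_sum]
  congr 1
  refine Finset.sum_congr rfl fun i _ => ?_
  rw [← pd_conj]
  have e : ∀ y, conj (∑ j, A y i j * pd j (fun z => conj (φ z)) y) = ∑ j, A y j i * pd j φ y := by
    intro y
    rw [map_sum]
    refine Finset.sum_congr rfl fun j _ => ?_
    rw [map_mul, pd_conj, Complex.conj_conj]
    congr 1
    exact (hA.hermitian y).apply j i
  simp_rw [e]
  have hd : ∀ j, DifferentiableAt ℝ (fun y => A y j i * pd j φ y) x := fun j =>
    ((hA.smooth j i).mul (contDiff_pd hφ j)).differentiable (by simp) x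
  have hs := fderiv_fun_sum (u := Finset.univ) (A := fun j y => A y j i * pd j φ y) fun j _ => hd j
  rw [pd, hs, sum_apply]
  rfl

theorem weakEq_iff_adjoint {A : Plane → Matrix (Fin 2) (Fin 2) ℂ} (hA : IsHoneycombMedium A)
    {f : Plane → ℂ} (hf : LocL2 f) {g : Fin 2 → Plane → ℂ} (hg : IsWeakGrad f g) {φ : Plane → ℂ}
    (hφ : IsTest φ) :
    ∑ i, ∫ x, flux A g i x * pd i φ x =
      ∫ x, f x * conj (divForm A (fun y => conj (φ y)) x) := by
  have ht : ∀ i j, IsTest fun y => A y j i * pd j φ y := fun i j =>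
    ⟨(hA.smooth j i).mul (contDiff_pd hφ.1 j), (hφ.pd j).2.mul_left⟩
  have i1 : ∀ i j, Integrable (fun x => f x * pd i (fun y => A y j i * pd j φ y) x) volume :=
    fun i j => hf.integrable_mul ((ht i j).pd i)
  have i2 : ∀ i j, Integrable (fun x => g i x * (A x j i * pd j φ x)) volume :=
    fun i j => (hg i).1.integrable_mul (ht i j).cc
  simp_rw [conj_divForm_conj hA hφ.1, mul_neg, Finset.mul_sum]
  rw [integral_neg, integral_finsetSum _ fun i _ => integrable_finsetSum _ fun j _ => i1 i j,
    ← Finset.sum_neg_distrib]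
  have e1 : ∀ i, -∫ x, ∑ j, f x * pd i (fun y => A y j i * pd j φ y) x =
      ∑ j, ∫ x, g i x * (A x j i * pd j φ x) := by
    intro i
    rw [integral_finsetSum _ fun j _ => i1 i j, ← Finset.sum_neg_distrib]
    refine Finset.sum_congr rfl fun j _ => ?_
    rw [(hg i).2 _ (ht i j), neg_neg]
  simp_rw [e1]
  rw [Finset.sum_comm]
  refine Finset.sum_congr rfl fun j _ => ?_
  rw [← integral_finsetSum _ fun i _ => i2 i j]
  congr 1
  funext x
  rw [flux, Finset.sum_mul]
  exact Finset.sum_congr rfl fun i _ => by ring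

/-- Here the operator acts only on smooth functions, which is where the commutation with the
symmetries is assumed. The weak gradient remains as a mere existence requirement. -/
theorem isWeakSol_iff {A : Plane → Matrix (Fin 2) (Fin 2) ℂ} (hA : IsHoneycombMedium A) {E : ℝ}
    {f : Plane → ℂ} (hf : LocL2 f) : IsWeakSol A E f ↔ (∃ g, IsWeakGrad f g) ∧
      ∀ φ, IsTest φ → ∫ x, f x * conj (divForm A (fun y => conj (φ y)) x) =
        (E : ℂ) * ∫ x, f x * φ x := by
  constructor
  · rintro ⟨g, hg, -, h⟩
    exact ⟨⟨g, hg⟩, fun φ hφ => by rw [← weakEq_iff_adjoint hA hf hg hφ, h φ hφ]⟩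
  · rintro ⟨⟨g, hg⟩, h⟩
    refine ⟨g, hg, fun i => ?_, fun φ hφ => by rw [weakEq_iff_adjoint hA hf hg hφ, h φ hφ]⟩
    have e : flux A g i = fun x => A x i 0 * g 0 x + A x i 1 * g 1 x := by
      funext x
      rw [flux, Fin.sum_univ_two]
    rw [e]
    exact ((hg 0).1.continuous_mul (hA.smooth i 0).continuous).add
      ((hg 1).1.continuous_mul (hA.smooth i 1).continuous)

/-! ### The symmetry operators on quasi-periodic functions and on eigenspaces. -/

theorem coeFn_opR (f : Fn) : opR f =ᵐ[volume] fun x => f (R.symm x) :=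
  AEEqFun.coeFn_compMeasurePreserving f R.symm.measurePreserving

theorem coeFn_opC (f : Fn) : opC f =ᵐ[volume] fun x => conj (f x) :=
  AEEqFun.coeFn_comp _ _ f

theorem coeFn_opP (f : Fn) : opP f =ᵐ[volume] fun x => f (-x) :=
  AEEqFun.coeFn_compMeasurePreserving f (Measure.measurePreserving_neg volume)

theorem coeFn_opPC (f : Fn) : opPC f =ᵐ[volume] fun x => conj (f (-x)) := by
  refine (coeFn_opP (opC f)).trans ?_
  exact (Measure.measurePreserving_neg (volume : Measure Plane)).quasiMeasurePreserving.ae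
    (coeFn_opC f)

theorem IsQuasi.comp_R_symm {k : Plane} {f : Plane → ℂ} (hf : IsQuasi k f) :
    IsQuasi (R k) fun x => f (R.symm x) := by
  refine ⟨hf.1.comp_isometry R.symm, fun v hv => ?_⟩
  have h := R.symm.measurePreserving.quasiMeasurePreserving.ae (hf.2 _ (R_symm_mem_lattice hv))
  filter_upwards [h] with x hx
  rw [map_add, hx]
  congr 1
  rw [wave, wave, ← LinearIsometryEquiv.inner_map_map R, LinearIsometryEquiv.apply_symm_apply]

theorem IsQuasi.conj {k : Plane} {f : Plane → ℂ} (hf : IsQuasi k f) :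
    IsQuasi (-k) fun x => conj (f x) := by
  refine ⟨hf.1.conj, fun v hv => ?_⟩
  filter_upwards [hf.2 v hv] with x hx
  rw [hx, map_mul, wave_neg_left]

theorem IsQuasi.comp_neg {k : Plane} {f : Plane → ℂ} (hf : IsQuasi k f) :
    IsQuasi (-k) fun x => f (-x) := by
  refine ⟨hf.1.comp_isometry (LinearIsometryEquiv.neg ℝ), fun v hv => ?_⟩
  have h := (Measure.measurePreserving_neg (volume : Measure Plane)).quasiMeasurePreserving.ae
    (hf.2 _ (neg_mem_lattice hv))
  filter_upwards [h] with x hx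
  rw [neg_add, hx, wave_neg_left, wave_neg_right]

theorem IsWeakSol.congr {A : Plane → Matrix (Fin 2) (Fin 2) ℂ} {E : ℝ} {f f' : Plane → ℂ}
    (h : IsWeakSol A E f) (hf : f' =ᵐ[volume] f) : IsWeakSol A E f' := by
  obtain ⟨g, hg, hl, hs⟩ := h
  exact ⟨g, hg.congr hf, hl, fun φ hφ => by rw [integral_congr_mul hf]; exact hs φ hφ⟩

/-- A change of variables moves the rotation onto the test function, where the commutation assumed
for smooth functions applies. The quasi-momentum rotates along with the function. -/
theorem opR_mem_eigenspace {A : Plane → Matrix (Fin 2) (Fin 2) ℂ} (hA : IsHoneycombMedium A)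
    {k : Plane} {E : ℝ} {f : Fn} (hf : f ∈ eigenspace A k E) : opR f ∈ eigenspace A (R k) E := by
  obtain ⟨hq, hs⟩ := hf
  have hq : IsQuasi k f := hq
  refine ⟨hq.comp_R_symm.congr (coeFn_opR f), IsWeakSol.congr ?_ (coeFn_opR f)⟩
  obtain ⟨⟨g, hg⟩, h⟩ := (isWeakSol_iff hA hq.1).1 hs
  refine (isWeakSol_iff hA hq.comp_R_symm.1).2 ⟨⟨_, hg.comp_isometry hq.1 R.symm⟩, fun φ hφ => ?_⟩
  have hψ := hφ.comp_isometry R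
  have hc := hA.comm_R _ hψ.conj.1
  have e := h _ hψ
  rw [← integral_comp_isometry R (fun x => f (R.symm x) * φ x),
    ← integral_comp_isometry R (fun x => f (R.symm x) * _)]
  simp only [LinearIsometryEquiv.symm_apply_apply]
  rw [← e]
  congr 1
  funext y
  have := congrFun hc (R y)
  simp only [LinearIsometryEquiv.symm_apply_apply, LinearIsometryEquiv.apply_symm_apply] at this
  rw [this]

theorem opPC_mem_eigenspace {A : Plane → Matrix (Fin 2) (Fin 2) ℂ} (hA : IsHoneycombMedium A)
    {k : Plane} {E : ℝ} {f : Fn} (hf : f ∈ eigenspace A k E) : opPC f ∈ eigenspace A k E := by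
  obtain ⟨hq, hs⟩ := hf
  have hq : IsQuasi k f := hq
  have hq' : IsQuasi k fun x => conj (f (-x)) := by simpa using hq.comp_neg.conj
  refine ⟨hq'.congr (coeFn_opPC f), IsWeakSol.congr ?_ (coeFn_opPC f)⟩
  obtain ⟨⟨g, hg⟩, h⟩ := (isWeakSol_iff hA hq.1).1 hs
  let N : Plane ≃ₗᵢ[ℝ] Plane := LinearIsometryEquiv.neg ℝ
  refine (isWeakSol_iff hA hq'.1).2 ⟨⟨_, (hg.comp_isometry hq.1 N).conj⟩, fun φ hφ => ?_⟩
  have hψ := hφ.comp_isometry N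
  have hc := hA.comm_PC _ hψ.1
  have e := congrArg (starRingEnd ℂ) (h _ hψ.conj)
  rw [map_mul, Complex.conj_ofReal, ← integral_conj, ← integral_conj] at e
  rw [← integral_comp_isometry N (fun x => conj (f (-x)) * φ x),
    ← integral_comp_isometry N (fun x => conj (f (-x)) * _)]
  have hN : ∀ x, N x = -x := fun x => rfl
  simp only [map_mul, Complex.conj_conj, hN, neg_neg] at e hc ⊢
  rw [← e]
  congr 1
  funext y
  have := congrFun hc (-y)
  rw [this, neg_neg, Complex.conj_conj]

/-! ### Invariance of the inner product -/

/-- The preimage of the cell under a lattice-preserving isometry is another fundamental domain, and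
a periodic function has the same integral over both. As `F` is periodic only almost everywhere, it
is first replaced by `F ∘ reduce`, which is exactly periodic. -/
theorem integral_cell_comp_isometry (L : Plane ≃ₗᵢ[ℝ] Plane) (hL : ∀ v ∈ lattice, L v ∈ lattice)
    (hL' : ∀ v ∈ lattice, L.symm v ∈ lattice) {F : Plane → ℂ}
    (hF : ∀ v ∈ lattice, ∀ᵐ x ∂(volume : Measure Plane), F (x + v) = F x) :
    ∫ x in cell, F (L x) = ∫ x in cell, F x := by
  have h1 : (fun x => F (reduce x)) =ᵐ[volume] F := by
    have := IsQuasi.ae_reduce (k := 0) (f := F) fun v hv => by simpa [wave] using hF v hv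
    filter_upwards [this] with x hx
    simpa [wave] using hx
  have h2 : (fun x => F (reduce (L x))) =ᵐ[volume] fun x => F (L x) :=
    L.measurePreserving.quasiMeasurePreserving.ae h1
  rw [← integral_congr_ae (ae_restrict_of_ae h1), ← integral_congr_ae (ae_restrict_of_ae h2),
    ← restrict_halfCell]
  have hD := ZSpan.isAddFundamentalDomain' latticeBasis (volume : Measure Plane)
  have hD' : IsAddFundamentalDomain (Submodule.span ℤ (Set.range latticeBasis)).toAddSubgroup
      (L ⁻¹' halfCell) (volume : Measure Plane) := by
    refine IsAddFundamentalDomain.mk' (hD.nullMeasurableSet.preimage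
      L.measurePreserving.quasiMeasurePreserving) fun x => ?_
    refine ⟨⟨-L.symm (latticeVec (latticeFloor (L x))), mem_span_latticeBasis.2
      (neg_mem_lattice (hL' _ (latticeVec_mem _)))⟩, ?_, ?_⟩
    · show L (-L.symm (latticeVec (latticeFloor (L x))) + x) ∈ halfCell
      rw [map_add, map_neg, L.apply_symm_apply, neg_add_eq_sub]
      exact reduce_mem_halfCell (L x)
    · rintro ⟨g, hg⟩ hgx
      have hgx : L (g + x) ∈ halfCell := hgx
      have hg' : g ∈ lattice := mem_span_latticeBasis.1 hg
      apply Subtype.ext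
      show g = -L.symm (latticeVec (latticeFloor (L x)))
      have e := reduce_of_mem hgx
      rw [add_comm g x, map_add, reduce_add (hL g hg'), reduce] at e
      apply L.injective
      rw [map_neg, L.apply_symm_apply]
      rw [sub_eq_add_neg, add_right_inj] at e
      exact e.symm
  have hcount : Countable (Submodule.span ℤ (Set.range latticeBasis)).toAddSubgroup :=
    inferInstanceAs (Countable (Submodule.span ℤ (Set.range latticeBasis)))
  have h3 : ∫ x in halfCell, F (reduce (L x)) = ∫ x in L ⁻¹' halfCell, F (reduce (L x)) := by
    refine hD.setIntegral_eq hD' fun g x => ?_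
    show F (reduce (L ((g : Plane) + x))) = _
    rw [add_comm, map_add, reduce_add (hL _ (mem_span_latticeBasis.1 g.2))]
  rw [h3]
  exact L.measurePreserving.setIntegral_preimage_emb L.toHomeomorph.measurableEmbedding
    (fun x => F (reduce x)) halfCell

theorem IsQuasi.ae_conj_mul {k : Plane} {f g : Plane → ℂ} (hf : IsQuasi k f) (hg : IsQuasi k g)
    (v : Plane) (hv : v ∈ lattice) :
    ∀ᵐ x ∂(volume : Measure Plane), conj (f (x + v)) * g (x + v) = conj (f x) * g x := by
  filter_upwards [hf.2 v hv, hg.2 v hv] with x h1 h2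
  rw [h1, h2, map_mul]
  linear_combination conj (f x) * g x * conj_wave_mul_wave k v

theorem ip_comp_R_symm {k : Plane} {f g : Plane → ℂ} (hf : IsQuasi k f) (hg : IsQuasi k g) :
    ip (fun x => f (R.symm x)) (fun x => g (R.symm x)) = ip f g :=
  integral_cell_comp_isometry R.symm (fun _ => R_symm_mem_lattice) (fun _ => R_mem_lattice)
    (F := fun x => conj (f x) * g x) (hf.ae_conj_mul hg)

theorem ip_conj_comp_neg {k : Plane} {f g : Plane → ℂ} (hf : IsQuasi k f) (hg : IsQuasi k g) :
    ip (fun x => conj (f (-x))) (fun x => conj (g (-x))) = conj (ip f g) := by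
  have := integral_cell_comp_isometry (LinearIsometryEquiv.neg ℝ) (fun _ => neg_mem_lattice)
    (fun _ => neg_mem_lattice) (F := fun x => conj (f x) * g x) (hf.ae_conj_mul hg)
  rw [ip, ip, ← this, ← integral_conj]
  simp

theorem ip_congr {f f' g g' : Plane → ℂ} (hf : f =ᵐ[volume] f') (hg : g =ᵐ[volume] g') :
    ip f g = ip f' g' := by
  refine integral_congr_ae (ae_restrict_of_ae ?_)
  filter_upwards [hf, hg] with x h1 h2
  rw [h1, h2]

/-! ### Rotation of the coefficients -/

section Coefficients

variable {A : Plane → Matrix (Fin 2) (Fin 2) ℂ}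

/-- The linear function `x ↦ a · x`. -/
def linFn (a x : Plane) : ℂ := ((inner ℝ a x : ℝ) : ℂ)

theorem contDiff_linFn (a : Plane) : ContDiff ℝ ∞ (linFn a) :=
  Complex.ofRealCLM.contDiff.comp (innerSL ℝ a).contDiff

theorem pd_linFn (a : Plane) (j : Fin 2) (x : Plane) : pd j (linFn a) x = a j := by
  have h : HasFDerivAt (linFn a) (Complex.ofRealCLM.comp (innerSL ℝ a)) x :=
    Complex.ofRealCLM.hasFDerivAt.comp x (innerSL ℝ a).hasFDerivAt
  rw [pd, h.fderiv]
  simp only [ContinuousLinearMap.comp_apply, innerSL_apply_apply, inner_single_one,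
    Complex.ofRealCLM_apply]

theorem linFn_R_symm (a x : Plane) : linFn a (R.symm x) = linFn (R a) x := by
  rw [linFn, linFn, ← LinearIsometryEquiv.inner_map_map R, LinearIsometryEquiv.apply_symm_apply]

/-- The divergence of the columns of `A`. -/
def divCoef (A : Plane → Matrix (Fin 2) (Fin 2) ℂ) (j : Fin 2) (x : Plane) : ℂ :=
  ∑ i, pd i (fun y => A y i j) x

theorem pd_add {f g : Plane → ℂ} {x : Plane} (hf : DifferentiableAt ℝ f x)
    (hg : DifferentiableAt ℝ g x) (j : Fin 2) :
    pd j (fun y => f y + g y) x = pd j f x + pd j g x := by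
  rw [pd, fderiv_fun_add hf hg]
  rfl

theorem pd_mul_const {f : Plane → ℂ} {x : Plane} (hf : DifferentiableAt ℝ f x) (c : ℂ)
    (j : Fin 2) : pd j (fun y => f y * c) x = pd j f x * c := by
  rw [pd_mul hf (differentiableAt_const c)]
  simp [pd]

theorem divForm_linFn (hA : IsHoneycombMedium A) (a x : Plane) :
    divForm A (linFn a) x = -∑ j, (a j : ℂ) * divCoef A j x := by
  have hd : ∀ i j, DifferentiableAt ℝ (fun y => A y i j) x := fun i j =>
    (hA.smooth i j).differentiable (by simp) x
  have hd' : ∀ i j, DifferentiableAt ℝ (fun y => A y i j * (a j : ℂ)) x := fun i j =>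
    (hd i j).mul_const _
  simp only [divForm, pd_linFn, divCoef, Fin.sum_univ_two]
  rw [pd_add (hd' 0 0) (hd' 0 1), pd_add (hd' 1 0) (hd' 1 1)]
  simp only [pd_mul_const (hd _ _)]
  ring

theorem divForm_linFn_mul (hA : IsHoneycombMedium A) (a b x : Plane) :
    divForm A (fun y => linFn a y * linFn b y) x =
      -(linFn a x * ∑ j, (b j : ℂ) * divCoef A j x + linFn b x * ∑ j, (a j : ℂ) * divCoef A j x +
        ∑ i, ∑ j, (A x i j + A x j i) * (a i * b j)) := by
  have hd : ∀ i j, DifferentiableAt ℝ (fun y => A y i j) x := fun i j =>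
    (hA.smooth i j).differentiable (by simp) x
  have hl : ∀ a : Plane, Differentiable ℝ (linFn a) := fun a =>
    (contDiff_linFn a).differentiable (by simp)
  have e : ∀ j y, pd j (fun y => linFn a y * linFn b y) y = linFn a y * b j + linFn b y * a j := by
    intro j y
    rw [pd_mul (hl a y) (hl b y), pd_linFn, pd_linFn]; ring
  have hm : ∀ j, DifferentiableAt ℝ (fun y => linFn a y * (b j : ℂ) + linFn b y * a j) x := fun j =>
    ((hl a x).mul_const _).add ((hl b x).mul_const _)
  have hd' : ∀ i j, DifferentiableAt ℝ
      (fun y => A y i j * (linFn a y * (b j : ℂ) + linFn b y * a j)) x := fun i j =>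
    (hd i j).mul (hm j)
  simp only [divForm, e, divCoef, Fin.sum_univ_two]
  rw [pd_add (hd' 0 0) (hd' 0 1), pd_add (hd' 1 0) (hd' 1 1)]
  have e2 : ∀ i j, pd i (fun y => A y i j * (linFn a y * (b j : ℂ) + linFn b y * a j)) x =
      A x i j * (a i * b j + b i * a j) +
        pd i (fun y => A y i j) x * (linFn a x * b j + linFn b x * a j) := by
    intro i j
    rw [pd_mul (hd i j) (hm j), pd_add ((hl a x).mul_const _) ((hl b x).mul_const _),
      pd_mul_const (hl a x), pd_mul_const (hl b x), pd_linFn, pd_linFn]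
  simp only [e2]
  ring

/-- Commutation evaluated on a linear function, where only the divergence of the coefficients
survives. -/
theorem divCoef_rotation (hA : IsHoneycombMedium A) (a x : Plane) :
    ∑ j, (R a j : ℂ) * divCoef A j x = ∑ j, (a j : ℂ) * divCoef A j (R.symm x) := by
  have h := congrFun (hA.comm_R _ (contDiff_linFn a)) x
  simp only [linFn_R_symm] at h
  have e : (fun y => linFn (R a) y) = linFn (R a) := rfl
  rw [e, divForm_linFn hA, divForm_linFn hA, neg_inj] at h
  exact h

/-- Commutation evaluated on a product of two linear functions. The divergence terms cancel by the
linear case and leave the symmetrized coefficients. The antisymmetric part of `A` acts only through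
its divergence, so no pointwise law for it is available or needed. -/
theorem symCoef_rotation (hA : IsHoneycombMedium A) (a b x : Plane) :
    ∑ i, ∑ j, (A x i j + A x j i) * ((R a i : ℂ) * R b j) =
      ∑ i, ∑ j, (A (R.symm x) i j + A (R.symm x) j i) * ((a i : ℂ) * b j) := by
  have h := congrFun (hA.comm_R _ ((contDiff_linFn a).mul (contDiff_linFn b))) x
  simp only [linFn_R_symm] at h
  rw [divForm_linFn_mul hA, divForm_linFn_mul hA, linFn_R_symm, linFn_R_symm,
    divCoef_rotation hA, divCoef_rotation hA, neg_inj, add_right_inj] at h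
  exact h

/-! ### Rotation of the velocities -/

/-- The product rule regroups `𝒜` into the two quantities with known rotation laws, `A + Aᵀ` and the
divergence. Uniqueness of weak gradients also frees the formula from the choice made in `weakGrad`.
-/
theorem opA_ae_eq {f : Plane → ℂ} {g : Fin 2 → Plane → ℂ} (hg : IsWeakGrad f g) (j : Fin 2) :
    opA A f j =ᵐ[volume] fun x =>
      -I * (∑ l, (A x j l + A x l j) * g l x + divCoef A j x * f x) := by
  have hs := weakGrad_spec ⟨g, hg⟩
  filter_upwards [hs.ae_eq hg 0, hs.ae_eq hg 1] with x h0 h1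
  simp only [opA, divCoef, Fin.sum_univ_two, h0, h1, one_div, Complex.inv_I]
  ring

theorem opA_congr {f f' : Plane → ℂ} {g : Fin 2 → Plane → ℂ} (hg : IsWeakGrad f g)
    (h : f' =ᵐ[volume] f) (j : Fin 2) : opA A f' j =ᵐ[volume] opA A f j := by
  filter_upwards [opA_ae_eq (A := A) hg j, opA_ae_eq (A := A) (hg.congr h) j, h] with x h1 h2 h3
  rw [h1, h2, h3]

theorem IsWeakGrad.const_mul {f : Plane → ℂ} {g : Fin 2 → Plane → ℂ} (hg : IsWeakGrad f g) (c : ℂ) :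
    IsWeakGrad (fun x => c * f x) fun j x => c * g j x := fun j =>
  ⟨(hg j).1.const_mul c, fun φ hφ => by
    rw [integral_smul_mul, integral_smul_mul, (hg j).2 φ hφ, mul_neg]⟩

theorem opA_const_mul {f : Plane → ℂ} {g : Fin 2 → Plane → ℂ} (hg : IsWeakGrad f g) (c : ℂ)
    (j : Fin 2) : opA A (fun x => c * f x) j =ᵐ[volume] fun x => c * opA A f j x := by
  filter_upwards [opA_ae_eq (A := A) hg j, opA_ae_eq (A := A) (hg.const_mul c) j] with x h1 h2
  rw [h1, h2]
  simp only [Fin.sum_univ_two]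
  ring

theorem opA_rotation (hA : IsHoneycombMedium A) {f : Plane → ℂ} (hf : LocL2 f)
    {g : Fin 2 → Plane → ℂ} (hg : IsWeakGrad f g) (k : Fin 2) :
    (fun x => opA A f k (R.symm x)) =ᵐ[volume] fun x =>
      ∑ l, (R (EuclideanSpace.single k 1) l : ℂ) * opA A (fun y => f (R.symm y)) l x := by
  have h0 := R.symm.measurePreserving.quasiMeasurePreserving.ae (opA_ae_eq (A := A) hg k)
  have hr := hg.comp_isometry hf R.symm
  filter_upwards [h0, opA_ae_eq (A := A) hr 0, opA_ae_eq (A := A) hr 1] with x h1 h2 h3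
  have hD := divCoef_rotation hA (EuclideanSpace.single k 1) x
  have hS := fun m => symCoef_rotation hA (EuclideanSpace.single k 1) (EuclideanSpace.single m 1) x
  have hS0 := hS 0
  have hS1 := hS 1
  rw [h1]
  simp only [Fin.sum_univ_two, h2, h3]
  fin_cases k <;>
  · simp [Fin.sum_univ_two, R_apply_zero, R_apply_one, R_symm_apply_zero, R_symm_apply_one]
      at hD hS0 hS1 ⊢
    linear_combination I * hD * f (R.symm x) + I * hS0 * g 0 (R.symm x) + I * hS1 * g 1 (R.symm x)

theorem isQuasi_opA (hA : IsHoneycombMedium A) {k : Plane} {f : Plane → ℂ}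
    {g : Fin 2 → Plane → ℂ} (hf : IsQuasi k f) (hg : IsWeakGrad f g) (j : Fin 2) :
    IsQuasi k (opA A f j) := by
  have hq := fun l => hg.isQuasi hf l
  have h1 : ∀ l, IsQuasi k fun x => A x j l * g l x + A x l j * g l x + pd l (fun y => A y l j) x * f x :=
    fun l => ((isQuasi_coef hA (hq l) j l).add (isQuasi_coef hA (hq l) l j)).add
      (isQuasi_pd_coef hA hf l l j)
  refine (((h1 0).add (h1 1)).const_mul (-I)).congr ?_
  filter_upwards [opA_ae_eq (A := A) hg j] with x hx
  rw [hx]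
  simp only [divCoef, Fin.sum_univ_two]
  ring

theorem ip_const_mul_right (f g : Plane → ℂ) (c : ℂ) : ip f (fun x => c * g x) = c * ip f g := by
  rw [ip, ip, ← integral_const_mul]
  congr 1
  funext x
  ring

theorem ip_const_mul_left (f g : Plane → ℂ) (c : ℂ) :
    ip (fun x => c * f x) g = conj c * ip f g := by
  rw [ip, ip, ← integral_const_mul]
  congr 1
  funext x
  rw [map_mul]
  ring

theorem ip_add_right {k : Plane} {f g h : Plane → ℂ} (hf : IsQuasi k f) (hg : IsQuasi k g)
    (hh : IsQuasi k h) : ip f (fun x => g x + h x) = ip f g + ip f h := by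
  rw [← inner_toCell hf (hg.add hh), toCell_add hg hh, inner_add_right, inner_toCell, inner_toCell]

/-- Rotating both arguments leaves the inner product unchanged, while `𝒜` transforms as a vector and
the two functions contribute the scalars `conj s` and `t`. The matrix elements thus satisfy an
eigenvector equation for the rotation. -/
theorem ip_opA_rotation (hA : IsHoneycombMedium A) {k : Plane} {f g : Fn} {s t : ℂ}
    (hf : IsQuasi k f) (hg : IsQuasi k g) (hfs : opR f = s • f) (hgt : opR g = t • g)
    {G : Fin 2 → Plane → ℂ} (hG : IsWeakGrad g G) (j : Fin 2) :
    ip f (opA A g j) = conj s * t *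
      ∑ l, (R (EuclideanSpace.single j 1) l : ℂ) * ip f (opA A g l) := by
  have hq := fun l => isQuasi_opA hA hg hG l
  have e1 : (fun x => f (R.symm x)) =ᵐ[volume] fun x => s * f x :=
    (coeFn_opR f).symm.trans (hfs ▸ coeFn_smul' s f)
  have e2 : (fun x => g (R.symm x)) =ᵐ[volume] fun x => t * g x :=
    (coeFn_opR g).symm.trans (hgt ▸ coeFn_smul' t g)
  have e3 : (fun x => opA A g j (R.symm x)) =ᵐ[volume] fun x =>
      t * ((R (EuclideanSpace.single j 1) 0 : ℂ) * opA A g 0 x +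
        (R (EuclideanSpace.single j 1) 1 : ℂ) * opA A g 1 x) := by
    filter_upwards [opA_rotation hA hg.1 hG j, opA_congr (A := A) (hG.const_mul t) e2 0,
      opA_congr (A := A) (hG.const_mul t) e2 1, opA_const_mul (A := A) hG t 0,
      opA_const_mul (A := A) hG t 1] with x h1 h2 h3 h4 h5
    rw [h1, Fin.sum_univ_two, h2, h3, h4, h5]
    ring
  rw [← ip_comp_R_symm hf (hq j), ip_congr e1 e3, ip_const_mul_left, ip_const_mul_right,
    ip_add_right hf ((hq 0).const_mul _) ((hq 1).const_mul _), ip_const_mul_right,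
    ip_const_mul_right, Fin.sum_univ_two]
  ring

end Coefficients

/-! ### The cube root of unity and vectors equivariant under the rotation. -/

theorem τ_eq : τ = -(1 / 2) + (√3 / 2 : ℝ) * I := by
  have h : τ = Complex.exp (((2 * Real.pi / 3 : ℝ) : ℂ) * I) := by
    rw [τ]; congr 1; push_cast; ring
  have hc : Real.cos (2 * Real.pi / 3) = -(1 / 2) := by
    rw [show 2 * Real.pi / 3 = Real.pi - Real.pi / 3 by ring, Real.cos_pi_sub, Real.cos_pi_div_three]
  have hs : Real.sin (2 * Real.pi / 3) = √3 / 2 := by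
    rw [show 2 * Real.pi / 3 = Real.pi - Real.pi / 3 by ring, Real.sin_pi_sub, Real.sin_pi_div_three]
  rw [h, Complex.exp_mul_I, ← Complex.ofReal_cos, ← Complex.ofReal_sin, hc, hs]
  push_cast
  ring

theorem sqrt_three_sq_complex : ((√3 : ℝ) : ℂ) * ((√3 : ℝ) : ℂ) = 3 := by
  rw [← Complex.ofReal_mul, sqrt_three_sq]; norm_num

theorem conj_τ_eq : conj τ = -(1 / 2) - (√3 / 2 : ℝ) * I := by
  rw [τ_eq]
  simp only [map_add, map_mul, map_neg, Complex.conj_ofReal, Complex.conj_I, map_div₀, map_one,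
    map_ofNat]
  ring

theorem conj_τ_mul_τ : conj τ * τ = 1 := by
  rw [conj_τ_eq, τ_eq]
  push_cast
  linear_combination (-3 / 4 : ℂ) * I_sq - (1 / 4) * I ^ 2 * sqrt_three_sq_complex

theorem conj_τ_sq : conj τ * conj τ = τ := by
  rw [conj_τ_eq, τ_eq]
  push_cast
  linear_combination (3 / 4 : ℂ) * I_sq + (1 / 4) * I ^ 2 * sqrt_three_sq_complex

theorem τ_sq : τ * τ = conj τ := by
  rw [conj_τ_eq, τ_eq]
  push_cast
  linear_combination (3 / 4 : ℂ) * I_sq + (1 / 4) * I ^ 2 * sqrt_three_sq_complex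

theorem one_add_τ : 1 + τ + conj τ = 0 := by
  rw [conj_τ_eq, τ_eq]; ring

theorem τ_ne_one : τ ≠ 1 := by
  intro h
  have := congrArg Complex.re h
  rw [τ_eq] at this
  simp at this
  norm_num at this

/-- A vector that is invariant under the rotation vanishes. -/
theorem eq_zero_of_rotation {h : Fin 2 → ℂ}
    (hr : ∀ j, h j = ∑ l, (R (EuclideanSpace.single j 1) l : ℂ) * h l) (j : Fin 2) : h j = 0 := by
  have h0 := hr 0
  have h1 := hr 1
  simp [Fin.sum_univ_two, R_apply_zero, R_apply_one] at h0 h1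
  have e1 : 3 * h 0 = 0 := by
    linear_combination (3 / 2) * h0 - (√3 / 2 : ℂ) * h1 - (1 / 4) * h 0 * sqrt_three_sq_complex
  have e2 : 3 * h 1 = 0 := by
    linear_combination (3 / 2) * h1 + (√3 / 2 : ℂ) * h0 - (1 / 4) * h 1 * sqrt_three_sq_complex
  have h3 : (3 : ℂ) ≠ 0 := by norm_num
  fin_cases j
  · exact (mul_eq_zero.1 e1).resolve_left h3
  · exact (mul_eq_zero.1 e2).resolve_left h3

/-- The solutions form the eigenline of the rotation spanned by `(1, i)`. The first component
suffices: after multiplication by `conj τ` it is linear in `h 0` and `h 1`. -/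
theorem eq_I_mul_of_rotation {h : Fin 2 → ℂ}
    (hr : ∀ j, h j = τ * ∑ l, (R (EuclideanSpace.single j 1) l : ℂ) * h l) : h 1 = I * h 0 := by
  have h0 := hr 0
  simp [Fin.sum_univ_two, R_apply_zero, R_apply_one] at h0
  have hs : ((√3 : ℝ) : ℂ) ≠ 0 := by
    exact_mod_cast sqrt_three_ne_zero
  have e := congrArg (fun z => conj τ * z) h0
  simp only [← mul_assoc] at e
  rw [conj_τ_mul_τ, conj_τ_eq] at e
  push_cast at e
  have e3 : (√3 : ℂ) * (h 1 - I * h 0) = 0 := by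
    linear_combination 2 * e
  exact sub_eq_zero.1 ((mul_eq_zero.1 e3).resolve_left hs)

/-! ### The vertices of the Brillouin zone -/

theorem norm_sq_dualVec (n : Fin 2 → ℤ) :
    ‖dualVec n‖ ^ 2 = 16 * Real.pi ^ 2 / 3 * ((n 0 : ℝ) ^ 2 - n 0 * n 1 + (n 1 : ℝ) ^ 2) := by
  rw [norm_sq_plane, dualVec_apply_zero, dualVec_apply_one, mul_pow, div_pow,
    Real.sq_sqrt (by norm_num)]
  ring

theorem mem_brillouinZone_iff_forall {k : Plane} : k ∈ brillouinZone ↔ ∀ n : Fin 2 → ℤ,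
    (n 0 : ℝ) * coord k 0 + n 1 * coord k 1 ≤
      4 * Real.pi / 3 * ((n 0 : ℝ) ^ 2 - n 0 * n 1 + (n 1 : ℝ) ^ 2) := by
  have key : ∀ n : Fin 2 → ℤ, ‖k‖ ≤ ‖k - dualVec n‖ ↔
      (n 0 : ℝ) * coord k 0 + n 1 * coord k 1 ≤
      4 * Real.pi / 3 * ((n 0 : ℝ) ^ 2 - n 0 * n 1 + (n 1 : ℝ) ^ 2) := by
    intro n
    rw [← sq_le_sq₀ (norm_nonneg _) (norm_nonneg _), norm_sub_sq_real, norm_sq_dualVec,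
      real_inner_comm, inner_dualVec]
    have hpi := Real.pi_pos
    constructor
    · intro h
      have h2 : Real.pi * ((n 0 : ℝ) * coord k 0 + n 1 * coord k 1) ≤
          Real.pi * (4 * Real.pi / 3 * ((n 0 : ℝ) ^ 2 - n 0 * n 1 + (n 1 : ℝ) ^ 2)) := by
        nlinarith
      exact le_of_mul_le_mul_left h2 hpi
    · intro h
      have h2 := mul_le_mul_of_nonneg_left h hpi.le
      nlinarith
  constructor
  · intro h n
    exact (key n).1 (h _ ⟨n 0, n 1, rfl⟩)
  · rintro h g ⟨m, n, rfl⟩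
    exact (key ![m, n]).2 (h ![m, n])

/-- Integrality is essential: over the reals the inequality fails at `m = 1`, `n = 1/2`. For
integers the strict reverse inequality has a gap of one, which completing squares contradicts. -/
theorem int_le_quadratic (m n : ℤ) : m ≤ m ^ 2 - m * n + n ^ 2 := by
  by_contra! h
  nlinarith [sq_nonneg (2 * n - m), sq_nonneg (3 * m - 2)]

/-- A linear form on the hexagon is largest at one of the vertices `±(1, 0)`, `±(0, 1)`, `±(1, -1)`,
where `m s + n t` takes the values bounded by `q1` to `q6`. -/
theorem hexagon_le (m n : ℤ) {s t : ℝ} (hs : |s| ≤ 1) (ht : |t| ≤ 1) (hst : |s + t| ≤ 1) :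
    m * s + n * t ≤ (m : ℝ) ^ 2 - m * n + (n : ℝ) ^ 2 := by
  have q1 : (m : ℝ) ≤ (m : ℝ) ^ 2 - m * n + (n : ℝ) ^ 2 := by exact_mod_cast int_le_quadratic m n
  have q2 : (n : ℝ) ≤ (m : ℝ) ^ 2 - m * n + (n : ℝ) ^ 2 := by
    have := int_le_quadratic n m
    have h : n ≤ m ^ 2 - m * n + n ^ 2 := by linarith
    exact_mod_cast h
  have q3 : -(m : ℝ) ≤ (m : ℝ) ^ 2 - m * n + (n : ℝ) ^ 2 := by
    have := int_le_quadratic (-m) (-n)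
    have h : -m ≤ m ^ 2 - m * n + n ^ 2 := by linarith
    exact_mod_cast h
  have q4 : -(n : ℝ) ≤ (m : ℝ) ^ 2 - m * n + (n : ℝ) ^ 2 := by
    have := int_le_quadratic (-n) (-m)
    have h : -n ≤ m ^ 2 - m * n + n ^ 2 := by linarith
    exact_mod_cast h
  have q5 : (m - n : ℝ) ≤ (m : ℝ) ^ 2 - m * n + (n : ℝ) ^ 2 := by
    have := int_le_quadratic (m - n) (-n)
    have h : m - n ≤ m ^ 2 - m * n + n ^ 2 := by linarith
    exact_mod_cast h
  have q6 : (n - m : ℝ) ≤ (m : ℝ) ^ 2 - m * n + (n : ℝ) ^ 2 := by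
    have := int_le_quadratic (n - m) (-m)
    have h : n - m ≤ m ^ 2 - m * n + n ^ 2 := by linarith
    exact_mod_cast h
  rw [abs_le] at hs ht hst
  rcases le_total 0 (m : ℝ) with hm | hm <;> rcases le_total 0 (n : ℝ) with hn | hn <;>
    rcases le_total (m : ℝ) n with hmn | hmn <;>
    nlinarith [mul_le_mul_of_nonneg_left hs.1 (abs_nonneg (m : ℝ))]

/-- The six shortest dual vectors already cut out the hexagon; `hexagon_le` shows that all others
impose nothing more. -/
theorem mem_brillouinZone_iff {k : Plane} : k ∈ brillouinZone ↔
    |coord k 0| ≤ 4 * Real.pi / 3 ∧ |coord k 1| ≤ 4 * Real.pi / 3 ∧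
      |coord k 0 + coord k 1| ≤ 4 * Real.pi / 3 := by
  rw [mem_brillouinZone_iff_forall]
  constructor
  · intro h
    have h1 := h ![1, 0]
    have h2 := h ![-1, 0]
    have h3 := h ![0, 1]
    have h4 := h ![0, -1]
    have h5 := h ![1, 1]
    have h6 := h ![-1, -1]
    simp at h1 h2 h3 h4 h5 h6
    simp only [abs_le]
    refine ⟨⟨?_, ?_⟩, ⟨?_, ?_⟩, ⟨?_, ?_⟩⟩ <;> linarith
  · rintro ⟨h0, h1, h2⟩ n
    set d := 4 * Real.pi / 3 with hd
    have hd0 : 0 < d := by positivity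
    have e : ∀ x : ℝ, |x| ≤ d → |x / d| ≤ 1 := fun x hx => by
      rw [abs_div, abs_of_pos hd0, div_le_one hd0]; exact hx
    have h3 : |coord k 0 / d + coord k 1 / d| ≤ 1 := by
      rw [← add_div]; exact e _ h2
    have h4 := mul_le_mul_of_nonneg_left (hexagon_le (n 0) (n 1) (e _ h0) (e _ h1) h3) hd0.le
    refine le_trans (le_of_eq ?_) h4
    field_simp

/-- A vertex is moved by the rotation within its class modulo the dual lattice. -/
theorem R_sub_mem_dualLattice {K : Plane} (hK : K ∈ brillouinVertices) : R K - K ∈ dualLattice := by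
  obtain ⟨hZ, hext⟩ := mem_extremePoints.1 hK
  set d := 4 * Real.pi / 3 with hd
  have hd0 : 0 < d := by positivity
  have hZ' := mem_brillouinZone_iff.1 hZ
  -- An extreme point is not the midpoint of a non-trivial segment inside the hexagon, whatever its
  -- direction `(p, q)` in lattice coordinates.
  have move : ∀ p q : ℝ, (p, q) ≠ 0 → ¬ (∃ ε > 0, ∀ e : ℝ, |e| ≤ ε →
      |coord K 0 + e * p| ≤ d ∧ |coord K 1 + e * q| ≤ d ∧
        |coord K 0 + coord K 1 + e * (p + q)| ≤ d) := by
    rintro p q hpq ⟨ε, hε, h⟩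
    let u : Plane := coord.symm ![ε * p, ε * q]
    have hu0 : coord u 0 = ε * p := by simp [u]
    have hu1 : coord u 1 = ε * q := by simp [u]
    have hp := h ε (abs_of_pos hε).le
    have hm := h (-ε) (by rw [abs_neg]; exact (abs_of_pos hε).le)
    have m1 : K + u ∈ brillouinZone := by
      rw [mem_brillouinZone_iff, map_add, Pi.add_apply, Pi.add_apply, hu0, hu1]
      refine ⟨hp.1, hp.2.1, ?_⟩
      convert hp.2.2 using 2
      ring
    have m2 : K - u ∈ brillouinZone := by
      rw [mem_brillouinZone_iff, map_sub, Pi.sub_apply, Pi.sub_apply, hu0, hu1]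
      refine ⟨?_, ?_, ?_⟩
      · convert hm.1 using 2
        ring
      · convert hm.2.1 using 2
        ring
      · convert hm.2.2 using 2
        ring
    have := (hext _ m1 _ m2 ⟨1 / 2, 1 / 2, by norm_num, by norm_num, by norm_num, by module⟩).1
    have hu : u = 0 := by simpa using this
    apply hpq
    rw [hu, map_zero] at hu0 hu1
    have e0 : p = 0 := by
      rcases mul_eq_zero.1 hu0.symm with h' | h'
      · exact absurd h' hε.ne'
      · exact h'
    have e1 : q = 0 := by
      rcases mul_eq_zero.1 hu1.symm with h' | h'
      · exact absurd h' hε.ne'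
      · exact h'
    rw [e0, e1]; rfl
  have room : ∀ x y : ℝ, |x| < d → |y| < d → ∃ ε > 0, ∀ e : ℝ, |e| ≤ ε →
      |x + e| ≤ d ∧ |x - e| ≤ d ∧ |y + e| ≤ d ∧ |y - e| ≤ d := by
    intro x y hx hy
    refine ⟨min (d - |x|) (d - |y|), lt_min (by linarith) (by linarith), fun e he => ?_⟩
    have h1 := he.trans (min_le_left _ _)
    have h2 := he.trans (min_le_right _ _)
    refine ⟨?_, ?_, ?_, ?_⟩
    · linarith [abs_add_le x e]
    · linarith [abs_sub x e]
    · linarith [abs_add_le y e]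
    · linarith [abs_sub y e]
  -- Of any two of the three constraints one is active. Otherwise the point could move along the
  -- direction that keeps the third quantity fixed: `(0, 1)`, `(1, 0)` or `(1, -1)`. Thus at least
  -- two constraints are active.
  have c1 : |coord K 1| = d ∨ |coord K 0 + coord K 1| = d := by
    by_contra! hc
    obtain ⟨ε, hε, h⟩ := room _ _ (lt_of_le_of_ne hZ'.2.1 hc.1) (lt_of_le_of_ne hZ'.2.2 hc.2)
    refine move 0 1 (by simp) ⟨ε, hε, fun e he => ?_⟩
    have := h e he
    exact ⟨by simpa using hZ'.1, by simpa using this.1, by simpa using this.2.2.1⟩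
  have c2 : |coord K 0| = d ∨ |coord K 0 + coord K 1| = d := by
    by_contra! hc
    obtain ⟨ε, hε, h⟩ := room _ _ (lt_of_le_of_ne hZ'.1 hc.1) (lt_of_le_of_ne hZ'.2.2 hc.2)
    refine move 1 0 (by simp) ⟨ε, hε, fun e he => ?_⟩
    have := h e he
    exact ⟨by simpa using this.1, by simpa using hZ'.2.1, by simpa using this.2.2.1⟩
  have c3 : |coord K 0| = d ∨ |coord K 1| = d := by
    by_contra! hc
    obtain ⟨ε, hε, h⟩ := room _ _ (lt_of_le_of_ne hZ'.1 hc.1) (lt_of_le_of_ne hZ'.2.1 hc.2)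
    refine move 1 (-1) (by simp) ⟨ε, hε, fun e he => ?_⟩
    have := h e he
    exact ⟨by simpa using this.1, by simpa [sub_eq_add_neg] using this.2.2.2,
      by simpa using hZ'.2.2⟩
  -- Two active constraints make both coordinates integer multiples of `d = 4π/3`; the displacement
  -- `R K - K` can then be read off as a dual lattice vector.
  have hint : ∃ m n : ℤ, coord K 0 = m * d ∧ coord K 1 = n * d := by
    have sgn : ∀ x : ℝ, |x| = d → ∃ m : ℤ, x = m * d := by
      intro x hx
      rcases (abs_eq hd0.le).1 hx with h | h
      · exact ⟨1, by rw [h]; simp⟩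
      · exact ⟨-1, by rw [h]; simp⟩
    by_cases h0 : |coord K 0| = d
    · obtain ⟨m, hm⟩ := sgn _ h0
      rcases c1 with h1 | h1
      · obtain ⟨n, hn⟩ := sgn _ h1
        exact ⟨m, n, hm, hn⟩
      · obtain ⟨n, hn⟩ := sgn _ h1
        exact ⟨m, n - m, hm, by push_cast; linarith⟩
    · obtain ⟨n, hn⟩ := sgn _ (c3.resolve_left h0)
      obtain ⟨m, hm⟩ := sgn _ (c2.resolve_left h0)
      exact ⟨m - n, n, by push_cast; linarith, hn⟩
  obtain ⟨m, n, hm, hn⟩ := hint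
  refine ⟨-(m + n), -n, ?_⟩
  have e : R K - K = dualVec ![-(m + n), -n] := by
    rw [coord_apply_zero] at hm
    rw [coord_apply_one] at hn
    have hs := sqrt_three_sq
    have hs0 := sqrt_three_ne_zero
    have hK0 : K 0 = √3 * ((m + n) * d / 2) := by
      have : K 0 / √3 = (m + n) * d / 2 := by linarith
      rw [← this]
      field_simp
    have hK1 : K 1 = (m - n) * d / 2 := by linarith
    refine plane_ext ?_ ?_
    · rw [PiLp.sub_apply, R_apply_zero, dualVec_apply_zero, hK0, hK1, hd]
      simp
      field_simp
      linear_combination (-(16 * (n : ℝ)) - 8 * m) * hs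
    · rw [PiLp.sub_apply, R_apply_one, dualVec_apply_one, hK0, hK1, hd]
      simp
      linear_combination (-(m + n : ℝ) * Real.pi / 3) * hs
  rw [e]
  simp [dualVec]

theorem R_pointK_sub : R pointK - pointK ∈ dualLattice := by
  refine ⟨0, 1, ?_⟩
  rw [pointK, map_smul, map_sub, R_k₁, R_k₂]
  push_cast
  module

theorem R_neg_pointK_sub : R (-pointK) - -pointK ∈ dualLattice := by
  have := neg_mem_dualLattice R_pointK_sub
  rw [map_neg]
  rwa [neg_sub', sub_eq_add_neg] at this

theorem neg_mem_brillouinZone {k : Plane} : -k ∈ brillouinZone ↔ k ∈ brillouinZone := by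
  rw [mem_brillouinZone_iff, mem_brillouinZone_iff]
  simp only [map_neg, Pi.neg_apply, ← neg_add, abs_neg]

/-! ### Algebra of the symmetries -/

theorem opR_opPC (f : Fn) : opR (opPC f) = opPC (opR f) := by
  refine AEEqFun.ext ?_
  have h1 := R.symm.measurePreserving.quasiMeasurePreserving.ae (coeFn_opPC f)
  have h2 := (Measure.measurePreserving_neg (volume : Measure Plane)).quasiMeasurePreserving.ae
    (coeFn_opR f)
  filter_upwards [coeFn_opR (opPC f), coeFn_opPC (opR f), h1, h2] with x e1 e2 e3 e4
  rw [e1, e2, e3, e4, map_neg]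

theorem opPC_smul (c : ℂ) (f : Fn) : opPC (c • f) = conj c • opPC f := by
  refine AEEqFun.ext ?_
  have h1 := (Measure.measurePreserving_neg (volume : Measure Plane)).quasiMeasurePreserving.ae
    (coeFn_smul' c f)
  filter_upwards [coeFn_opPC (c • f), coeFn_smul' (conj c) (opPC f), coeFn_opPC f, h1]
    with x e1 e2 e3 e4
  rw [e1, e2, e3, e4, map_mul]

theorem opR_opC (f : Fn) : opR (opC f) = opC (opR f) := by
  refine AEEqFun.ext ?_
  have h1 := R.symm.measurePreserving.quasiMeasurePreserving.ae (coeFn_opC f)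
  filter_upwards [coeFn_opR (opC f), coeFn_opC (opR f), h1, coeFn_opR f] with x e1 e2 e3 e4
  rw [e1, e2, e3, e4]

theorem opC_smul (c : ℂ) (f : Fn) : opC (c • f) = conj c • opC f := by
  refine AEEqFun.ext ?_
  filter_upwards [coeFn_opC (c • f), coeFn_smul' (conj c) (opC f), coeFn_opC f, coeFn_smul' c f]
    with x e1 e2 e3 e4
  rw [e1, e2, e3, e4, map_mul]

theorem opC_add (f g : Fn) : opC (f + g) = opC f + opC g := by
  refine AEEqFun.ext ?_
  filter_upwards [coeFn_opC (f + g), coeFn_add' (opC f) (opC g), coeFn_opC f, coeFn_opC g,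
    coeFn_add' f g] with x e1 e2 e3 e4 e5
  rw [e1, e2, e3, e4, e5, map_add]

theorem opC_zero : opC (0 : Fn) = 0 := by
  refine AEEqFun.ext ?_
  filter_upwards [coeFn_opC (0 : Fn), coeFn_zero'] with x e1 e2
  rw [e1, e2, map_zero]

theorem opR_zero : opR (0 : Fn) = 0 := by
  refine AEEqFun.ext ?_
  filter_upwards [coeFn_opR (0 : Fn), coeFn_zero',
    R.symm.measurePreserving.quasiMeasurePreserving.ae coeFn_zero'] with x e1 e2 e3
  rw [e1, e2, e3]

theorem opC_opC (f : Fn) : opC (opC f) = f := by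
  refine AEEqFun.ext ?_
  filter_upwards [coeFn_opC (opC f), coeFn_opC f] with x e1 e2
  rw [e1, e2, Complex.conj_conj]

theorem opPC_opC_opPC (f : Fn) : opPC (opC (opPC f)) = opC f := by
  refine AEEqFun.ext ?_
  have hn := (Measure.measurePreserving_neg (volume : Measure Plane)).quasiMeasurePreserving
  filter_upwards [coeFn_opPC (opC (opPC f)), hn.ae (coeFn_opC (opPC f)), hn.ae (coeFn_opPC f),
    coeFn_opC f] with x e1 e2 e3 e4
  rw [e1, e2, e3, e4, neg_neg, Complex.conj_conj]

theorem opR_opR_opR (f : Fn) : opR (opR (opR f)) = f := by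
  refine AEEqFun.ext ?_
  have hR := R.symm.measurePreserving.quasiMeasurePreserving
  filter_upwards [coeFn_opR (opR (opR f)), hR.ae (coeFn_opR (opR f)),
    hR.ae (hR.ae (coeFn_opR f))] with x e1 e2 e3
  rw [e1, e2, e3]
  congr 1
  apply R.injective
  apply R.injective
  apply R.injective
  simp only [LinearIsometryEquiv.apply_symm_apply]
  rw [R_R_R]

theorem opPC_mem_L2kσ {K : Plane} {σ : ℂ} {f : Fn} (hf : f ∈ L2kσ K σ) :
    opPC f ∈ L2kσ K (conj σ) := by
  obtain ⟨hq, hR⟩ := hf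
  have hq : IsQuasi K f := hq
  refine ⟨(show IsQuasi K fun x => conj (f (-x)) by simpa using hq.comp_neg.conj).congr
    (coeFn_opPC f), ?_⟩
  rw [opR_opPC, hR, opPC_smul]

theorem opC_mem_L2kσ {K : Plane} {σ : ℂ} {f : Fn} (hf : f ∈ L2kσ K σ) :
    opC f ∈ L2kσ (-K) (conj σ) := by
  obtain ⟨hq, hR⟩ := hf
  have hq : IsQuasi K f := hq
  refine ⟨hq.conj.congr (coeFn_opC f), ?_⟩
  rw [opR_opC, hR, opC_smul]

/-! ### Splitting of eigenspaces under the rotation of order three. -/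

/-- The component of `f` in the eigenspace of the rotation operator. -/
def rotPart (σ : ℂ) (f : Fn) : Fn := f + conj σ • opR f + (conj σ * conj σ) • opR (opR f)

/-- Averaging over the cyclic group generated by the rotation, without the factor 1/3. The two
conditions on `σ` express `|σ| = 1` and `σ³ = 1`. -/
theorem rotPart_mem {K : Plane} {S : Submodule ℂ Fn} (hS : S ≤ L2k K) (hR : ∀ f ∈ S, opR f ∈ S)
    {σ : ℂ} (h1 : conj σ * σ = 1) (h3 : conj σ * conj σ = σ) {f : Fn} (hf : f ∈ S) :
    rotPart σ f ∈ S ⊓ L2kσ K σ := by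
  have hm : rotPart σ f ∈ S := S.add_mem (S.add_mem hf (S.smul_mem _ (hR f hf)))
    (S.smul_mem _ (hR _ (hR f hf)))
  refine ⟨hm, hS hm, ?_⟩
  rw [rotPart, opR_add, opR_add, opR_smul, opR_smul, opR_opR_opR, smul_add, smul_add, smul_smul,
    smul_smul, h3, mul_comm σ, h1, one_smul]
  have : σ * σ = conj σ := by
    have := congrArg (starRingEnd ℂ) h3
    simpa using this
  rw [this]
  abel

theorem eq_sum_rotPart (f : Fn) :
    f = (1 / 3 : ℂ) • (rotPart 1 f + rotPart τ f + rotPart (conj τ) f) := by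
  have h : rotPart 1 f + rotPart τ f + rotPart (conj τ) f = (3 : ℂ) • f +
      (1 + τ + conj τ) • opR f + (1 + τ + conj τ) • opR (opR f) := by
    simp only [rotPart, map_one, one_mul, one_smul, Complex.conj_conj, conj_τ_sq, τ_sq]
    module
  have h0 : ∀ g : Fn, (1 + τ + conj τ) • g = 0 := fun g => by
    rw [one_add_τ]
    exact zero_smul ℂ g
  rw [h, h0, h0, add_zero, add_zero, smul_smul]
  norm_num

/-! ### Dirac points at the vertices. -/

/-- A degenerate energy at a vertex, with non-zero velocity, is a Dirac point. -/
theorem isDiracPointWith_of_vertex {A : Plane → Matrix (Fin 2) (Fin 2) ℂ}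
    (hA : IsHoneycombMedium A) {K : Plane} (hK : K ∈ brillouinVertices) {E_D : ℝ} {Φ₁ : Fn}
    (hτ : Module.finrank ℂ ↥(eigenspace A K E_D ⊓ L2kσ K τ) = 1)
    (hΦ : Φ₁ ∈ eigenspace A K E_D ⊓ L2kσ K τ) (h11 : ip Φ₁ Φ₁ = 1)
    (hτ' : Module.finrank ℂ ↥(eigenspace A K E_D ⊓ L2kσ K (conj τ)) = 1)
    (h1 : eigenspace A K E_D ⊓ L2kσ K 1 = ⊥) (hυ : 0 < fermiVelocity A Φ₁ (opPC Φ₁)) :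
    IsDiracPointWith A K E_D Φ₁ (opPC Φ₁) (fermiVelocity A Φ₁ (opPC Φ₁)) := by
  set Φ₂ := opPC Φ₁ with hΦ₂
  have m1 : Φ₁ ∈ eigenspace A K E_D := hΦ.1
  have m2 : Φ₂ ∈ eigenspace A K E_D := opPC_mem_eigenspace hA m1
  have s1 : Φ₁ ∈ L2kσ K τ := hΦ.2
  have s2 : Φ₂ ∈ L2kσ K (conj τ) := opPC_mem_L2kσ s1
  have q1 : IsQuasi K Φ₁ := m1.1
  have q2 : IsQuasi K Φ₂ := m2.1
  have h22 : ip Φ₂ Φ₂ = 1 := by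
    rw [ip_congr (coeFn_opPC Φ₁) (coeFn_opPC Φ₁), ip_conj_comp_neg q1 q1, h11, map_one]
  have rot : ∀ {f : Fn} {σ : ℂ}, f ∈ L2kσ K σ → (fun x => f (R.symm x)) =ᵐ[volume] fun x => σ * f x :=
    fun {f σ} hf => (coeFn_opR f).symm.trans (hf.2 ▸ coeFn_smul' σ f)
  -- Rotation invariance multiplies the inner product by `conj τ * conj τ = τ`, which differs from
  -- 1.
  have h12 : ip Φ₁ Φ₂ = 0 := by
    have e := ip_comp_R_symm q1 q2
    rw [ip_congr (rot s1) (rot s2), ip_const_mul_left, ip_const_mul_right, ← mul_assoc,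
      conj_τ_sq] at e
    have : (τ - 1) * ip Φ₁ Φ₂ = 0 := by linear_combination e
    exact (mul_eq_zero.1 this).resolve_left (sub_ne_zero.2 τ_ne_one)
  have n1 : Φ₁ ≠ 0 := by
    intro h
    rw [ip_congr (f' := fun _ => 0) (g' := fun _ => 0) (h ▸ coeFn_zero') (h ▸ coeFn_zero')] at h11
    simp [ip] at h11
  have n2 : Φ₂ ≠ 0 := by
    intro h
    rw [ip_congr (f' := fun _ => 0) (g' := fun _ => 0) (h ▸ coeFn_zero') (h ▸ coeFn_zero')] at h22
    simp [ip] at h22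
  have hRS : ∀ f ∈ eigenspace A K E_D, opR f ∈ eigenspace A K E_D := fun f hf => by
    have := opR_mem_eigenspace hA hf
    rwa [eigenspace_eq_of_sub_mem A (R_sub_mem_dualLattice hK)] at this
  -- Each eigenfunction is a third of the sum of its three rotation parts: the invariant part is
  -- excluded by hypothesis and the other two are multiples of `Φ₁` and `Φ₂`.
  have hspan : eigenspace A K E_D = Submodule.span ℂ {Φ₁, Φ₂} := by
    refine le_antisymm (fun f hf => ?_) (Submodule.span_le.2 ?_)
    · have hS : eigenspace A K E_D ≤ L2k K := fun f hf => hf.1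
      have p0 := rotPart_mem hS hRS (σ := 1) (by simp) (by simp) hf
      have p1 := rotPart_mem hS hRS (σ := τ) conj_τ_mul_τ conj_τ_sq hf
      have p2 := rotPart_mem hS hRS (σ := conj τ)
        (by rw [Complex.conj_conj, mul_comm, conj_τ_mul_τ]) (by rw [Complex.conj_conj, τ_sq]) hf
      rw [h1, Submodule.mem_bot] at p0
      obtain ⟨a, ha⟩ := (finrank_eq_one_iff_of_nonzero' (⟨Φ₁, hΦ⟩ :
        ↥(eigenspace A K E_D ⊓ L2kσ K τ)) fun h => n1 (congrArg Subtype.val h)).1 hτ ⟨_, p1⟩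
      obtain ⟨b, hb⟩ := (finrank_eq_one_iff_of_nonzero' (⟨Φ₂, m2, s2⟩ :
        ↥(eigenspace A K E_D ⊓ L2kσ K (conj τ))) fun h => n2 (congrArg Subtype.val h)).1 hτ' ⟨_, p2⟩
      have ha' : a • Φ₁ = rotPart τ f := congrArg Subtype.val ha
      have hb' : b • Φ₂ = rotPart (conj τ) f := congrArg Subtype.val hb
      rw [eq_sum_rotPart f, p0, ← ha', ← hb', zero_add]
      refine Submodule.smul_mem _ _ (Submodule.add_mem _ ?_ ?_)
      · exact Submodule.smul_mem _ _ (Submodule.subset_span (by simp))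
      · exact Submodule.smul_mem _ _ (Submodule.subset_span (by simp))
    · rintro f (rfl | rfl)
      · exact m1
      · exact m2
  obtain ⟨g1, hg1, -⟩ := m1.2
  obtain ⟨g2, hg2, -⟩ := m2.2
  have hI : ip Φ₁ (opA A Φ₂ 1) = I * ip Φ₁ (opA A Φ₂ 0) :=
    eq_I_mul_of_rotation (h := fun l => ip Φ₁ (opA A Φ₂ l)) fun j => by
      rw [← conj_τ_sq]
      exact ip_opA_rotation hA q1 q2 s1.2 s2.2 hg2 j
  -- Along `(1, i)` the two terms of the Fermi velocity coincide, and the factor 1/2 in its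
  -- definition makes it the modulus of the coefficient `c`.
  have hυ' : fermiVelocity A Φ₁ Φ₂ = ‖ip Φ₁ (opA A Φ₂ 0)‖ := by
    have e : conj (ip Φ₁ (opA A Φ₂ 0)) * 1 + conj (I * ip Φ₁ (opA A Φ₂ 0)) * I =
        2 * conj (ip Φ₁ (opA A Φ₂ 0)) := by
      rw [map_mul, Complex.conj_I]
      linear_combination -conj (ip Φ₁ (opA A Φ₂ 0)) * I_sq
    rw [fermiVelocity, hI, e, norm_mul, RCLike.norm_conj]
    norm_num
    ring
  rw [hυ'] at hυ ⊢
  refine isDiracPointWith_of_velocity hA hK.1 s1 rfl s2 h11 h22 h12 hspan (norm_pos_iff.1 hυ)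
    (fun κ => ?_) (fun l => ?_) (fun l => ?_)
  · rw [Fin.sum_univ_two, hI]; ring
  -- For a mode paired with itself the scalar factor is `conj τ * τ = 1`, so the velocity is a
  -- rotation invariant vector and vanishes.
  · refine eq_zero_of_rotation (h := fun l => ip Φ₁ (opA A Φ₁ l)) (fun j => ?_) l
    have := ip_opA_rotation hA q1 q1 s1.2 s1.2 hg1 j
    rwa [conj_τ_mul_τ, one_mul] at this
  · refine eq_zero_of_rotation (h := fun l => ip Φ₂ (opA A Φ₂ l)) (fun j => ?_) l
    have := ip_opA_rotation hA q2 q2 s2.2 s2.2 hg2 j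
    rwa [Complex.conj_conj, mul_comm τ, conj_τ_mul_τ, one_mul] at this

/-! ### Real media -/

theorem opC_mem_eigenspace {A : Plane → Matrix (Fin 2) (Fin 2) ℂ} (hr : IsRealValued A)
    {k : Plane} {E : ℝ} {f : Fn} (hf : f ∈ eigenspace A k E) : opC f ∈ eigenspace A (-k) E := by
  obtain ⟨hq, g, hg, hl, hs⟩ := hf
  have hq : IsQuasi k f := hq
  have hfl : ∀ i, flux A (fun j x => conj (g j x)) i = fun x => conj (flux A g i x) := by
    intro i
    funext x
    rw [flux, flux, map_sum]
    refine Finset.sum_congr rfl fun j _ => ?_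
    rw [map_mul, Complex.conj_eq_iff_im.2 (hr x i j)]
  refine ⟨hq.conj.congr (coeFn_opC f), IsWeakSol.congr ⟨_, hg.conj, fun i => ?_, fun φ hφ => ?_⟩
    (coeFn_opC f)⟩
  · rw [hfl]
    exact (hl i).conj
  · have := congrArg (starRingEnd ℂ) (hs _ hφ.conj)
    rw [map_sum, map_mul, Complex.conj_ofReal, ← integral_conj] at this
    simp only [← integral_conj, map_mul, Complex.conj_conj, pd_conj] at this
    simp only [hfl]
    exact this

theorem isEigenpair_opC_iff {A : Plane → Matrix (Fin 2) (Fin 2) ℂ} (hr : IsRealValued A)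
    (k : Plane) (E : ℝ) (f : Fn) : IsEigenpair A k E f ↔ IsEigenpair A (-k) E (opC f) := by
  constructor
  · rintro ⟨h, hne⟩
    refine ⟨opC_mem_eigenspace hr h, fun h' => hne ?_⟩
    rw [← opC_opC f, h', opC_zero]
  · rintro ⟨h, hne⟩
    refine ⟨?_, fun h' => hne (by rw [h', opC_zero])⟩
    have := opC_mem_eigenspace hr h
    rwa [opC_opC, neg_neg] at this

theorem ip_opC (f g : Fn) : ip (opC f) (opC g) = conj (ip f g) := by
  rw [ip_congr (coeFn_opC f) (coeFn_opC g), ip, ip, ← integral_conj]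
  simp only [map_mul]

theorem ip_opC_left (f g : Fn) : ip (opC f) g = conj (ip f (opC g)) := by
  rw [← ip_opC, opC_opC]

theorem IsBandStructure.conj {A : Plane → Matrix (Fin 2) (Fin 2) ℂ} (hr : IsRealValued A)
    {E : ℕ → Plane → ℝ} {Φ : ℕ → Plane → Fn} (h : IsBandStructure A E Φ) :
    IsBandStructure A (fun b k => E b (-k)) fun b k => opC (Φ b (-k)) where
  mono k := h.mono (-k)
  unbounded k := h.unbounded (-k)
  eigen b k := by
    have := (isEigenpair_opC_iff hr _ _ _).1 (h.eigen b (-k))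
    rwa [neg_neg] at this
  orthonormal k b b' := by
    rw [ip_opC, h.orthonormal]
    split_ifs <;> simp
  complete k f hf h0 := by
    have hf' : opC f ∈ L2k (-k) := by
      have hf : IsQuasi k f := hf
      exact hf.conj.congr (coeFn_opC f)
    have h1 := h.complete (-k) (opC f) hf' fun b => by
      have := h0 b
      rw [ip_opC_left] at this
      simpa using this
    rw [← opC_opC f, h1, opC_zero]

/-- Conjugation reflects the bands by `k ↦ -k` and turns rotation type `τ` into `conj τ`. The modes
therefore exchange their places, with `opC Φ₂` now of type `τ`. -/
theorem IsDiracPointWith.conj {A : Plane → Matrix (Fin 2) (Fin 2) ℂ} (hr : IsRealValued A)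
    {K : Plane} {E_D : ℝ} {Φ₁ Φ₂ : Fn} {υ : ℝ} (h : IsDiracPointWith A K E_D Φ₁ Φ₂ υ) :
    IsDiracPointWith A (-K) E_D (opC Φ₂) (opC Φ₁) υ := by
  obtain ⟨hK, E, Φ, hB, b, hb, hb1, hrank, hs1, h2, hs2, h11, h22, h12, hspan, hυ, ζ, hζ, ep, em,
    ⟨L, hL⟩, ⟨L', hL'⟩, ⟨C, hC⟩, hexp⟩ := h
  have t2 := opC_mem_L2kσ hs1
  have t1 := opC_mem_L2kσ hs2
  rw [Complex.conj_conj] at t1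
  have i21 : ip (opC Φ₂) (opC Φ₁) = 0 := by
    have q1 : IsQuasi K Φ₁ := hs1.1
    have q2 : IsQuasi K Φ₂ := hs2.1
    rw [ip_opC, ← inner_toCell q2 q1, inner_conj_symm, inner_toCell, h12]
  have i22 : ip (opC Φ₂) (opC Φ₂) = 1 := by rw [ip_opC, h22, map_one]
  have i11 : ip (opC Φ₁) (opC Φ₁) = 1 := by rw [ip_opC, h11, map_one]
  have hspan' : eigenspace A (-K) E_D = Submodule.span ℂ {opC Φ₂, opC Φ₁} := by
    refine le_antisymm (fun f hf => ?_) (Submodule.span_le.2 ?_)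
    · have hf' := opC_mem_eigenspace hr hf
      rw [neg_neg, hspan, Submodule.mem_span_pair] at hf'
      obtain ⟨s, t, hst⟩ := hf'
      rw [Submodule.mem_span_pair]
      refine ⟨conj t, conj s, ?_⟩
      rw [← opC_smul, ← opC_smul, ← opC_add, add_comm, hst, opC_opC]
    · rintro f (rfl | rfl)
      · exact opC_mem_eigenspace hr (hspan ▸ Submodule.subset_span (by simp))
      · exact opC_mem_eigenspace hr (hspan ▸ Submodule.subset_span (by simp))
  have hball : ∀ k ∈ Metric.ball (-K) ζ, -k ∈ Metric.ball K ζ := fun k hk => by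
    rw [Metric.mem_ball, ← dist_neg_neg, neg_neg]
    exact hk
  have hnorm : ∀ k, ‖-k - K‖ = ‖k - -K‖ := fun k => by
    rw [← norm_neg]
    congr 1
    abel
  have hcomp : ∀ (e : Plane → ℝ) (L : NNReal), LipschitzOnWith L e (Metric.ball K ζ) →
      LipschitzOnWith L (fun k => e (-k)) (Metric.ball (-K) ζ) := by
    intro e L he
    refine LipschitzOnWith.of_dist_le_mul fun x hx y hy => ?_
    have := he.dist_le_mul _ (hball x hx) _ (hball y hy)
    rwa [dist_neg_neg] at this
  refine ⟨neg_mem_brillouinZone.2 hK, _, _, hB.conj hr, b, by rw [neg_neg, hb],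
    by rw [neg_neg, hb1], ?_, t1, ?_, t2, i22, i11, i21, hspan', hυ, ζ, hζ, fun k => ep (-k),
    fun k => em (-k), ⟨L, hcomp _ _ hL⟩, ⟨L', hcomp _ _ hL'⟩, ⟨C, fun k hk => ?_⟩, fun k hk => ?_⟩
  · rw [hspan', finrank_span_pair_of_ip t1.1 t2.1 i22 i21 i11]
  · rw [h2, opPC_opC_opPC]
  · rw [← hnorm]
    exact hC _ (hball k hk)
  · rw [← hnorm]
    exact hexp _ (hball k hk)

/-- For real coefficients only the factor `1/i` feels the conjugation, whence the sign. -/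
theorem opA_conj {A : Plane → Matrix (Fin 2) (Fin 2) ℂ} (hr : IsRealValued A) {f : Plane → ℂ}
    {g : Fin 2 → Plane → ℂ} (hg : IsWeakGrad f g) (j : Fin 2) :
    opA A (fun x => conj (f x)) j =ᵐ[volume] fun x => -conj (opA A f j x) := by
  have hc : ∀ x i j, conj (A x i j) = A x i j := fun x i j => Complex.conj_eq_iff_im.2 (hr x i j)
  have hd : ∀ x i j l, conj (pd l (fun y => A y i j) x) = pd l (fun y => A y i j) x := by
    intro x i j l
    rw [← pd_conj]
    simp only [hc]
  filter_upwards [opA_ae_eq (A := A) hg j, opA_ae_eq (A := A) hg.conj j] with x h1 h2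
  rw [h1, h2]
  simp only [divCoef, Fin.sum_univ_two, map_mul, map_add, map_neg, Complex.conj_I, hc, hd]
  ring

/-- Conjugation gives `-conj ⟨g, 𝒜 f⟩`, which equals `-⟨f, 𝒜 g⟩` by symmetry of the velocity
operator; the modulus removes the sign. -/
theorem fermiVelocity_opC {A : Plane → Matrix (Fin 2) (Fin 2) ℂ} (hA : IsHoneycombMedium A)
    (hr : IsRealValued A) {k : Plane} {E : ℝ} {f g : Fn} (hf : f ∈ eigenspace A k E)
    (hg : g ∈ eigenspace A k E) : fermiVelocity A f g = fermiVelocity A (opC g) (opC f) := by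
  obtain ⟨q1, w1, hw1, -⟩ := (mem_eigenspace_iff hA).1 hf
  obtain ⟨q2, w2, hw2, -⟩ := (mem_eigenspace_iff hA).1 hg
  obtain ⟨-, G, hG, -⟩ := hf
  have h : ∀ l, ip (opC g) (opA A (opC f) l) = -ip f (opA A g l) := by
    intro l
    have e1 : opA A (opC f) l =ᵐ[volume] fun x => -conj (opA A f l x) :=
      (opA_congr hG.conj (coeFn_opC f) l).trans (opA_conj hr hG l)
    rw [ip_congr (coeFn_opC g) e1, ip_opA hA q1 q2 hw1 hw2, inner_velOp_symm,
      ← ip_opA hA q2 q1 hw2 hw1, ip, ip, ← integral_conj, ← integral_neg]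
    congr 1
    funext x
    rw [map_mul, mul_neg]
  rw [fermiVelocity, fermiVelocity, h, h]
  congr 1
  rw [map_neg, map_neg, ← norm_neg]
  congr 1
  ring

theorem iterate_R_sub_mem {K : Plane} (hK : R K - K ∈ dualLattice) (j : ℕ) :
    R^[j] K - K ∈ dualLattice := by
  induction j with
  | zero => exact ⟨0, 0, by simp⟩
  | succ j ih =>
    rw [Function.iterate_succ_apply']
    obtain ⟨m, n, h⟩ := R_mem_dualLattice ih
    obtain ⟨m', n', h'⟩ := hK
    refine ⟨m + m', n + n', ?_⟩
    have : R (R^[j] K) - K = R (R^[j] K - K) + (R K - K) := by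
      rw [map_sub]; abel
    rw [this, h, h']
    push_cast
    module

theorem opR_iterate_isEigenpair {A : Plane → Matrix (Fin 2) (Fin 2) ℂ} (hA : IsHoneycombMedium A)
    {K : Plane} (hK : R K - K ∈ dualLattice) {E : ℝ} {f : Fn} (hf : IsEigenpair A K E f) (j : ℕ) :
    IsEigenpair A K E (opR^[j] f) := by
  induction j with
  | zero => exact hf
  | succ j ih =>
    rw [Function.iterate_succ_apply']
    refine ⟨?_, fun h => ih.2 ?_⟩
    · have := opR_mem_eigenspace hA ih.1
      rwa [eigenspace_eq_of_sub_mem A hK] at this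
    · rw [← opR_opR_opR (opR^[j] f), h, opR_zero, opR_zero]

end Honeycomb

end

/-! ### The theorem. -/

theorem mainTheorem1 (A : Plane → Matrix (Fin 2) (Fin 2) ℂ)
    (hA : IsHoneycombMedium A) :
    -- the vertices of the Brillouin zone
    (∀ K ∈ brillouinVertices, ∀ (E_D : ℝ) (Φ₁ : Fn),
      Module.finrank ℂ
        ↥(eigenspace A K E_D ⊓ L2kσ K τ) = 1 →
      Φ₁ ∈ eigenspace A K E_D ⊓ L2kσ K τ →
      ip Φ₁ Φ₁ = 1 →
      Module.finrank ℂ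
        ↥(eigenspace A K E_D ⊓ L2kσ K (conj τ)) = 1 →
      eigenspace A K E_D ⊓ L2kσ K 1 = ⊥ →
      0 < fermiVelocity A Φ₁ (opPC Φ₁) →
      IsDiracPointWith A K E_D Φ₁ (opPC Φ₁)
        (fermiVelocity A Φ₁ (opPC Φ₁))) ∧
    -- real-valued media
    (IsRealValued A →
      (∀ (E : ℝ) (Φ : Fn),
        IsEigenpair A pointK E Φ ↔
          IsEigenpair A (-pointK) E (opC Φ)) ∧
      (∀ (E_D : ℝ) (Φ₁ : Fn) (υ : ℝ),
        IsDiracPointWith A pointK E_D Φ₁ (opPC Φ₁) υ ↔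
          IsDiracPointWith A (-pointK) E_D
            (opC (opPC Φ₁)) (opC Φ₁) υ) ∧
      (∀ K ∈ ({pointK, -pointK} : Set Plane),
        ∀ (E : ℝ) (Φ : Fn) (j : ℕ),
          (IsEigenpair A (R^[j] K) E Φ ↔ IsEigenpair A K E Φ) ∧
          (IsEigenpair A K E Φ →
            IsEigenpair A K E (opR^[j] Φ))) ∧
      (∀ (E_D : ℝ) (Φ₁ : Fn) (υ : ℝ),
        IsDiracPointWith A pointK E_D Φ₁ (opPC Φ₁) υ →
          fermiVelocity A Φ₁ (opPC Φ₁) =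
            fermiVelocity A (opC (opPC Φ₁))
              (opC Φ₁))) := by
  refine ⟨fun K hK E_D Φ₁ hτ hΦ h11 hτ' h1 hυ =>
    isDiracPointWith_of_vertex hA hK hτ hΦ h11 hτ' h1 hυ, fun hr =>
    ⟨isEigenpair_opC_iff hr pointK, fun E_D Φ₁ υ => ⟨fun h => h.conj hr, fun h => ?_⟩,
      fun K hK E Φ j => ?_, fun E_D Φ₁ υ h => ?_⟩⟩
  -- Conjugation is an involution on quasi-momenta and modes, so the converse follows from the same
  -- implication.
  · have := h.conj hr
    rwa [neg_neg, opC_opC, opC_opC] at this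
  · have hR : R K - K ∈ dualLattice := by
      rcases hK with rfl | rfl
      · exact R_pointK_sub
      · exact R_neg_pointK_sub
    refine ⟨?_, fun h => opR_iterate_isEigenpair hA hR h j⟩
    rw [IsEigenpair, IsEigenpair, eigenspace_eq_of_sub_mem A (iterate_R_sub_mem hR j) E]
  · obtain ⟨-, -, -, -, -, -, -, -, -, -, -, -, -, -, hspan, -⟩ := h
    exact fermiVelocity_opC hA hr (hspan ▸ Submodule.subset_span (by simp))
      (hspan ▸ Submodule.subset_span (by simp))
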